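/- **Setting.** Let $\mathbb{T}^3=(\mathbb{R}/\mathbb{Z})^3$ and $m(v)=(2\pi)^{-3/2}e^{-|v|^2/2}$ for $v\in\mathbb{R}^3$. For a distribution function $F(x,v,t)$ on $\mathbb{T}^3\times\mathbb{R}^3\times[0,T_*)$ put $$\rho=\int F\,dv,\quad \rho U=\int Fv\,dv,\quad 3\rho T=\int F|v-U|^2dv,\quad q=\int F(v-U)|v-U|^2dv,$$ $$\mathcal{S}_{Pr}(F)=\frac{\rho}{\sqrt{2\pi T}^3}e^{-\frac{|v-U|^2}{2T}}\left[1+\frac{1-Pr}{5}\,\frac{q\cdot(v-U)}{\rho T^2}\left(\frac{|v-U|^2}{2T}-\frac52\right)\right],\qquad \frac1\tau=\frac1{\tau_0}\rho^{\eta}T^{w},$$ where $\tau_0>0$, $\eta\ge0$, $w\in\mathbb{R}$. The Shakhov model is $\partial_tF+v\cdot\nabla_xF=\frac1\tau(\mathcal{S}_{Pr}(F)-F)$, $F|_{t=0}=F_0$. The perturbation $f$ is defined by $F=m+\sqrt m f$, and $F_0=m+\sqrt m f_0$. The linearized operator is $L_{Pr}f=P_cf+(1-Pr)P_{nc}f-f$,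 where $$P_cf=\Big(\int f\sqrt m\,dv\Big)\sqrt m+\Big(\int fv\sqrt m\,dv\Big)\cdot v\sqrt m+\Big(\int f\tfrac{|v|^2-3}{\sqrt6}\sqrt m\,dv\Big)\tfrac{|v|^2-3}{\sqrt6}\sqrt m,$$ $$P_{nc}f=\Big(\int f\tfrac{v(|v|^2-5)}{\sqrt{10}}\sqrt m\,dv\Big)\cdot\tfrac{v(|v|^2-5)}{\sqrt{10}}\sqrt m.$$ For $\alpha\in\mathbb{N}^4$, $\beta\in\mathbb{N}^3$ write $\partial^\alpha_\beta=\partial_t^{\alpha_0}\partial_{x_1}^{\alpha_1}\partial_{x_2}^{\alpha_2}\partial_{x_3}^{\alpha_3}\partial_{v_1}^{\beta_1}\partial_{v_2}^{\beta_2}\partial_{v_3}^{\beta_3}$ and $\partial^\alpha=\partial^\alpha_0$, and let $$\mathcal{E}(t)=\frac12\sum_{|\alpha|+|\beta|\le N}\|\partial^\alpha_\beta f(t)\|_{L^2_{x,v}}^2+\sum_{|\alpha|+|\beta|\le N}\int_0^t\|\partial^\alpha_\beta f(s)\|_{L^2_{x,v}}^2ds.$$ **Theorem.** Let $Pr=0$,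 $N\ge3$, $\tau_0>0$, $\eta\ge0$ and $w\in\mathbb{R}$. There are constants $M_0>0$, $\delta>0$ and $C>0$, depending only on $N,\tau_0,\eta,w$, with the following property. Let $T_*>0$ and let $f\in\bigcap_{k=0}^{N}C^k([0,T_*);H^{N-k}(\mathbb{T}^3\times\mathbb{R}^3))$ be such that $F=m+\sqrt mf$ solves the Shakhov model with $Pr=0$ on $[0,T_*)$ (for every $t$, almost everywhere in $(x,v)$), $F_0\ge0$, and $\mathcal{E}(t)\le M_0$ for all $0\le t<T_*$. Suppose that $F_0$ has the same total mass, momentum and energy as $m$, $$\int_{\mathbb{T}^3\times\mathbb{R}^3}F_0\,(1,v,|v|^2)\,dvdx=\int_{\mathbb{T}^3\times\mathbb{R}^3}m\,(1,v,|v|^2)\,dvdx,$$ and that its total third moment vanishes, $$\int_{\mathbb{T}^3\times\mathbb{R}^3}F_0\,v_i|v|^2\,dvdx=0\qquad(i=1,2,3).$$ Then for every $0\le t<T_*$, $$\sum_{|\alpha|\le N}\langle L_0\,\partial^\alpha f(t),\partial^\alpha f(t)\rangle_{L^2_{x,v}}\le-\delta\sum_{|\alpha|\le N}\|\partial^\alpha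 f(t)\|_{L^2_{x,v}}^2+C\,\mathcal{E}(t)^2.$$ -/

import Mathlib

open MeasureTheory Set
open scoped ContDiff

noncomputable section

namespace Shakhov

/-- The spatial domain `𝕋³ = (ℝ/ℤ)³`, with its Haar probability measure as `volume`. -/
abbrev Torus := UnitAddTorus (Fin 3)

/-- The velocity space `ℝ³` with the Euclidean norm. -/
abbrev Vel := EuclideanSpace ℝ (Fin 3)

/-- The phase space `𝕋³ × ℝ³`. -/
abbrev Phase := Torus × Vel

/-- The real Hilbert space `L²(𝕋³ × ℝ³)`. -/
abbrev L2 := Lp ℝ 2 (volume : Measure Phase)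

/-! ### The Shakhov operator -/

/-- The normalized global Maxwellian `m(v) = (2π)^{-3/2} exp(-|v|²/2)`. -/
def maxwellian (v : Vel) : ℝ :=
  1 / √((2 * Real.pi) ^ 3) * Real.exp (-‖v‖ ^ 2 / 2)

/-- `√m`. -/
def sqrtMaxwellian (v : Vel) : ℝ := √(maxwellian v)

/-- The distribution function `F = m + √m f` of a perturbation `f`. -/
def density (f : Phase → ℝ) (p : Phase) : ℝ :=
  maxwellian p.2 + sqrtMaxwellian p.2 * f p

/-- Macroscopic density `ρ = ∫ F dv`. In this and the next definitions `F` is a function of the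
velocity alone: the distribution function at a given time and place. -/
def rho (F : Vel → ℝ) : ℝ := ∫ v, F v

/-- Bulk velocity: `ρ U = ∫ F v dv`. -/
def bulkVelocity (F : Vel → ℝ) : Vel := (rho F)⁻¹ • ∫ v, F v • v

/-- Temperature: `3 ρ T = ∫ F |v - U|² dv`. -/
def temperature (F : Vel → ℝ) : ℝ :=
  (∫ v, F v * ‖v - bulkVelocity F‖ ^ 2) / (3 * rho F)

/-- Heat flux `q = ∫ F (v - U) |v - U|² dv`. -/
def heatFlux (F : Vel → ℝ) : Vel :=
  ∫ v, (F v * ‖v - bulkVelocity F‖ ^ 2) • (v - bulkVelocity F)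

/-- The local Maxwellian `𝓜(F)`. -/
def localMaxwellian (F : Vel → ℝ) (v : Vel) : ℝ :=
  rho F / √(2 * Real.pi * temperature F) ^ 3 *
    Real.exp (-‖v - bulkVelocity F‖ ^ 2 / (2 * temperature F))

/-- The Shakhov operator `𝓢_Pr(F)`. -/
def shakhovOp (Pr : ℝ) (F : Vel → ℝ) (v : Vel) : ℝ :=
  localMaxwellian F v *
    (1 + (1 - Pr) / 5 *
      (inner ℝ (heatFlux F) (v - bulkVelocity F) / (rho F * temperature F ^ 2)) *
      (‖v - bulkVelocity F‖ ^ 2 / (2 * temperature F) - 5 / 2))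

/-- The collision frequency `1/τ = (1/τ₀) ρ^η T^w`. -/
def collisionFreq (τ₀ η w : ℝ) (F : Vel → ℝ) : ℝ :=
  1 / τ₀ * rho F ^ η * temperature F ^ w

/-! ### The linearized operator -/

/-- The projection `P_c` on the span of `√m, v √m, |v|² √m`. -/
def projC (f : Phase → ℝ) (p : Phase) : ℝ :=
  (∫ u, f (p.1, u) * sqrtMaxwellian u) * sqrtMaxwellian p.2 +
  (∑ i : Fin 3, (∫ u, f (p.1, u) * (u i * sqrtMaxwellian u)) * (p.2 i * sqrtMaxwellian p.2)) +
  (∫ u, f (p.1, u) * ((‖u‖ ^ 2 - 3) / √6 * sqrtMaxwellian u)) *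
    ((‖p.2‖ ^ 2 - 3) / √6 * sqrtMaxwellian p.2)

/-- The projection `P_nc` on the span of `v (|v|² - 5) √m`. -/
def projNC (f : Phase → ℝ) (p : Phase) : ℝ :=
  ∑ i : Fin 3, (∫ u, f (p.1, u) * (u i * (‖u‖ ^ 2 - 5) / √10 * sqrtMaxwellian u)) *
    (p.2 i * (‖p.2‖ ^ 2 - 5) / √10 * sqrtMaxwellian p.2)

/-- The linearized operator `L_Pr f = P_c f + (1 - Pr) P_nc f - f`. -/
def linearOp (Pr : ℝ) (f : Phase → ℝ) (p : Phase) : ℝ :=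
  projC f p + (1 - Pr) * projNC f p - f p

/-! ### Derivatives -/

/-- Test functions on `𝕋³ × ℝ³`: smooth (as functions periodic in `x`) and compactly supported. -/
structure IsTest (φ : Phase → ℝ) : Prop where
  smooth : ContDiff ℝ ∞
    fun p : (Fin 3 → ℝ) × Vel => φ (fun i => (p.1 i : UnitAddCircle), p.2)
  compact : HasCompactSupport φ

/-- The classical partial derivative `∂φ/∂x_i`. -/
def partialX (i : Fin 3) (φ : Phase → ℝ) (p : Phase) : ℝ :=
  deriv (fun s : ℝ => φ (p.1 + Pi.single i (s : UnitAddCircle), p.2)) 0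

/-- The classical partial derivative `∂φ/∂v_i`. -/
def partialV (i : Fin 3) (φ : Phase → ℝ) (p : Phase) : ℝ :=
  deriv (fun s : ℝ => φ (p.1, p.2 + EuclideanSpace.single i s)) 0

/-- `g` is the weak derivative `∂_{x_i} f`. -/
def IsWeakDerivX (i : Fin 3) (f g : L2) : Prop :=
  ∀ φ : Phase → ℝ, IsTest φ → ∫ p, f p * partialX i φ p = -∫ p, g p * φ p

/-- `g` is the weak derivative `∂_{v_i} f`. -/
def IsWeakDerivV (i : Fin 3) (f g : L2) : Prop :=
  ∀ φ : Phase → ℝ, IsTest φ → ∫ p, f p * partialV i φ p = -∫ p, g p * φ p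

/-- The order `|α|` of a multi-index. -/
def order {n : ℕ} (α : Fin n → ℕ) : ℕ := ∑ i, α i

/-- `f` lies in `C^k([0,T); H^{N-k}(𝕋³ × ℝ³))` for `k = 0, …, N`, and
`D α β = ∂_t^{α₀} ∂_{x₁}^{α₁} ∂_{x₂}^{α₂} ∂_{x₃}^{α₃} ∂_{v₁}^{β₁} ∂_{v₂}^{β₂} ∂_{v₃}^{β₃} f`
whenever `|α| + |β| ≤ N`. These conditions determine those `D α β` on `[0,T)`. Derivatives in time
are derivatives of `L²`-valued functions (one-sided at `0`), those in `x` and `v` are weak. -/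
structure HasDerivatives (N : ℕ) (T : ℝ) (f : ℝ → L2)
    (D : (Fin 4 → ℕ) → (Fin 3 → ℕ) → ℝ → L2) : Prop where
  zero : ∀ t ∈ Ico 0 T, D 0 0 t = f t
  continuousOn : ∀ α β, order α + order β ≤ N → ContinuousOn (D α β) (Ico 0 T)
  time : ∀ α β, order α + order β < N → ∀ t ∈ Ico 0 T,
    HasDerivWithinAt (D α β) (D (α + Pi.single 0 1) β t) (Ico 0 T) t
  space : ∀ α β, order α + order β < N → ∀ i : Fin 3, ∀ t ∈ Ico 0 T,
    IsWeakDerivX i (D α β t) (D (α + Pi.single i.succ 1) β t)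
  velocity : ∀ α β, order α + order β < N → ∀ i : Fin 3, ∀ t ∈ Ico 0 T,
    IsWeakDerivV i (D α β t) (D α (β + Pi.single i 1) t)

/-- The multi-indices in `n` variables of order at most `N`. -/
def multiIndices (n N : ℕ) : Finset (Fin n → ℕ) :=
  (Fintype.piFinset fun _ => Finset.range (N + 1)).filter fun α => order α ≤ N

/-- The pairs `(α, β)` with `|α| + |β| ≤ N`. -/
def multiIndexPairs (N : ℕ) : Finset ((Fin 4 → ℕ) × (Fin 3 → ℕ)) :=
  (multiIndices 4 N ×ˢ multiIndices 3 N).filter fun ab => order ab.1 + order ab.2 ≤ N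

/-- The energy functional
`𝓔(t) = ½ ∑ ‖∂^α_β f(t)‖² + ∑ ∫₀ᵗ ‖∂^α_β f(s)‖² ds`, sums over `|α| + |β| ≤ N`. -/
def energy (N : ℕ) (D : (Fin 4 → ℕ) → (Fin 3 → ℕ) → ℝ → L2) (t : ℝ) : ℝ :=
  1 / 2 * ∑ ab ∈ multiIndexPairs N, ‖D ab.1 ab.2 t‖ ^ 2 +
    ∑ ab ∈ multiIndexPairs N, ∫ s in (0 : ℝ)..t, ‖D ab.1 ab.2 s‖ ^ 2

/-! ### Solutions -/

/-- `f`, with partial derivatives `D`, is a solution on `[0,T)` of the perturbed Shakhov model with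
Prandtl number `Pr`: `F = m + √m f` satisfies `∂_t F + v · ∇_x F = (1/τ) (𝓢_Pr(F) - F)`. -/
structure IsSolution (Pr τ₀ η w : ℝ) (N : ℕ) (T : ℝ) (f : ℝ → L2)
    (D : (Fin 4 → ℕ) → (Fin 3 → ℕ) → ℝ → L2) : Prop where
  derivatives : HasDerivatives N T f D
  equation : ∀ t ∈ Ico 0 T, ∀ᵐ p : Phase,
    sqrtMaxwellian p.2 *
        (D (Pi.single 0 1) 0 t p + ∑ i : Fin 3, p.2 i * D (Pi.single i.succ 1) 0 t p) =
      collisionFreq τ₀ η w (fun u => density (f t) (p.1, u)) *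
        (shakhovOp Pr (fun u => density (f t) (p.1, u)) p.2 - density (f t) p)

/-- `F₀ = m + √m f₀` has the total mass, momentum and energy of `m`. -/
structure SameConserved (f₀ : L2) : Prop where
  mass : ∫ p : Phase, density f₀ p = ∫ p : Phase, maxwellian p.2
  momentum : ∀ i : Fin 3,
    ∫ p : Phase, density f₀ p * p.2 i = ∫ p : Phase, maxwellian p.2 * p.2 i
  energy : ∫ p : Phase, density f₀ p * ‖p.2‖ ^ 2 = ∫ p : Phase, maxwellian p.2 * ‖p.2‖ ^ 2

end Shakhov

end

noncomputable section

namespace Shakhov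

open Filter Topology

section

/-! ### Polynomials in the velocity and their Gaussian moments -/

/-! For `Pr = 0` the linearized operator acts at each `x` as the orthogonal projection onto the
eight-dimensional span of `√m`, `v√m`, `|v|²√m`, `v|v|²√m`, minus the identity. Hence
`integral_linearOp`: the quadratic form is minus the squared distance to that span. It says nothing
about the macroscopic part, so the theorem amounts to a bound, along solutions, of the macroscopic
part by the microscopic one (`micro`) up to an error `quad` = `b² + ∫₀ᵗ b²`, where `b² = ∑ ‖∂^α
f‖²`. As `quad` is at most twice the energy, its square is an admissible error.

The macroscopic part is recovered from moment equations. The moments of `1`, `v`, `|v|²` have no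
collision term. For `Pr = 0` the Shakhov correction carries the whole heat flux of `F`, so the
moment of `v|v|²` has no linear collision term either: by `collision_XSq` what remains is the bulk
velocity times a stress deviation. The polynomials `χ = 3 v_i v_j - δ_ij |v|²` and `χ|v|²` are
orthogonal to the kernel and relax at rate `1/τ₀` up to quadratic terms. In their equations
everything except the spatial flux is therefore microscopic or quadratic, so the flux is controlled.
Modulo polynomials orthogonal to the kernel, the two fluxes are traceless symmetric gradients: of
the moments of `v|v|²`, and of those of `14 v|v|² - 35 v`. Korn's inequality turns this into control
of all spatial gradients of the moments of `v|v|²` and `v` (`controlled_grad_XSq`,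
`controlled_grad_X`).

The balance laws yield the rest. Mass and energy balance give the time derivatives of the moments of
`1` and `|v|²`. Differentiating the equations for `v` and `v|v|²` once in space gives the Hessians
of these two moments, and Poincaré's inequality descends to their first derivatives, which have mean
zero (`controlled_of_time_of_hessian`). For the undifferentiated moments Poincaré leaves the means.
These vanish initially, by the four hypotheses on the totals of `F₀`, and drift only at a quadratic
rate (`norm_coef_zero_sub_le`); this is where the time integral in `quad` comes from.

The quadratic bounds are needed for all space-time derivatives of the collision moments up to order
`N - 1`. The collision moments are smooth functions of finitely many velocity moments of `f`, so a
calculus of fields on the torus suffices and no velocity derivatives enter. `Reg` asks for `L^∞`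
bounds below the top order and `L²` bounds at the top order; it is stable under products and smooth
functions, and the embedding `H² ⊆ L^∞` provides it for the moments of `f`.
`exists_norm_transport_le` transfers the resulting bounds to the moment equations. -/

/-- Polynomials in three variables with integer coefficients, as lists of terms. -/
abbrev Poly := List (ℤ × ℕ × ℕ × ℕ)

namespace Poly

/-- The value of a term. -/
def termEval (t : ℤ × ℕ × ℕ × ℕ) (v : Vel) : ℝ :=
  t.1 * (v 0 ^ t.2.1 * v 1 ^ t.2.2.1 * v 2 ^ t.2.2.2)

/-- The value of a polynomial. -/
def ev (p : Poly) (v : Vel) : ℝ := (p.map fun t => termEval t v).sum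

/-- The product of polynomials. -/
def mul (p q : Poly) : Poly :=
  (p.map fun s => q.map fun t =>
    (s.1 * t.1, s.2.1 + t.2.1, s.2.2.1 + t.2.2.1, s.2.2.2 + t.2.2.2)).flatten

/-- A scalar multiple of a polynomial. -/
def smul (c : ℤ) (p : Poly) : Poly := p.map fun t => (c * t.1, t.2)

/-- The moments of the standard Gaussian on the line. -/
def gaussLine : ℕ → ℤ
  | 0 => 1
  | 1 => 0
  | n + 2 => (n + 1) * gaussLine n

/-- The integral of a polynomial against the Maxwellian. -/
def gauss (p : Poly) : ℤ :=
  (p.map fun t => t.1 * (gaussLine t.2.1 * gaussLine t.2.2.1 * gaussLine t.2.2.2)).sum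

@[simp] lemma ev_nil (v : Vel) : ev [] v = 0 := rfl

@[simp] lemma ev_cons (t : ℤ × ℕ × ℕ × ℕ) (p : Poly) (v : Vel) :
    ev (t :: p) v = termEval t v + ev p v := by
  simp [ev]

@[simp] lemma ev_append (p q : Poly) (v : Vel) : ev (p ++ q) v = ev p v + ev q v := by
  simp [ev]

@[simp] lemma ev_smul (c : ℤ) (p : Poly) (v : Vel) : ev (smul c p) v = c * ev p v := by
  induction p with
  | nil => simp [smul]
  | cons t p ih =>
    have : smul c (t :: p) = (c * t.1, t.2) :: smul c p := rfl
    rw [this, ev_cons, ih, ev_cons]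
    simp only [termEval]
    push_cast
    ring

@[simp] lemma ev_mul (p q : Poly) (v : Vel) : ev (mul p q) v = ev p v * ev q v := by
  induction p with
  | nil => simp [mul]
  | cons s p ih =>
    have : mul (s :: p) q = (q.map fun t =>
      (s.1 * t.1, s.2.1 + t.2.1, s.2.2.1 + t.2.2.1, s.2.2.2 + t.2.2.2)) ++ mul p q := rfl
    rw [this, ev_append, ih, ev_cons, add_mul]
    congr 1
    clear ih this
    induction q with
    | nil => simp
    | cons t q ih =>
      rw [List.map_cons, ev_cons, ih, ev_cons, mul_add]
      congr 1
      simp only [termEval]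
      push_cast
      ring

lemma contDiff_ev (p : Poly) : ContDiff ℝ ∞ (ev p) := by
  induction p with
  | nil => exact contDiff_const
  | cons t p ih =>
    have : ev (t :: p) = fun v => termEval t v + ev p v := funext fun v => ev_cons t p v
    rw [this]
    refine ContDiff.add ?_ ih
    unfold termEval
    fun_prop

/-- The constant `1`. -/
def one : Poly := [(1, 0, 0, 0)]

/-- The coordinate `v_i`. -/
def X (i : Fin 3) : Poly :=
  [(1, if i = 0 then 1 else 0, if i = 1 then 1 else 0, if i = 2 then 1 else 0)]

/-- The polynomial `|v|²`. -/
def sq : Poly := [(1, 2, 0, 0), (1, 0, 2, 0), (1, 0, 0, 2)]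

@[simp] lemma ev_one (v : Vel) : ev one v = 1 := by simp [one, ev, termEval]

@[simp] lemma ev_X (i : Fin 3) (v : Vel) : ev (X i) v = v i := by
  fin_cases i <;> simp [X, ev, termEval]

@[simp] lemma ev_sq (v : Vel) : ev sq v = ‖v‖ ^ 2 := by
  simp [sq, ev, termEval, EuclideanSpace.norm_sq_eq, Fin.sum_univ_three]
  ring

end Poly

/-- The standard Gaussian density on the line. -/
def gaussDensity (x : ℝ) : ℝ := 1 / √(2 * Real.pi) * Real.exp (-x ^ 2 / 2)

lemma integrable_pow_mul_gaussDensity (n : ℕ) :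
    Integrable fun x : ℝ => x ^ n * gaussDensity x := by
  have h := integrable_rpow_mul_exp_neg_mul_sq (b := 1 / 2) (by norm_num) (s := (n : ℝ))
    (by have : (0 : ℝ) ≤ n := n.cast_nonneg
        linarith)
  refine (h.const_mul (1 / √(2 * Real.pi))).congr (Filter.Eventually.of_forall fun x => ?_)
  simp only [gaussDensity, Real.rpow_natCast]
  rw [show -(1 / 2) * x ^ 2 = -x ^ 2 / 2 by ring]
  ring

lemma hasDerivAt_gaussDensity (x : ℝ) : HasDerivAt gaussDensity (-(x * gaussDensity x)) x := by
  unfold gaussDensity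
  have h1 : HasDerivAt (fun x : ℝ => -x ^ 2 / 2) (-x) x := by
    refine (((hasDerivAt_pow 2 x).neg).div_const 2).congr_deriv ?_
    norm_num
    ring
  refine ((h1.exp).const_mul (1 / √(2 * Real.pi))).congr_deriv ?_
  ring

/-- Integration by parts with `γ' = -xγ`. At `n = 0` the truncated exponent `n - 1` is harmless
because its factor vanishes. -/
lemma integral_pow_succ_mul_gaussDensity (n : ℕ) :
    ∫ x : ℝ, x ^ (n + 1) * gaussDensity x = n * ∫ x : ℝ, x ^ (n - 1) * gaussDensity x := by
  have h := integral_mul_deriv_eq_deriv_mul_of_integrable (A := ℝ)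
    (u := fun x : ℝ => x ^ n) (v := gaussDensity) (u' := fun x => n * x ^ (n - 1))
    (v' := fun x => -(x * gaussDensity x)) (fun x _ => hasDerivAt_pow n x)
    (fun x _ => hasDerivAt_gaussDensity x)
    (by
      have := (integrable_pow_mul_gaussDensity (n + 1)).neg
      refine this.congr (Filter.Eventually.of_forall fun x => ?_)
      simp only [Pi.neg_apply, Pi.mul_apply]
      ring)
    (by
      have := (integrable_pow_mul_gaussDensity (n - 1)).const_mul (n : ℝ)
      refine this.congr (Filter.Eventually.of_forall fun x => ?_)
      simp only [Pi.mul_apply]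
      ring)
    (integrable_pow_mul_gaussDensity n)
  have e1 : ∀ x : ℝ, x ^ n * -(x * gaussDensity x) = -(x ^ (n + 1) * gaussDensity x) := by
    intro x; ring
  have e2 : ∀ x : ℝ, n * x ^ (n - 1) * gaussDensity x = n * (x ^ (n - 1) * gaussDensity x) := by
    intro x; ring
  simp only [e1, e2, integral_neg, integral_const_mul] at h
  linarith

lemma integral_gaussDensity : ∫ x : ℝ, gaussDensity x = 1 := by
  have h := integral_gaussian (1 / 2)
  unfold gaussDensity
  rw [integral_const_mul]
  have : ∀ x : ℝ, -x ^ 2 / 2 = -(1 / 2) * x ^ 2 := fun x => by ring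
  simp only [this, h]
  rw [show Real.pi / (1 / 2) = 2 * Real.pi by ring]
  have : √(2 * Real.pi) ≠ 0 := (Real.sqrt_pos.2 (by positivity)).ne'
  field_simp

lemma integral_pow_mul_gaussDensity (n : ℕ) :
    ∫ x : ℝ, x ^ n * gaussDensity x = Poly.gaussLine n := by
  induction n using Nat.twoStepInduction with
  | zero => simp [Poly.gaussLine, integral_gaussDensity]
  | one => simpa [Poly.gaussLine] using integral_pow_succ_mul_gaussDensity 0
  | more n ih _ =>
    rw [integral_pow_succ_mul_gaussDensity (n + 1)]
    simp [Poly.gaussLine, ih]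

lemma maxwellian_eq_prod (v : Vel) : maxwellian v = ∏ i, gaussDensity (v i) := by
  unfold maxwellian gaussDensity
  rw [Finset.prod_mul_distrib, ← Real.exp_sum]
  congr 1
  · rw [Finset.prod_const, Finset.card_univ, Fintype.card_fin, div_pow, one_pow,
      Real.sqrt_eq_rpow, Real.sqrt_eq_rpow, ← Real.rpow_natCast, ← Real.rpow_natCast,
      ← Real.rpow_mul (by positivity), ← Real.rpow_mul (by positivity)]
    norm_num
  · rw [EuclideanSpace.norm_sq_eq, Fin.sum_univ_three, Fin.sum_univ_three]
    simp
    ring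

lemma maxwellian_pos (v : Vel) : 0 < maxwellian v := by
  unfold maxwellian
  positivity

lemma sqrtMaxwellian_mul_self (v : Vel) : sqrtMaxwellian v * sqrtMaxwellian v = maxwellian v :=
  Real.mul_self_sqrt (maxwellian_pos v).le

lemma contDiff_maxwellian : ContDiff ℝ ∞ maxwellian := by
  unfold maxwellian
  have : ContDiff ℝ ∞ fun v : Vel => ‖v‖ ^ 2 := contDiff_norm_sq ℝ
  fun_prop

lemma contDiff_sqrtMaxwellian : ContDiff ℝ ∞ sqrtMaxwellian := by
  unfold sqrtMaxwellian
  exact contDiff_maxwellian.sqrt fun v => (maxwellian_pos v).ne'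

lemma integrable_and_integral_termEval (t : ℤ × ℕ × ℕ × ℕ) :
    Integrable (fun v : Vel => Poly.termEval t v * maxwellian v) ∧
    ∫ v : Vel, Poly.termEval t v * maxwellian v =
      t.1 * (Poly.gaussLine t.2.1 * Poly.gaussLine t.2.2.1 * Poly.gaussLine t.2.2.2 : ℝ) := by
  let e : Fin 3 → ℕ := ![t.2.1, t.2.2.1, t.2.2.2]
  have key : (fun v : Vel => Poly.termEval t v * maxwellian v) =
      fun v : Vel => (t.1 : ℝ) * ∏ i, v i ^ e i * gaussDensity (v i) := by
    funext v
    rw [maxwellian_eq_prod, Poly.termEval, Finset.prod_mul_distrib]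
    simp only [Fin.prod_univ_three, e]
    simp
    ring
  have mp := EuclideanSpace.volume_preserving_symm_measurableEquiv_toLp (Fin 3)
  have hi : Integrable fun x : Fin 3 → ℝ => ∏ i, x i ^ e i * gaussDensity (x i) :=
    Integrable.fintype_prod (f := fun i x => x ^ e i * gaussDensity x)
      fun i => integrable_pow_mul_gaussDensity (e i)
  have hI : ∫ x : Fin 3 → ℝ, ∏ i, x i ^ e i * gaussDensity (x i) =
      ∏ i, (Poly.gaussLine (e i) : ℝ) := by
    rw [integral_fintype_prod_volume_eq_prod (fun i x => x ^ e i * gaussDensity x)]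
    exact Finset.prod_congr rfl fun i _ => integral_pow_mul_gaussDensity (e i)
  rw [key]
  constructor
  · exact (mp.integrable_comp_of_integrable hi).const_mul _
  · rw [integral_const_mul]
    congr 1
    have := mp.integral_comp' (g := fun x : Fin 3 → ℝ => ∏ i, x i ^ e i * gaussDensity (x i))
    rw [hI] at this
    refine Eq.trans this ?_
    simp [Fin.prod_univ_three, e]

lemma integrable_ev_mul_maxwellian (p : Poly) :
    Integrable fun v : Vel => p.ev v * maxwellian v := by
  induction p with
  | nil => simp
  | cons t p ih =>
    simp only [Poly.ev_cons, add_mul]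
    exact (integrable_and_integral_termEval t).1.add ih

lemma integral_ev_mul_maxwellian (p : Poly) :
    ∫ v : Vel, p.ev v * maxwellian v = p.gauss := by
  induction p with
  | nil => simp [Poly.gauss]
  | cons t p ih =>
    simp only [Poly.ev_cons, add_mul]
    rw [integral_add (integrable_and_integral_termEval t).1 (integrable_ev_mul_maxwellian p), ih,
      (integrable_and_integral_termEval t).2]
    simp [Poly.gauss]

/-- The weighted polynomial `p √m`. -/
def weight (p : Poly) (v : Vel) : ℝ := p.ev v * sqrtMaxwellian v

lemma weight_mul_weight (p q : Poly) (v : Vel) :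
    weight p v * weight q v = (p.mul q).ev v * maxwellian v := by
  rw [weight, weight, Poly.ev_mul, ← sqrtMaxwellian_mul_self]
  ring

lemma contDiff_weight (p : Poly) : ContDiff ℝ ∞ (weight p) :=
  (p.contDiff_ev).mul contDiff_sqrtMaxwellian

lemma memLp_weight (p : Poly) : MemLp (weight p) 2 := by
  rw [memLp_two_iff_integrable_sq (contDiff_weight p).continuous.aestronglyMeasurable]
  refine (integrable_ev_mul_maxwellian (p.mul p)).congr (Filter.Eventually.of_forall fun v => ?_)
  simp only [← weight_mul_weight]
  ring

/-- Inner products of weighted polynomials are computable integers, so every orthogonality relation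
with the kernel reduces to an evaluation. -/
lemma integral_weight_mul_weight (p q : Poly) :
    ∫ v : Vel, weight p v * weight q v = (p.mul q).gauss := by
  simp only [weight_mul_weight, integral_ev_mul_maxwellian]

end

section

/-! ### Moments of the Shakhov operator -/

/-- The Kronecker symbol. -/
def kron (i j : Fin 3) : ℤ := if i = j then 1 else 0

namespace Poly

/-- The polynomial `v_l (|v|² - 5)`. -/
def heat (l : Fin 3) : Poly := (X l).mul (sq ++ smul (-5) one)

/-- The monomials `v_i v_j`, `v_i v_j v_k` and `v_i v_j v_k v_l`. -/
def X2 (i j : Fin 3) : Poly := (X i).mul (X j)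
/-- The monomial `v_i v_j v_k`. -/
def X3 (i j k : Fin 3) : Poly := (X i).mul (X2 j k)
/-- The monomial `v_i v_j v_k v_l`. -/
def X4 (i j k l : Fin 3) : Poly := (X i).mul (X3 j k l)

lemma gauss_X (i : Fin 3) : (X i).gauss = 0 := by revert i; decide
lemma gauss_X2 (i j : Fin 3) : (X2 i j).gauss = kron i j := by revert i j; decide
lemma gauss_X3 (i j k : Fin 3) : (X3 i j k).gauss = 0 := by revert i j k; decide
-- Isserlis' formula, checked on all index tuples.
lemma gauss_X4 (i j k l : Fin 3) : (X4 i j k l).gauss =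
    kron i j * kron k l + kron i k * kron j l + kron i l * kron j k := by
  revert i j k l; decide
lemma gauss_one_heat (m : Fin 3) : (one.mul (heat m)).gauss = 0 := by revert m; decide
-- The constant `5` is the Gaussian mean of `v_m² |v|²`; with it the heat-flux correction carries no
-- momentum.
lemma gauss_X_heat (i m : Fin 3) : ((X i).mul (heat m)).gauss = 0 := by revert i m; decide
lemma gauss_X2_heat (i j m : Fin 3) : ((X2 i j).mul (heat m)).gauss = 0 := by
  revert i j m; decide
lemma gauss_X3_heat (i j k m : Fin 3) : ((X3 i j k).mul (heat m)).gauss =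
    2 * (kron i m * kron j k + kron j m * kron i k + kron k m * kron i j) := by
  revert i j k m; decide
set_option maxRecDepth 4000 in
lemma gauss_X4_heat (i j k l m : Fin 3) : ((X4 i j k l).mul (heat m)).gauss = 0 := by
  revert i j k l m; decide

end Poly

/-- The Maxwellian corrected by a heat flux `κ`. -/
def heatMaxwellian (κ : Vel) (w : Vel) : ℝ :=
  maxwellian w * (1 + ∑ m, κ m * (Poly.heat m).ev w)

lemma ev_mul_heatMaxwellian (p : Poly) (κ w : Vel) : p.ev w * heatMaxwellian κ w =
    p.ev w * maxwellian w + ∑ m, κ m * ((p.mul (Poly.heat m)).ev w * maxwellian w) := by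
  simp only [heatMaxwellian, Poly.ev_mul, mul_add, Finset.mul_sum, mul_one]
  congr 1
  exact Finset.sum_congr rfl fun m _ => by ring

lemma integrable_ev_mul_heatMaxwellian (p : Poly) (κ : Vel) :
    Integrable fun w => p.ev w * heatMaxwellian κ w := by
  simp only [ev_mul_heatMaxwellian]
  exact (integrable_ev_mul_maxwellian p).add (integrable_finsetSum _ fun m _ =>
    (integrable_ev_mul_maxwellian _).const_mul _)

lemma integral_ev_mul_heatMaxwellian (p : Poly) (κ : Vel) :
    ∫ w, p.ev w * heatMaxwellian κ w =
      p.gauss + ∑ m, κ m * ((p.mul (Poly.heat m)).gauss : ℝ) := by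
  simp only [ev_mul_heatMaxwellian]
  rw [integral_add (integrable_ev_mul_maxwellian p) (integrable_finsetSum _ fun m _ =>
    (integrable_ev_mul_maxwellian _).const_mul _), integral_finsetSum _ fun m _ =>
    (integrable_ev_mul_maxwellian _).const_mul _]
  simp only [integral_const_mul, integral_ev_mul_maxwellian]

/-- The moment of a function of the velocity against a polynomial. -/
def vmom (F : Vel → ℝ) (p : Poly) : ℝ := ∫ v, p.ev v * F v

/-- All polynomial moments of a function of the velocity exist. -/
def HasMoments (F : Vel → ℝ) : Prop := ∀ p : Poly, Integrable fun v => p.ev v * F v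

/-- Reduces the moment computations below to writing the integrand as an explicit list of
coefficients and polynomials. -/
lemma HasMoments.integral_combination {F : Vel → ℝ} (hF : HasMoments F) (L : List (ℝ × Poly))
    {g : Vel → ℝ} (hg : ∀ w, g w = (L.map fun a => a.1 * a.2.ev w).sum) :
    Integrable (fun w => g w * F w) ∧
    ∫ w, g w * F w = (L.map fun a => a.1 * vmom F a.2).sum := by
  simp only [hg]
  clear hg
  induction L with
  | nil => simp
  | cons a L ih =>
    simp only [List.map_cons, List.sum_cons, add_mul, mul_assoc]
    have h := (hF a.2).const_mul a.1
    refine ⟨h.add ih.1, ?_⟩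
    rw [integral_add h ih.1, ih.2, integral_const_mul, vmom]

/-- The Kronecker symbol as a real number. -/
def kronR (i j : Fin 3) : ℝ := kron i j

/-- The correction is odd and orthogonal to `v`, so it changes no moment of degree `0`, `1`, `2` or
`4`; only the third moments see `κ`. -/
lemma heat_moment_zero (κ : Vel) : ∫ w, Poly.one.ev w * heatMaxwellian κ w = 1 := by
  rw [integral_ev_mul_heatMaxwellian]
  simp only [Poly.gauss_one_heat]
  simp [show Poly.one.gauss = 1 by decide]

lemma heat_moment_one (κ : Vel) (i : Fin 3) :
    ∫ w, (Poly.X i).ev w * heatMaxwellian κ w = 0 := by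
  rw [integral_ev_mul_heatMaxwellian]
  simp only [Poly.gauss_X_heat, Poly.gauss_X]
  simp

lemma heat_moment_two (κ : Vel) (i j : Fin 3) :
    ∫ w, (Poly.X2 i j).ev w * heatMaxwellian κ w = kronR i j := by
  rw [integral_ev_mul_heatMaxwellian]
  simp only [Poly.gauss_X2_heat, Poly.gauss_X2]
  simp [kronR]

lemma sum_mul_kron (κ : Vel) (i : Fin 3) : ∑ m, κ m * (kron i m : ℝ) = κ i := by
  simp [kron]

lemma heat_moment_three (κ : Vel) (i j k : Fin 3) :
    ∫ w, (Poly.X3 i j k).ev w * heatMaxwellian κ w =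
      2 * (κ i * kronR j k + κ j * kronR i k + κ k * kronR i j) := by
  rw [integral_ev_mul_heatMaxwellian]
  simp only [Poly.gauss_X3_heat, Poly.gauss_X3]
  push_cast
  rw [← sum_mul_kron κ i, ← sum_mul_kron κ j, ← sum_mul_kron κ k]
  simp only [Fin.sum_univ_three, kronR]
  ring

lemma heat_moment_four (κ : Vel) (i j k l : Fin 3) :
    ∫ w, (Poly.X4 i j k l).ev w * heatMaxwellian κ w =
      kronR i j * kronR k l + kronR i k * kronR j l + kronR i l * kronR j k := by
  rw [integral_ev_mul_heatMaxwellian]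
  simp only [Poly.gauss_X4_heat, Poly.gauss_X4]
  simp [kronR]

/-- The Shakhov distribution with density `r`, velocity `U`, temperature `T` and heat flux `q`. -/
def shakhovDensity (r T : ℝ) (U q : Vel) (v : Vel) : ℝ :=
  r / √(2 * Real.pi * T) ^ 3 * Real.exp (-‖v - U‖ ^ 2 / (2 * T)) *
    -- The factor `1 - 0` is kept so that `shakhovOp 0` unfolds to this expression by definition.
    (1 + (1 - 0) / 5 * (inner ℝ q (v - U) / (r * T ^ 2)) * (‖v - U‖ ^ 2 / (2 * T) - 5 / 2))

/-- The substitution `v = U + √T w` normalizes the Maxwellian. The `10` is the `5` of the Shakhov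
correction times the `2` in `|v - U|²/(2T)`; the powers `T^{1/2}` from `v - U` and `T^{-2}` combine
to `T^{-3/2}`. -/
lemma shakhovDensity_comp {r T : ℝ} (hr : 0 < r) (hT : 0 < T) (U q w : Vel) :
    shakhovDensity r T U q (U + √T • w) =
      r / √T ^ 3 * heatMaxwellian ((10 * r * √T ^ 3)⁻¹ • q) w := by
  have hs : 0 < √T := Real.sqrt_pos.2 hT
  have hTs : T = √T ^ 2 := (Real.sq_sqrt hT.le).symm
  unfold shakhovDensity heatMaxwellian maxwellian
  have e1 : U + √T • w - U = √T • w := by abel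
  have e2 : √((2 * Real.pi) ^ 3) = √(2 * Real.pi) ^ 3 := by
    rw [Real.sqrt_eq_iff_mul_self_eq (by positivity) (by positivity)]
    have := Real.sq_sqrt (show (0 : ℝ) ≤ 2 * Real.pi by positivity)
    calc (2 * Real.pi) ^ 3 = (√(2 * Real.pi) ^ 2) ^ 3 := by rw [this]
      _ = √(2 * Real.pi) ^ 3 * √(2 * Real.pi) ^ 3 := by ring
  have e3 : ‖√T • w‖ ^ 2 = √T ^ 2 * ‖w‖ ^ 2 := by
    rw [norm_smul, mul_pow, Real.norm_eq_abs, sq_abs]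
  have e4 : inner ℝ q (√T • w) = √T * ∑ m, q m * w m := by
    rw [inner_smul_right, PiLp.inner_apply]
    simp [mul_comm]
  have e5 : √(2 * Real.pi * T) = √(2 * Real.pi) * √T := Real.sqrt_mul (by positivity) _
  rw [e1, e2, e3, e4, e5]
  have e6 : -(√T ^ 2 * ‖w‖ ^ 2) / (2 * T) = -‖w‖ ^ 2 / 2 := by
    rw [Real.sq_sqrt hT.le]; field_simp
  have e7 : √T ^ 2 * ‖w‖ ^ 2 / (2 * T) = ‖w‖ ^ 2 / 2 := by
    rw [Real.sq_sqrt hT.le]; field_simp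
  have e8 : ∀ m, (Poly.heat m).ev w = w m * (‖w‖ ^ 2 - 5) := by
    intro m
    simp only [Poly.heat, Poly.ev_mul, Poly.ev_X, Poly.ev_append, Poly.ev_sq, Poly.ev_smul,
      Poly.ev_one]
    push_cast
    ring
  rw [e6, e7]
  simp only [e8]
  have e9 : ∑ m, ((10 * r * √T ^ 3)⁻¹ • q) m * (w m * (‖w‖ ^ 2 - 5)) =
      (10 * r * √T ^ 3)⁻¹ * (∑ m, q m * w m) * (‖w‖ ^ 2 - 5) := by
    simp only [Fin.sum_univ_three, PiLp.smul_apply, smul_eq_mul]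
    ring
  rw [e9, show r * T ^ 2 = r * √T ^ 4 by rw [show √T ^ 4 = (√T ^ 2) ^ 2 by ring,
    Real.sq_sqrt hT.le]]
  have : (0 : ℝ) < √(2 * Real.pi) := Real.sqrt_pos.2 (by positivity)
  field_simp
  ring

lemma integral_comp_affine (g : Vel → ℝ) (U : Vel) {s : ℝ} (hs : 0 < s) :
    ∫ v, g v = s ^ 3 * ∫ w, g (U + s • w) := by
  rw [Measure.integral_comp_smul volume (fun w => g (U + w)) s, integral_add_left_eq_self]
  simp only [finrank_euclideanSpace, Fintype.card_fin, smul_eq_mul]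
  rw [abs_of_pos (by positivity)]
  field_simp

lemma integrable_of_comp_affine {g : Vel → ℝ} {U : Vel} {s : ℝ} (hs : 0 < s)
    (h : Integrable fun w => g (U + s • w)) : Integrable g := by
  have h1 := (integrable_comp_smul_iff volume (fun w => g (U + w)) hs.ne').1 h
  have := h1.comp_add_left (-U)
  simpa using this

lemma integral_mul_shakhovDensity {r T : ℝ} (hr : 0 < r) (hT : 0 < T) (U q : Vel)
    (g : Vel → ℝ) (L : List (ℝ × Poly))
    (hL : ∀ w, g (U + √T • w) = (L.map fun a => a.1 * a.2.ev w).sum) :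
    Integrable (fun v => g v * shakhovDensity r T U q v) ∧
    ∫ v, g v * shakhovDensity r T U q v = r * (L.map fun a => a.1 *
      ∫ w, a.2.ev w * heatMaxwellian ((10 * r * √T ^ 3)⁻¹ • q) w).sum := by
  have hs : 0 < √T := Real.sqrt_pos.2 hT
  have hH : HasMoments (heatMaxwellian ((10 * r * √T ^ 3)⁻¹ • q)) := fun p =>
    integrable_ev_mul_heatMaxwellian p _
  obtain ⟨h1, h2⟩ := hH.integral_combination L (fun _ => rfl)
  have e : (fun w => g (U + √T • w) * shakhovDensity r T U q (U + √T • w)) = fun w =>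
      r / √T ^ 3 * ((L.map fun a => a.1 * a.2.ev w).sum *
        heatMaxwellian ((10 * r * √T ^ 3)⁻¹ • q) w) := by
    funext w
    rw [hL, shakhovDensity_comp hr hT]
    ring
  constructor
  · refine integrable_of_comp_affine (U := U) hs ?_
    rw [e]
    exact h1.const_mul _
  · rw [integral_comp_affine _ U hs, e, integral_const_mul, h2]
    unfold vmom
    field_simp

lemma shakhovDensity_moment_zero {r T : ℝ} (hr : 0 < r) (hT : 0 < T) (U q : Vel) :
    Integrable (fun v => Poly.one.ev v * shakhovDensity r T U q v) ∧
    ∫ v, Poly.one.ev v * shakhovDensity r T U q v = r := by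
  obtain ⟨h1, h2⟩ := integral_mul_shakhovDensity hr hT U q Poly.one.ev [(1, Poly.one)]
    (by intro w; simp)
  refine ⟨h1, h2.trans ?_⟩
  simp [heat_moment_zero, -Poly.ev_one]

lemma shakhovDensity_moment_one {r T : ℝ} (hr : 0 < r) (hT : 0 < T) (U q : Vel) (i : Fin 3) :
    Integrable (fun v => (Poly.X i).ev v * shakhovDensity r T U q v) ∧
    ∫ v, (Poly.X i).ev v * shakhovDensity r T U q v = r * U i := by
  obtain ⟨h1, h2⟩ := integral_mul_shakhovDensity hr hT U q (Poly.X i).ev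
    [(U i, Poly.one), (√T, Poly.X i)] (by intro w; simp)
  refine ⟨h1, h2.trans ?_⟩
  simp only [List.map_cons, List.map_nil, List.sum_cons, List.sum_nil, heat_moment_zero,
    heat_moment_one]
  ring

lemma shakhovDensity_moment_two {r T : ℝ} (hr : 0 < r) (hT : 0 < T) (U q : Vel) (i j : Fin 3) :
    Integrable (fun v => (Poly.X2 i j).ev v * shakhovDensity r T U q v) ∧
    ∫ v, (Poly.X2 i j).ev v * shakhovDensity r T U q v = r * (U i * U j + T * kronR i j) := by
  obtain ⟨h1, h2⟩ := integral_mul_shakhovDensity hr hT U q (Poly.X2 i j).ev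
    [(U i * U j, Poly.one), (√T * U j, Poly.X i), (√T * U i, Poly.X j), (√T ^ 2, Poly.X2 i j)]
    (by intro w; simp [Poly.X2]; ring)
  refine ⟨h1, h2.trans ?_⟩
  simp only [List.map_cons, List.map_nil, List.sum_cons, List.sum_nil, heat_moment_zero,
    heat_moment_one, heat_moment_two, Real.sq_sqrt hT.le]
  ring

/-- The `1/5` is `2κ` times `r√T³` with `κ = q / (10 r√T³)`. Contracting two indices multiplies it
by `3 + 1 + 1`, so the trace returns exactly `q`: at `Pr = 0` the heat flux is reproduced in full.
-/
lemma shakhovDensity_moment_three {r T : ℝ} (hr : 0 < r) (hT : 0 < T) (U q : Vel)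
    (i j k : Fin 3) :
    Integrable (fun v => (Poly.X3 i j k).ev v * shakhovDensity r T U q v) ∧
    ∫ v, (Poly.X3 i j k).ev v * shakhovDensity r T U q v =
      r * (U i * U j * U k + T * (U i * kronR j k + U j * kronR i k + U k * kronR i j)) +
      1 / 5 * (q i * kronR j k + q j * kronR i k + q k * kronR i j) := by
  have hs : 0 < √T := Real.sqrt_pos.2 hT
  obtain ⟨h1, h2⟩ := integral_mul_shakhovDensity hr hT U q (Poly.X3 i j k).ev
    [(U i * U j * U k, Poly.one), (√T * (U j * U k), Poly.X i), (√T * (U i * U k), Poly.X j),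
      (√T * (U i * U j), Poly.X k), (√T ^ 2 * U i, Poly.X2 j k), (√T ^ 2 * U j, Poly.X2 i k),
      (√T ^ 2 * U k, Poly.X2 i j), (√T ^ 3, Poly.X3 i j k)]
    (by intro w; simp [Poly.X2, Poly.X3]; ring)
  refine ⟨h1, h2.trans ?_⟩
  simp only [List.map_cons, List.map_nil, List.sum_cons, List.sum_nil, heat_moment_zero,
    heat_moment_one, heat_moment_two, heat_moment_three, Real.sq_sqrt hT.le,
    PiLp.smul_apply, smul_eq_mul]
  field_simp
  ring

lemma shakhovDensity_moment_four {r T : ℝ} (hr : 0 < r) (hT : 0 < T) (U q : Vel)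
    (i j k l : Fin 3) :
    Integrable (fun v => (Poly.X4 i j k l).ev v * shakhovDensity r T U q v) ∧
    ∫ v, (Poly.X4 i j k l).ev v * shakhovDensity r T U q v =
      r * (U i * U j * U k * U l + T * (U i * U j * kronR k l + U i * U k * kronR j l +
        U i * U l * kronR j k + U j * U k * kronR i l + U j * U l * kronR i k +
        U k * U l * kronR i j) + T ^ 2 * (kronR i j * kronR k l + kronR i k * kronR j l +
        kronR i l * kronR j k)) +
      1 / 5 * (U i * (q j * kronR k l + q k * kronR j l + q l * kronR j k) +
        U j * (q i * kronR k l + q k * kronR i l + q l * kronR i k) +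
        U k * (q i * kronR j l + q j * kronR i l + q l * kronR i j) +
        U l * (q i * kronR j k + q j * kronR i k + q k * kronR i j)) := by
  have hs : 0 < √T := Real.sqrt_pos.2 hT
  obtain ⟨h1, h2⟩ := integral_mul_shakhovDensity hr hT U q (Poly.X4 i j k l).ev
    [(U i * U j * U k * U l, Poly.one),
      (√T * (U j * U k * U l), Poly.X i), (√T * (U i * U k * U l), Poly.X j),
      (√T * (U i * U j * U l), Poly.X k), (√T * (U i * U j * U k), Poly.X l),
      (√T ^ 2 * (U i * U j), Poly.X2 k l), (√T ^ 2 * (U i * U k), Poly.X2 j l),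
      (√T ^ 2 * (U i * U l), Poly.X2 j k), (√T ^ 2 * (U j * U k), Poly.X2 i l),
      (√T ^ 2 * (U j * U l), Poly.X2 i k), (√T ^ 2 * (U k * U l), Poly.X2 i j),
      (√T ^ 3 * U i, Poly.X3 j k l), (√T ^ 3 * U j, Poly.X3 i k l),
      (√T ^ 3 * U k, Poly.X3 i j l), (√T ^ 3 * U l, Poly.X3 i j k),
      (√T ^ 4, Poly.X4 i j k l)]
    (by intro w; simp [Poly.X2, Poly.X3, Poly.X4]; ring)
  refine ⟨h1, h2.trans ?_⟩
  have h4 : √T ^ 4 = T ^ 2 := by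
    rw [show √T ^ 4 = (√T ^ 2) ^ 2 by ring, Real.sq_sqrt hT.le]
  simp only [List.map_cons, List.map_nil, List.sum_cons, List.sum_nil, heat_moment_zero,
    heat_moment_one, heat_moment_two, heat_moment_three, heat_moment_four, Real.sq_sqrt hT.le,
    PiLp.smul_apply, smul_eq_mul, h4]
  field_simp
  ring

end

section

/-! ### The collision term tested against polynomials -/

namespace Poly

/-- The traceless quadratic `3 v_i v_j - δ_ij |v|²`. -/
def chi (i j : Fin 3) : Poly := smul 3 (X2 i j) ++ smul (-(kron i j)) sq

/-- The quartic `(3 v_i v_j - δ_ij |v|²) |v|²`. -/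
def chiSq (i j : Fin 3) : Poly := (chi i j).mul sq

/-- The cubic `v_i |v|²`. -/
def XSq (i : Fin 3) : Poly := (X i).mul sq

end Poly

lemma vmom_append {F : Vel → ℝ} (hF : HasMoments F) (p q : Poly) :
    vmom F (p ++ q) = vmom F p + vmom F q := by
  simp only [vmom, Poly.ev_append, add_mul]
  exact integral_add (hF p) (hF q)

lemma vmom_smul (F : Vel → ℝ) (c : ℤ) (p : Poly) :
    vmom F (Poly.smul c p) = c * vmom F p := by
  simp only [vmom, Poly.ev_smul, mul_assoc, integral_const_mul]

lemma vmom_sum {F : Vel → ℝ} (hF : HasMoments F) (p : Poly) (c : Fin 3 → ℝ) (q : Fin 3 → Poly)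
    (h : ∀ v, p.ev v = ∑ k, c k * (q k).ev v) : vmom F p = ∑ k, c k * vmom F (q k) := by
  simp only [vmom, h, Finset.sum_mul, mul_assoc]
  rw [integral_finsetSum _ fun k _ => (hF (q k)).const_mul (c k)]
  simp only [integral_const_mul]

lemma sq_norm_eq_sum (v : Vel) : ‖v‖ ^ 2 = ∑ k, v k * v k := by
  rw [EuclideanSpace.norm_sq_eq]
  exact Finset.sum_congr rfl fun k _ => by rw [Real.norm_eq_abs, sq_abs, sq]

lemma ev_sq_eq_sum (v : Vel) : Poly.sq.ev v = ∑ k, 1 * (Poly.X2 k k).ev v := by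
  simp [sq_norm_eq_sum, Poly.X2]

lemma ev_XSq_eq_sum (i : Fin 3) (v : Vel) :
    (Poly.XSq i).ev v = ∑ k, 1 * (Poly.X3 i k k).ev v := by
  simp [sq_norm_eq_sum, Poly.X2, Poly.X3, Poly.XSq, Finset.mul_sum]

lemma ev_X2_mul_sq_eq_sum (i j : Fin 3) (v : Vel) :
    ((Poly.X2 i j).mul Poly.sq).ev v = ∑ k, 1 * (Poly.X4 i j k k).ev v := by
  simp [sq_norm_eq_sum, Poly.X2, Poly.X3, Poly.X4, Finset.mul_sum, mul_assoc]

lemma vmom_chi {F : Vel → ℝ} (hF : HasMoments F) (i j : Fin 3) :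
    vmom F (Poly.chi i j) = 3 * vmom F (Poly.X2 i j) - kronR i j * vmom F Poly.sq := by
  rw [Poly.chi, vmom_append hF, vmom_smul, vmom_smul, kronR]
  push_cast
  ring

lemma vmom_chiSq {F : Vel → ℝ} (hF : HasMoments F) (i j : Fin 3) :
    vmom F (Poly.chiSq i j) = 3 * vmom F ((Poly.X2 i j).mul Poly.sq) -
      kronR i j * ∑ k, 1 * vmom F ((Poly.X2 k k).mul Poly.sq) := by
  rw [← vmom_sum hF (Poly.sq.mul Poly.sq) (fun _ => 1) (fun k => (Poly.X2 k k).mul Poly.sq)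
    (fun v => by simp only [Poly.ev_mul, ← mul_assoc, ← Finset.sum_mul, ← ev_sq_eq_sum]),
    kronR, ← neg_neg ((kron i j : ℝ) * _), ← neg_mul, ← Int.cast_neg, ← vmom_smul,
    show (3 : ℝ) = ((3 : ℤ) : ℝ) by norm_num, ← vmom_smul, sub_neg_eq_add, ← vmom_append hF]
  unfold vmom
  congr 1
  funext v
  simp only [Poly.chiSq, Poly.chi, Poly.ev_mul, Poly.ev_append, Poly.ev_smul]
  ring

/-- Linear combinations of polynomials with real coefficients. -/
def IsCombination (g : Vel → ℝ) : Prop :=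
  ∃ L : List (ℝ × Poly), ∀ w, g w = (L.map fun a => a.1 * a.2.ev w).sum

lemma IsCombination.add {g h : Vel → ℝ} (hg : IsCombination g) (hh : IsCombination h) :
    IsCombination fun w => g w + h w := by
  obtain ⟨L, hL⟩ := hg
  obtain ⟨M, hM⟩ := hh
  exact ⟨L ++ M, fun w => by simp [hL, hM]⟩

lemma IsCombination.mul {g h : Vel → ℝ} (hg : IsCombination g) (hh : IsCombination h) :
    IsCombination fun w => g w * h w := by
  obtain ⟨L, hL⟩ := hg
  obtain ⟨M, hM⟩ := hh
  have key : ∀ a : ℝ × Poly, IsCombination fun w => a.1 * a.2.ev w * h w := fun a =>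
    ⟨M.map fun b => (a.1 * b.1, a.2.mul b.2), fun w => by
      simp only [hM]
      rw [ ← List.sum_map_mul_left, List.map_map]
      congr 1
      refine List.map_congr_left fun b _ => ?_
      simp only [Function.comp, Poly.ev_mul]
      ring⟩
  have : ∀ L : List (ℝ × Poly),
      IsCombination fun w => (L.map fun a => a.1 * a.2.ev w).sum * h w := by
    intro L
    induction L with
    | nil => exact ⟨[], by simp⟩
    | cons a L ih =>
      simp only [List.map_cons, List.sum_cons, add_mul]
      exact (key a).add ih
  simpa only [hL] using this L

lemma IsCombination.const (c : ℝ) : IsCombination fun _ => c := ⟨[(c, Poly.one)], by simp⟩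

lemma IsCombination.pow {g : Vel → ℝ} (hg : IsCombination g) (n : ℕ) :
    IsCombination fun w => g w ^ n := by
  induction n with
  | zero => simpa using IsCombination.const 1
  | succ n ih => simpa only [pow_succ] using ih.mul hg

/-- Gives the existence of all polynomial moments of the Shakhov density, beyond the explicit ones
of degree at most four. -/
lemma isCombination_comp_affine (p : Poly) (U : Vel) (s : ℝ) :
    IsCombination fun w => p.ev (U + s • w) := by
  have hc : ∀ i, IsCombination fun w : Vel => (U + s • w) i := fun i =>
    ⟨[(U i, Poly.one), (s, Poly.X i)], by simp⟩
  induction p with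
  | nil => exact ⟨[], by simp⟩
  | cons t p ih =>
    simp only [Poly.ev_cons]
    refine IsCombination.add ?_ ih
    exact (IsCombination.const _).mul ((((hc 0).pow _).mul ((hc 1).pow _)).mul ((hc 2).pow _))

lemma hasMoments_shakhovDensity {r T : ℝ} (hr : 0 < r) (hT : 0 < T) (U q : Vel) :
    HasMoments (shakhovDensity r T U q) := fun p => by
  obtain ⟨L, hL⟩ := isCombination_comp_affine p U √T
  exact (integral_mul_shakhovDensity hr hT U q p.ev L hL).1

lemma kronR_self (i : Fin 3) : kronR i i = 1 := by simp [kronR, kron]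

lemma sum_mul_kronR (c : Fin 3 → ℝ) (i : Fin 3) : ∑ k, c k * kronR i k = c i := by
  simp [kronR, kron]

/-! ### Macroscopic quantities and collision moments of a velocity distribution. -/

section macroscopic

variable {F : Vel → ℝ}

lemma rho_eq (F : Vel → ℝ) : rho F = vmom F Poly.one := by simp [rho, vmom]

lemma bulkVelocity_apply (hF : HasMoments F) (i : Fin 3) :
    bulkVelocity F i = (rho F)⁻¹ * vmom F (Poly.X i) := by
  have h : ∀ i : Fin 3, Integrable fun v : Vel => (F v • v) i := fun i =>
    (hF (Poly.X i)).congr (Filter.Eventually.of_forall fun v => by simp [mul_comm])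
  rw [bulkVelocity, PiLp.smul_apply, eval_integral_piLp h, smul_eq_mul]
  simp [vmom, mul_comm]

lemma rho_mul_bulkVelocity (hF : HasMoments F) (hr : 0 < rho F) (i : Fin 3) :
    vmom F (Poly.X i) = rho F * bulkVelocity F i := by
  rw [bulkVelocity_apply hF]
  field_simp

lemma sq_norm_sub (U v : Vel) :
    ‖v - U‖ ^ 2 = ‖v‖ ^ 2 - 2 * ∑ j, U j * v j + ∑ j, U j * U j := by
  simp only [sq_norm_eq_sum, Fin.sum_univ_three, PiLp.sub_apply]
  ring

lemma vmom_sq_eq (hF : HasMoments F) (hr : 0 < rho F) : vmom F Poly.sq =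
    3 * (rho F * temperature F) + rho F * ∑ j, bulkVelocity F j * bulkVelocity F j := by
  have h : ∫ v, F v * ‖v - bulkVelocity F‖ ^ 2 = vmom F Poly.sq -
      2 * (∑ j, bulkVelocity F j * vmom F (Poly.X j)) +
      (∑ j, bulkVelocity F j * bulkVelocity F j) * vmom F Poly.one := by
    simp only [mul_comm (F _)]
    rw [(hF.integral_combination [(1, Poly.sq), (-2 * bulkVelocity F 0, Poly.X 0),
      (-2 * bulkVelocity F 1, Poly.X 1), (-2 * bulkVelocity F 2, Poly.X 2),
      (∑ j, bulkVelocity F j * bulkVelocity F j, Poly.one)] fun v => ?_).2]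
    · simp only [List.map_cons, List.map_nil, List.sum_cons, List.sum_nil, Fin.sum_univ_three]
      ring
    · simp [sq_norm_sub, Fin.sum_univ_three]
      ring
  rw [temperature, h, ← rho_eq]
  simp only [rho_mul_bulkVelocity hF hr, Fin.sum_univ_three]
  field_simp
  ring

lemma heatFlux_apply (hF : HasMoments F) (hr : 0 < rho F) (i : Fin 3) :
    heatFlux F i = vmom F (Poly.XSq i) -
      2 * ∑ j, bulkVelocity F j * vmom F (Poly.X2 i j) - bulkVelocity F i * vmom F Poly.sq +
      2 * rho F * bulkVelocity F i * ∑ j, bulkVelocity F j * bulkVelocity F j := by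
  set U := bulkVelocity F with hU
  have e : ∀ (i : Fin 3) (v : Vel), ((F v * ‖v - U‖ ^ 2) • (v - U)) i =
      ‖v - U‖ ^ 2 * (v i - U i) * F v := by
    intro i v
    simp only [PiLp.smul_apply, PiLp.sub_apply, smul_eq_mul]
    ring
  have key := fun i => hF.integral_combination [(1, Poly.XSq i), (-2 * U 0, Poly.X2 i 0),
    (-2 * U 1, Poly.X2 i 1), (-2 * U 2, Poly.X2 i 2), (-U i, Poly.sq),
    (2 * U i * U 0, Poly.X 0), (2 * U i * U 1, Poly.X 1), (2 * U i * U 2, Poly.X 2),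
    (∑ j, U j * U j, Poly.X i), (-(∑ j, U j * U j) * U i, Poly.one)]
    (g := fun v => ‖v - U‖ ^ 2 * (v i - U i)) (fun v => by
      simp [sq_norm_sub, Fin.sum_univ_three, Poly.XSq, Poly.X2]
      ring)
  have hint : ∀ i : Fin 3, Integrable fun v => ((F v * ‖v - U‖ ^ 2) • (v - U)) i := by
    simpa only [e] using fun i => (key i).1
  rw [heatFlux, eval_integral_piLp hint]
  simp only [e]
  rw [(key i).2]
  simp only [List.map_cons, List.map_nil, List.sum_cons, List.sum_nil, Fin.sum_univ_three,
    rho_mul_bulkVelocity hF hr, ← rho_eq, ← hU]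
  ring

/-- The collision term tested against a polynomial. -/
def collision (F : Vel → ℝ) (p : Poly) : ℝ := ∫ v, p.ev v * (shakhovOp 0 F v - F v)

lemma collision_eq (hF : HasMoments F) (hr : 0 < rho F) (hT : 0 < temperature F) (p : Poly) :
    Integrable (fun v => p.ev v * (shakhovOp 0 F v - F v)) ∧ collision F p =
      vmom (shakhovDensity (rho F) (temperature F) (bulkVelocity F) (heatFlux F)) p -
        vmom F p := by
  have h := hasMoments_shakhovDensity hr hT (bulkVelocity F) (heatFlux F) p
  have e : ∀ v, p.ev v * (shakhovOp 0 F v - F v) = p.ev v * shakhovDensity (rho F)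
      (temperature F) (bulkVelocity F) (heatFlux F) v - p.ev v * F v := fun v => mul_sub _ _ _
  simp only [collision, e]
  exact ⟨h.sub (hF p), integral_sub h (hF p)⟩

lemma collision_one (hF : HasMoments F) (hr : 0 < rho F) (hT : 0 < temperature F) :
    collision F Poly.one = 0 := by
  rw [(collision_eq hF hr hT _).2, vmom, (shakhovDensity_moment_zero hr hT _ _).2, rho_eq,
    sub_self]

lemma collision_X (hF : HasMoments F) (hr : 0 < rho F) (hT : 0 < temperature F) (i : Fin 3) :
    collision F (Poly.X i) = 0 := by
  rw [(collision_eq hF hr hT _).2, vmom, (shakhovDensity_moment_one hr hT _ _ i).2,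
    rho_mul_bulkVelocity hF hr, sub_self]

lemma collision_sq (hF : HasMoments F) (hr : 0 < rho F) (hT : 0 < temperature F) :
    collision F Poly.sq = 0 := by
  rw [(collision_eq hF hr hT _).2, vmom_sq_eq hF hr,
    vmom_sum (hasMoments_shakhovDensity hr hT _ _) _ _ _ ev_sq_eq_sum]
  simp only [vmom, (shakhovDensity_moment_two hr hT _ _ _ _).2, kronR_self, Fin.sum_univ_three]
  ring

/-- The traced third moment of the Shakhov distribution contains the heat flux of `F` with
coefficient one, so `q` and the third moment of `F` cancel. Each remaining term is `U_j` times the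
deviation of a second moment from its local equilibrium, which is quadratic in the perturbation. -/
lemma collision_XSq (hF : HasMoments F) (hr : 0 < rho F) (hT : 0 < temperature F) (i : Fin 3) :
    collision F (Poly.XSq i) = -2 * ∑ j, bulkVelocity F j * (vmom F (Poly.X2 i j) -
      rho F * temperature F * kronR i j - rho F * bulkVelocity F i * bulkVelocity F j) := by
  rw [(collision_eq hF hr hT _).2,
    vmom_sum (hasMoments_shakhovDensity hr hT _ _) _ _ _ (ev_XSq_eq_sum i)]
  have hq := sum_mul_kronR (fun j => heatFlux F j) i
  simp only [vmom, (shakhovDensity_moment_three hr hT _ _ _ _ _).2, kronR_self,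
    Fin.sum_univ_three] at hq ⊢
  change _ - vmom F (Poly.XSq i) = -2 * (_ * (vmom F _ - _ - _) + _ * (vmom F _ - _ - _) +
    _ * (vmom F _ - _ - _))
  have h := heatFlux_apply hF hr i
  rw [vmom_sq_eq hF hr] at h
  simp only [Fin.sum_univ_three] at h
  linear_combination 2 / 5 * hq + h

/-- The isotropic pressure drops out of the traceless part, so the gain term is quadratic in `U` and
the only linear contribution is the damping. -/
lemma collision_chi (hF : HasMoments F) (hr : 0 < rho F) (hT : 0 < temperature F)
    (i j : Fin 3) : collision F (Poly.chi i j) =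
      rho F * (3 * (bulkVelocity F i * bulkVelocity F j) -
        kronR i j * ∑ k, bulkVelocity F k * bulkVelocity F k) - vmom F (Poly.chi i j) := by
  have hS := hasMoments_shakhovDensity hr hT (bulkVelocity F) (heatFlux F)
  rw [(collision_eq hF hr hT _).2, vmom_chi hS, vmom_sum hS _ _ _ ev_sq_eq_sum]
  simp only [vmom, (shakhovDensity_moment_two hr hT _ _ _ _).2, kronR_self, Fin.sum_univ_three]
  ring

/-- As for degree two: the `T²` terms are isotropic and vanish in the traceless part. What is left
of the gain carries `U ⊗ U` or `U ⊗ q`, hence is quadratic. -/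
lemma collision_chiSq (hF : HasMoments F) (hr : 0 < rho F) (hT : 0 < temperature F)
    (i j : Fin 3) : collision F (Poly.chiSq i j) =
      (rho F * (∑ k, bulkVelocity F k * bulkVelocity F k) + 7 * (rho F * temperature F)) *
        (3 * (bulkVelocity F i * bulkVelocity F j) -
          kronR i j * ∑ k, bulkVelocity F k * bulkVelocity F k) +
      7 / 5 * (3 * (bulkVelocity F i * heatFlux F j + bulkVelocity F j * heatFlux F i) -
        2 * kronR i j * ∑ k, bulkVelocity F k * heatFlux F k) -
      vmom F (Poly.chiSq i j) := by
  have hS := hasMoments_shakhovDensity hr hT (bulkVelocity F) (heatFlux F)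
  rw [(collision_eq hF hr hT _).2, vmom_chiSq hS]
  simp only [vmom_sum hS _ _ _ (ev_X2_mul_sq_eq_sum _ _)]
  simp only [vmom, (shakhovDensity_moment_four hr hT _ _ _ _ _ _).2]
  congr 1
  fin_cases i <;> fin_cases j <;>
    simp [kronR, kron, Fin.sum_univ_three] <;> ring

end macroscopic

end

section

/-! ### Fourier analysis on the torus -/

/-- The real Hilbert space `L²(𝕋³)`. -/
abbrev Hx := Lp ℝ 2 (volume : Measure Torus)

lemma volume_unitAddCircle : (volume : Measure UnitAddCircle) = AddCircle.haarAddCircle := by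
  rw [AddCircle.volume_eq_smul_haarAddCircle]
  simp

/-- The measure is a variable so that its equality with the product of normalized Haar measures can
be substituted into the type of the basis. -/
lemma exists_hilbertBasis_of_eq_haar (μ : Measure Torus)
    (h : μ = Measure.pi fun _ => AddCircle.haarAddCircle) :
    ∃ b : HilbertBasis (Fin 3 → ℤ) ℂ (Lp ℂ 2 μ), ∀ n, b n =ᵐ[μ] UnitAddTorus.mFourier n := by
  subst h
  exact ⟨UnitAddTorus.mFourierBasis, fun n => by
    rw [UnitAddTorus.coe_mFourierBasis]; exact UnitAddTorus.coeFn_mFourierLp 2 n⟩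

lemma exists_fourierBasis : ∃ b : HilbertBasis (Fin 3 → ℤ) ℂ (Lp ℂ 2 (volume : Measure Torus)),
    ∀ n, b n =ᵐ[volume] UnitAddTorus.mFourier n :=
  exists_hilbertBasis_of_eq_haar _ (by
    rw [volume_pi]
    simp only [volume_unitAddCircle])

/-- The exponentials as a Hilbert basis of `L²(𝕋³; ℂ)`. -/
def fourierBasis : HilbertBasis (Fin 3 → ℤ) ℂ (Lp ℂ 2 (volume : Measure Torus)) :=
  exists_fourierBasis.choose

lemma coeFn_fourierBasis (n : Fin 3 → ℤ) : fourierBasis n =ᵐ[volume] UnitAddTorus.mFourier n :=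
  exists_fourierBasis.choose_spec n

/-- Complexification `L²(𝕋³; ℝ) → L²(𝕋³; ℂ)`. -/
def cplx : Hx →L[ℝ] Lp ℂ 2 (volume : Measure Torus) := Complex.ofRealCLM.compLpL 2 volume

lemma coeFn_cplx (u : Hx) : cplx u =ᵐ[volume] fun x => (u x : ℂ) :=
  Complex.ofRealCLM.coeFn_compLp' u

lemma inner_cplx (u w : Hx) : inner ℂ (cplx u) (cplx w) = ((inner ℝ u w : ℝ) : ℂ) := by
  rw [L2.inner_def, L2.inner_def, ← integral_complex_ofReal]
  refine integral_congr_ae ?_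
  filter_upwards [coeFn_cplx u, coeFn_cplx w] with x h1 h2
  simp [h1, h2]

/-- The Fourier coefficients of a real function. -/
def coef (n : Fin 3 → ℤ) : Hx →L[ℝ] ℂ :=
  ((innerSL ℂ (fourierBasis n)).restrictScalars ℝ).comp cplx

lemma coef_eq_inner (n : Fin 3 → ℤ) (u : Hx) : coef n u = inner ℂ (fourierBasis n) (cplx u) := rfl

lemma coef_eq_integral (n : Fin 3 → ℤ) (u : Hx) :
    coef n u = ∫ x, UnitAddTorus.mFourier (-n) x * (u x : ℂ) := by
  rw [coef_eq_inner, L2.inner_def]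
  refine integral_congr_ae ?_
  filter_upwards [coeFn_cplx u, coeFn_fourierBasis n] with x h1 h2
  rw [h1, h2, UnitAddTorus.mFourier_neg, RCLike.inner_apply, mul_comm]

lemma coef_zero (u : Hx) : coef 0 u = ((∫ x, u x : ℝ) : ℂ) := by
  rw [coef_eq_integral, ← integral_complex_ofReal]
  simp [UnitAddTorus.mFourier_zero]

lemma hasSum_coef_inner (u w : Hx) :
    HasSum (fun n => (starRingEnd ℂ) (coef n u) * coef n w) ((inner ℝ u w : ℝ) : ℂ) := by
  rw [← inner_cplx]
  refine (fourierBasis.hasSum_inner_mul_inner (cplx u) (cplx w)).congr_fun fun n => ?_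
  rw [coef_eq_inner, coef_eq_inner, inner_conj_symm]

lemma hasSum_coef_sq (u : Hx) : HasSum (fun n => ‖coef n u‖ ^ 2) (‖u‖ ^ 2) := by
  have h := Complex.hasSum_re (hasSum_coef_inner u u)
  rw [Complex.ofReal_re, real_inner_self_eq_norm_sq] at h
  refine h.congr_fun fun n => ?_
  rw [← Complex.normSq_eq_conj_mul_self, Complex.ofReal_re, Complex.normSq_eq_norm_sq]

lemma eq_of_coef_eq {u w : Hx} (h : ∀ n, coef n u = coef n w) : u = w := by
  have h2 := hasSum_coef_sq (u - w)
  simp only [map_sub, h, sub_self, norm_zero] at h2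
  have h3 : ‖u - w‖ ^ 2 = 0 := h2.unique (by simp [hasSum_zero])
  rwa [sq_eq_zero_iff, norm_eq_zero, sub_eq_zero] at h3

/-- `g` is the derivative `∂_{x_i} u`, in terms of Fourier coefficients. -/
def IsDerivX (i : Fin 3) (u g : Hx) : Prop :=
  ∀ n : Fin 3 → ℤ, coef n g = 2 * Real.pi * Complex.I * n i * coef n u

lemma IsDerivX.coef_zero_eq {i : Fin 3} {u g : Hx} (h : IsDerivX i u g) : coef 0 g = 0 := by
  simp [h 0]

lemma IsDerivX.integral_eq_zero {i : Fin 3} {u g : Hx} (h : IsDerivX i u g) : ∫ x, g x = 0 := by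
  have := h.coef_zero_eq
  rw [coef_zero] at this
  exact_mod_cast this

lemma IsDerivX.add {i : Fin 3} {u g w h : Hx} (hu : IsDerivX i u g) (hw : IsDerivX i w h) :
    IsDerivX i (u + w) (g + h) := fun n => by
  rw [map_add, map_add, hu n, hw n, mul_add]

lemma IsDerivX.smul {i : Fin 3} {u g : Hx} (hu : IsDerivX i u g) (c : ℝ) :
    IsDerivX i (c • u) (c • g) := fun n => by
  rw [map_smul, map_smul, hu n, mul_smul_comm]

/-- Two integrations by parts: on the Fourier side both pairings carry the factor `n_i n_j`. This is
the identity that Korn's inequality rests on. -/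
lemma inner_derivX_comm {i j : Fin 3} {u ui uj w wi wj : Hx} (hui : IsDerivX i u ui)
    (huj : IsDerivX j u uj) (hwi : IsDerivX i w wi) (hwj : IsDerivX j w wj) :
    inner ℝ ui wj = inner ℝ uj wi := by
  have h1 := hasSum_coef_inner ui wj
  have h2 := hasSum_coef_inner uj wi
  have e : (fun n => (starRingEnd ℂ) (coef n ui) * coef n wj) =
      fun n => (starRingEnd ℂ) (coef n uj) * coef n wi := by
    funext n
    rw [hui n, huj n, hwi n, hwj n]
    simp only [map_mul, map_intCast]
    ring
  rw [e] at h1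
  exact_mod_cast h1.unique h2

/-- **Poincaré's inequality.** -/
lemma poincare {u : Hx} {g : Fin 3 → Hx} (h : ∀ i, IsDerivX i u (g i)) :
    ‖u‖ ^ 2 ≤ (∫ x, u x) ^ 2 + ∑ i, ‖g i‖ ^ 2 := by
  have h1 := hasSum_coef_sq u
  have h2 : HasSum (fun n => (if n = 0 then (∫ x, u x) ^ 2 else 0) + ∑ i, ‖coef n (g i)‖ ^ 2)
      ((∫ x, u x) ^ 2 + ∑ i, ‖g i‖ ^ 2) :=
    (hasSum_ite_eq 0 _).add (hasSum_sum fun i _ => hasSum_coef_sq (g i))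
  refine hasSum_le (fun n => ?_) h1 h2
  by_cases hn : n = 0
  · subst hn
    rw [if_pos rfl, coef_zero, Complex.norm_real, Real.norm_eq_abs, sq_abs]
    exact le_add_of_nonneg_right (Finset.sum_nonneg fun i _ => sq_nonneg _)
  -- A nonzero frequency has a nonzero component, and the corresponding derivative alone dominates,
  -- since `|2π n_i| ≥ 1`.
  · obtain ⟨i, hi⟩ := Function.ne_iff.1 hn
    rw [if_neg hn, zero_add]
    refine le_trans ?_ (Finset.single_le_sum (f := fun i => ‖coef n (g i)‖ ^ 2)
      (fun i _ => sq_nonneg _) (Finset.mem_univ i))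
    rw [h i n, norm_mul, mul_pow]
    have : 1 ≤ ‖(2 * Real.pi * Complex.I * n i : ℂ)‖ := by
      simp only [norm_mul, Complex.norm_I, Complex.norm_real, Complex.norm_intCast, mul_one,
        Complex.norm_ofNat, Real.norm_eq_abs, abs_of_pos Real.pi_pos]
      have h3 : (1 : ℝ) ≤ |((n i : ℤ) : ℝ)| := by
        exact_mod_cast Int.one_le_abs hi
      have := Real.pi_gt_three
      nlinarith
    exact le_mul_of_one_le_left (sq_nonneg _) (one_le_pow₀ this)

/-- Splitting the exponent `2` as `3 · (2/3)` bounds the term by the product of the `(1 +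
n_i²)^{-2/3}`, each of which decays like `|n_i|^{-4/3}` and is summable over `ℤ`. -/
lemma summable_inv_sq_fin_three :
    Summable fun n : Fin 3 → ℤ => ((1 : ℝ) + ∑ i, (n i : ℝ) ^ 2)⁻¹ ^ 2 := by
  let φ : ℤ → ℝ := fun k => (1 + (k : ℝ) ^ 2) ^ (-(2 / 3) : ℝ)
  have hpos : ∀ k : ℤ, (0 : ℝ) < 1 + (k : ℝ) ^ 2 := fun k => by positivity
  have hφ0 : ∀ k, 0 ≤ φ k := fun k => Real.rpow_nonneg (hpos k).le _
  have hφ : Summable φ := by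
    refine Summable.of_norm_bounded_eventually
      (g := fun k : ℤ => |(k : ℝ)| ^ (-(4 / 3) : ℝ))
      (Real.summable_abs_int_rpow (by norm_num)) ?_
    filter_upwards [(Set.finite_singleton (0 : ℤ)).compl_mem_cofinite] with k hk
    have hk' : (0 : ℝ) < |(k : ℝ)| := abs_pos.2 (by exact_mod_cast hk)
    rw [Real.norm_of_nonneg (hφ0 k), show (-(4 / 3) : ℝ) = 2 * (-(2 / 3)) by norm_num,
      Real.rpow_mul hk'.le, Real.rpow_two, sq_abs]
    exact Real.rpow_le_rpow_of_nonpos (by rw [← sq_abs]; positivity) (by linarith) (by norm_num)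
  have h3 : Summable fun n : Fin 3 → ℤ => φ (n 0) * (φ (n 1) * φ (n 2)) := by
    have h2 := hφ.mul_of_nonneg (hφ.mul_of_nonneg hφ hφ0 hφ0) hφ0
      (fun x => mul_nonneg (hφ0 x.1) (hφ0 x.2))
    refine h2.comp_injective (i := fun n : Fin 3 → ℤ => (n 0, n 1, n 2)) fun n m h => ?_
    simp only [Prod.mk.injEq] at h
    funext i
    fin_cases i
    exacts [h.1, h.2.1, h.2.2]
  refine Summable.of_nonneg_of_le (fun n => by positivity) (fun n => ?_) h3
  set a : ℝ := 1 + ∑ i, (n i : ℝ) ^ 2 with ha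
  have hle : ∀ i, 1 + (n i : ℝ) ^ 2 ≤ a := fun i => by
    have := Finset.single_le_sum (f := fun i => (n i : ℝ) ^ 2) (fun i _ => sq_nonneg _)
      (Finset.mem_univ i)
    rw [ha]
    simpa using this
  have ha0 : 0 < a := (hpos (n 0)).trans_le (hle 0)
  have hb : ∀ i, a ^ (-(2 / 3) : ℝ) ≤ φ (n i) := fun i =>
    Real.rpow_le_rpow_of_nonpos (hpos _) (hle i) (by norm_num)
  have hc : a⁻¹ ^ 2 = a ^ (-(2 / 3) : ℝ) * (a ^ (-(2 / 3) : ℝ) * a ^ (-(2 / 3) : ℝ)) := by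
    rw [← Real.rpow_add ha0, ← Real.rpow_add ha0, inv_pow, ← Real.rpow_two, ← Real.rpow_neg ha0.le]
    norm_num
  have h0 : 0 ≤ a ^ (-(2 / 3) : ℝ) := Real.rpow_nonneg ha0.le _
  rw [hc]
  exact mul_le_mul (hb 0) (mul_le_mul (hb 1) (hb 2) h0 (hφ0 _)) (mul_nonneg h0 h0) (hφ0 _)

/-- The `ℓ²` norm of the symbol of `(1 - Δ)⁻¹`. -/
def sobolevConst : ℝ := √(∑' n : Fin 3 → ℤ, ((1 : ℝ) + ∑ i, (n i : ℝ) ^ 2)⁻¹ ^ 2)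

/-- Since `u - Δu` has symbol `1 + 4π²|n|² ≥ 1 + |n|²`, Cauchy–Schwarz against the square-summable
`(1 + |n|²)⁻¹` bounds the `ℓ¹` norm of the coefficients. -/
lemma summable_coef_and_tsum_le {u : Hx} {g h : Fin 3 → Hx} (hg : ∀ i, IsDerivX i u (g i))
    (hh : ∀ i, IsDerivX i (g i) (h i)) :
    Summable (fun n => ‖coef n u‖) ∧ ∑' n, ‖coef n u‖ ≤ sobolevConst * ‖u - ∑ i, h i‖ := by
  have key : ∀ n, ‖coef n u‖ ≤ ((1 : ℝ) + ∑ i, (n i : ℝ) ^ 2)⁻¹ * ‖coef n (u - ∑ i, h i)‖ := by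
    intro n
    have e : coef n (u - ∑ i, h i) =
        ((1 + (2 * Real.pi) ^ 2 * ∑ i, (n i : ℝ) ^ 2 : ℝ) : ℂ) * coef n u := by
      rw [map_sub, map_sum]
      simp only [hh _ n, hg _ n, Fin.sum_univ_three]
      push_cast
      linear_combination (-4 * Real.pi ^ 2 * coef n u * (n 0 ^ 2 + n 1 ^ 2 + n 2 ^ 2)) *
        Complex.I_sq
    have hs : 0 ≤ ∑ i, (n i : ℝ) ^ 2 := Finset.sum_nonneg fun i _ => sq_nonneg _
    rw [e, norm_mul, Complex.norm_real, Real.norm_eq_abs, abs_of_pos (by positivity),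
      ← mul_assoc]
    refine le_mul_of_one_le_left (norm_nonneg _) ?_
    rw [inv_mul_eq_div, one_le_div (by positivity)]
    have h1 : (1 : ℝ) ≤ (2 * Real.pi) ^ 2 := one_le_pow₀ (by have := Real.pi_gt_three; linarith)
    exact add_le_add_right (le_mul_of_one_le_left hs h1) 1
  have hs : (Summable fun n : Fin 3 → ℤ =>
      ((1 : ℝ) + ∑ i, (n i : ℝ) ^ 2)⁻¹ * ‖coef n (u - ∑ i, h i)‖) ∧
      ∑' n : Fin 3 → ℤ, ((1 : ℝ) + ∑ i, (n i : ℝ) ^ 2)⁻¹ * ‖coef n (u - ∑ i, h i)‖ ≤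
        sobolevConst * ‖u - ∑ i, h i‖ := by
    have h1 := hasSum_coef_sq (u - ∑ i, h i)
    have hnn : ∀ n : Fin 3 → ℤ, 0 ≤ ((1 : ℝ) + ∑ i, (n i : ℝ) ^ 2)⁻¹ := fun n =>
      inv_nonneg.2 (add_nonneg zero_le_one (Finset.sum_nonneg fun i _ => sq_nonneg _))
    have := Real.summable_and_inner_le_Lp_mul_Lq_tsum_of_nonneg (p := 2) (q := 2) Real.HolderConjugate.two_two
      hnn (fun n => norm_nonneg (coef n (u - ∑ i, h i)))
      (by simpa using summable_inv_sq_fin_three) (by simpa using h1.summable)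
    refine ⟨this.1, this.2.trans ?_⟩
    simp only [Real.rpow_two, h1.tsum_eq, sobolevConst, ← Real.sqrt_eq_rpow]
    rw [Real.sqrt_sq (norm_nonneg _)]
  have h1 : Summable fun n => ‖coef n u‖ :=
    Summable.of_nonneg_of_le (fun n => norm_nonneg _) key hs.1
  exact ⟨h1, (h1.tsum_le_tsum key hs.1).trans hs.2⟩

/-- An absolutely summable Fourier series converges uniformly, and its sum represents `u` almost
everywhere by uniqueness of limits in `L²`. -/
lemma ae_abs_le_tsum_coef {u : Hx} (hs : Summable fun n => ‖coef n u‖) :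
    ∀ᵐ x, |u x| ≤ ∑' n, ‖coef n u‖ := by
  have hn : ∀ n, ‖coef n u • UnitAddTorus.mFourier n‖ = ‖coef n u‖ := fun n => by
    rw [norm_smul, UnitAddTorus.mFourier_norm, mul_one]
  have hs' : Summable fun n => coef n u • UnitAddTorus.mFourier n :=
    Summable.of_norm (by simpa only [hn] using hs)
  have h1 := (ContinuousMap.toLp (E := ℂ) 2 (volume : Measure Torus) ℂ).hasSum hs'.hasSum
  have h2 : HasSum (fun n => coef n u • fourierBasis n) (cplx u) := by
    refine (fourierBasis.hasSum_repr (cplx u)).congr_fun fun n => ?_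
    rw [coef_eq_inner, fourierBasis.repr_apply_apply]
  have h3 : ∀ n, ContinuousMap.toLp (E := ℂ) 2 (volume : Measure Torus) ℂ
      (UnitAddTorus.mFourier n) = fourierBasis n := fun n =>
    Lp.ext ((ContinuousMap.coeFn_toLp _ _).trans (coeFn_fourierBasis n).symm)
  simp only [map_smul, h3] at h1
  have h4 := h1.unique h2
  have h5 := ContinuousMap.coeFn_toLp (p := 2) (𝕜 := ℂ) (volume : Measure Torus)
    (∑' n, coef n u • UnitAddTorus.mFourier n)
  rw [h4] at h5
  filter_upwards [h5, coeFn_cplx u] with x hx1 hx2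
  rw [hx2] at hx1
  have h6 := ContinuousMap.norm_coe_le_norm (∑' n, coef n u • UnitAddTorus.mFourier n) x
  rw [← hx1, Complex.norm_real, Real.norm_eq_abs] at h6
  refine h6.trans ((norm_tsum_le_tsum_norm (by simpa only [hn] using hs)).trans_eq ?_)
  simp only [hn]

/-- **Sobolev's inequality** `H²(𝕋³) ⊆ L^∞(𝕋³)`. -/
lemma sobolev {u : Hx} {g h : Fin 3 → Hx} (hg : ∀ i, IsDerivX i u (g i))
    (hh : ∀ i, IsDerivX i (g i) (h i)) :
    ∀ᵐ x, |u x| ≤ sobolevConst * (‖u‖ + ∑ i, ‖h i‖) := by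
  obtain ⟨h1, h2⟩ := summable_coef_and_tsum_le hg hh
  filter_upwards [ae_abs_le_tsum_coef h1] with x hx
  refine hx.trans (h2.trans ?_)
  refine mul_le_mul_of_nonneg_left ?_ (Real.sqrt_nonneg _)
  exact (norm_sub_le _ _).trans (add_le_add_right (norm_sum_le _ _) _)

end

section

/-! ### Translations on the torus -/

lemma measurePreserving_translate (y : Torus) :
    MeasurePreserving (fun x : Torus => x + y) volume volume :=
  measurePreserving_add_right volume y

/-- Translation on `L²(𝕋³)`. -/
def translate (y : Torus) (u : Hx) : Hx :=
  Lp.compMeasurePreserving (fun x : Torus => x + y) (measurePreserving_translate y) u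

lemma coeFn_translate (y : Torus) (u : Hx) : translate y u =ᵐ[volume] fun x => u (x + y) :=
  Lp.coeFn_compMeasurePreserving u (measurePreserving_translate y)

lemma translate_zero (u : Hx) : translate 0 u = u := by
  refine Lp.ext ((coeFn_translate 0 u).trans ?_)
  simp only [add_zero]
  rfl

lemma continuous_translate (u : Hx) : Continuous fun y => translate y u := by
  have hc : Continuous fun p : Torus × Torus => p.2 + p.1 := by fun_prop
  exact Continuous.compMeasurePreservingLp (μ := volume) (ν := volume)
    (g := fun y : Torus => (⟨fun x => x + y, by fun_prop⟩ : C(Torus, Torus)))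
    (continuous_const (y := u)) (ContinuousMap.continuous_of_continuous_uncurry _ hc)
    measurePreserving_translate (by simp)

lemma mFourier_apply_add (n : Fin 3 → ℤ) (x y : Torus) : UnitAddTorus.mFourier n (x + y) =
    UnitAddTorus.mFourier n x * UnitAddTorus.mFourier n y := by
  simp only [UnitAddTorus.mFourier, ContinuousMap.coe_mk, Pi.add_apply,
    ← Finset.prod_mul_distrib]
  refine Finset.prod_congr rfl fun i _ => ?_
  rw [fourier_apply, fourier_apply, fourier_apply, smul_add, AddCircle.toCircle_add,
    Circle.coe_mul]

lemma coef_translate (n : Fin 3 → ℤ) (y : Torus) (u : Hx) :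
    coef n (translate y u) = UnitAddTorus.mFourier n y * coef n u := by
  rw [coef_eq_integral, coef_eq_integral, ← integral_const_mul,
    ← integral_add_right_eq_self (fun x => UnitAddTorus.mFourier n y *
      (UnitAddTorus.mFourier (-n) x * (u x : ℂ))) y]
  refine integral_congr_ae ?_
  filter_upwards [coeFn_translate y u] with x hx
  have h1 : UnitAddTorus.mFourier n y * UnitAddTorus.mFourier (-n) (x + y) =
      UnitAddTorus.mFourier (-n) x := by
    have e2 : UnitAddTorus.mFourier n y * UnitAddTorus.mFourier (-n) y = 1 := by
      rw [← UnitAddTorus.mFourier_add, add_neg_cancel, UnitAddTorus.mFourier_zero]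
      rfl
    rw [mFourier_apply_add]
    linear_combination UnitAddTorus.mFourier (-n) x * e2
  rw [hx, ← mul_assoc, h1]

/-- The line through `0` in the direction `x_i`. -/
def axis (i : Fin 3) (s : ℝ) : Torus := Pi.single i (s : UnitAddCircle)

lemma axis_zero (i : Fin 3) : axis i 0 = 0 := by
  simp [axis]

lemma continuous_axis (i : Fin 3) : Continuous (axis i) := by
  unfold axis
  exact (continuous_single i).comp (AddCircle.continuous_mk' 1)

lemma mFourier_axis (n : Fin 3 → ℤ) (i : Fin 3) (s : ℝ) :
    UnitAddTorus.mFourier n (axis i s) = Complex.exp (2 * Real.pi * Complex.I * n i * s) := by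
  have : ∀ j, (fourier (n j) (axis i s j) : ℂ) =
      if j = i then Complex.exp (2 * Real.pi * Complex.I * n i * s) else 1 := by
    intro j
    by_cases h : j = i
    · subst h
      rw [if_pos rfl, axis, Pi.single_eq_same, fourier_coe_apply]
      simp
    · rw [if_neg h, axis, Pi.single_eq_of_ne h, fourier_eval_zero]
  simp only [UnitAddTorus.mFourier, ContinuousMap.coe_mk, this]
  simp

/-- The fundamental theorem of calculus, compared coefficient by coefficient: translation multiplies
by `exp(2πi n_i s)`. Frequencies with `n_i = 0` are separated because the antiderivative divides by
`n_i`. -/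
lemma translate_axis_sub (i : Fin 3) {u g : Hx} (h : IsDerivX i u g) (s : ℝ) :
    translate (axis i s) u - u = ∫ r in (0 : ℝ)..s, translate (axis i r) g := by
  have hc : Continuous fun r => translate (axis i r) g :=
    (continuous_translate g).comp (continuous_axis i)
  refine eq_of_coef_eq fun n => ?_
  rw [← (coef n).intervalIntegral_comp_comm (hc.intervalIntegrable _ _), map_sub, coef_translate,
    mFourier_axis]
  simp only [coef_translate, mFourier_axis, h n]
  rw [intervalIntegral.integral_mul_const]
  by_cases hn : n i = 0
  · simp [hn]
  · have hne : (2 * Real.pi * Complex.I * n i : ℂ) ≠ 0 := by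
      simp [Real.pi_ne_zero, hn]
    rw [integral_exp_mul_complex hne]
    field_simp
    simp

/-- Turns a derivative given by Fourier coefficients into a strong `L²` limit of difference
quotients, the form in which space and time derivatives are treated alike. -/
lemma hasDerivAt_translate (i : Fin 3) {u g : Hx} (h : IsDerivX i u g) :
    HasDerivAt (fun s => translate (axis i s) u) g 0 := by
  have hc : Continuous fun r => translate (axis i r) g :=
    (continuous_translate g).comp (continuous_axis i)
  have h1 := (hc.integral_hasStrictDerivAt 0 0).hasDerivAt
  simp only [axis_zero, translate_zero] at h1
  have e : (fun s => translate (axis i s) u) =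
      fun s => (∫ r in (0 : ℝ)..s, translate (axis i r) g) + u := by
    funext s
    rw [← translate_axis_sub i h, sub_add_cancel]
  rw [e]
  exact h1.add_const u

end

section

/-! ### Regular fields on the space-time cylinder -/

/-- The `L²` norm of a function on the torus. -/
abbrev normTwo (u : Torus → ℝ) : ENNReal := eLpNorm u 2 volume

/-- The essential supremum of a function on the torus. -/
abbrev normSup (u : Torus → ℝ) : ENNReal := eLpNorm u ⊤ volume

lemma normTwo_mul_le (a : Torus → ℝ) {b : Torus → ℝ} (hb : AEStronglyMeasurable b volume) :
    normTwo (fun x => a x * b x) ≤ normSup a * normTwo b := by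
  refine eLpNorm_le_mul_eLpNorm_of_ae_le_mul'' 2 hb ?_
  filter_upwards [ae_le_eLpNormEssSup (f := a) (μ := (volume : Measure Torus))] with x hx
  rw [enorm_mul, normSup, eLpNorm_exponent_top]
  gcongr

lemma normSup_mul_le (a : Torus → ℝ) {b : Torus → ℝ} (hb : AEStronglyMeasurable b volume) :
    normSup (fun x => a x * b x) ≤ normSup a * normSup b := by
  refine eLpNorm_le_mul_eLpNorm_of_ae_le_mul'' ⊤ hb ?_
  filter_upwards [ae_le_eLpNormEssSup (f := a) (μ := (volume : Measure Torus))] with x hx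
  rw [enorm_mul, normSup, eLpNorm_exponent_top]
  gcongr

lemma normTwo_add_le {a b : Torus → ℝ} (ha : AEStronglyMeasurable a volume)
    (hb : AEStronglyMeasurable b volume) :
    normTwo (fun x => a x + b x) ≤ normTwo a + normTwo b :=
  eLpNorm_add_le ha hb (by norm_num)

lemma normSup_add_le {a b : Torus → ℝ} (ha : AEStronglyMeasurable a volume)
    (hb : AEStronglyMeasurable b volume) :
    normSup (fun x => a x + b x) ≤ normSup a + normSup b :=
  eLpNorm_add_le ha hb le_top

lemma normSup_le_of_ae {a : Torus → ℝ} {B : ℝ} (h : ∀ᵐ x, |a x| ≤ B) :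
    normSup a ≤ ENNReal.ofReal B := by
  rw [normSup, eLpNorm_exponent_top]
  exact eLpNormEssSup_le_of_ae_bound h

instance : IsProbabilityMeasure (volume : Measure UnitAddCircle) := by
  rw [volume_unitAddCircle]
  infer_instance

lemma normTwo_le_of_ae {a : Torus → ℝ} {B : ℝ} (h : ∀ᵐ x, |a x| ≤ B) :
    normTwo a ≤ ENNReal.ofReal B := by
  refine (eLpNorm_le_of_ae_bound (C := B) h).trans ?_
  simp

lemma normTwo_le_of_ae_le {a b : Torus → ℝ} {c : ℝ} (h : ∀ᵐ x, |a x| ≤ c * |b x|) :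
    normTwo a ≤ ENNReal.ofReal c * normTwo b :=
  eLpNorm_le_mul_eLpNorm_of_ae_le_mul h 2

lemma normSup_le_of_ae_le {a b : Torus → ℝ} {c : ℝ} (h : ∀ᵐ x, |a x| ≤ c * |b x|) :
    normSup a ≤ ENNReal.ofReal c * normSup b :=
  eLpNorm_le_mul_eLpNorm_of_ae_le_mul h ⊤

/-- Real functions of time and of the position on the torus. -/
abbrev Field := ℝ → Torus → ℝ

/-- The time component of the step of length `s` in direction `i`. -/
def timeStep (i : Fin 4) (s : ℝ) : ℝ := Fin.cases (motive := fun _ => ℝ) s (fun _ => 0) i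

/-- The space component of the step of length `s` in direction `i`. -/
def spaceStep (i : Fin 4) (s : ℝ) : Torus :=
  Fin.cases (motive := fun _ => Torus) 0 (fun j => axis j s) i

/-- The shift of a field by `s` in direction `i`, where `0` is time. -/
def shift (i : Fin 4) (s : ℝ) (u : Field) : Field :=
  fun t x => u (t + timeStep i s) (x + spaceStep i s)

/-- `g` is the strong `L²` derivative of `u` in direction `i` on `(0,T)`. -/
def HasD (T : ℝ) (i : Fin 4) (u g : Field) : Prop :=
  ∀ t ∈ Ioo 0 T, Tendsto (fun s => normTwo fun x => s⁻¹ * (shift i s u t x - u t x) - g t x)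
    (𝓝[≠] 0) (𝓝 0)

/-- Shifts of `u` in direction `i` converge uniformly. -/
def ShiftContinuous (T : ℝ) (i : Fin 4) (u : Field) : Prop :=
  ∀ t ∈ Ioo 0 T, Tendsto (fun s => normSup fun x => shift i s u t x - u t x) (𝓝[≠] 0) (𝓝 0)

/-- `u` has derivatives up to order `k` bounded by `B`: in `L^∞` up to order `k - 1`, and in `L²`
for order `k`. -/
def Reg (T : ℝ) : ℕ → (ℝ → ℝ) → Field → Prop
  | 0, B, u => (∀ t, AEStronglyMeasurable (u t) volume) ∧
      ∀ t ∈ Ioo 0 T, normTwo (u t) ≤ ENNReal.ofReal (B t)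
  | k + 1, B, u => (∀ t, AEStronglyMeasurable (u t) volume) ∧
      (∀ t ∈ Ioo 0 T, ∀ᵐ x, |u t x| ≤ B t) ∧ (∀ i, ShiftContinuous T i u) ∧
      ∀ i, ∃ g, HasD T i u g ∧ Reg T k B g

variable {T : ℝ}

lemma Reg.aesm {k : ℕ} {B : ℝ → ℝ} {u : Field} (h : Reg T k B u) (t : ℝ) :
    AEStronglyMeasurable (u t) volume := by
  cases k with
  | zero => exact h.1 t
  | succ k => exact h.1 t

lemma aesm_shift {u : Field} (h : ∀ t, AEStronglyMeasurable (u t) volume) (i : Fin 4) (s t : ℝ) :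
    AEStronglyMeasurable (shift i s u t) volume :=
  (h _).comp_quasiMeasurePreserving (measurePreserving_translate _).quasiMeasurePreserving

lemma tendsto_timeStep (i : Fin 4) : Tendsto (timeStep i) (𝓝[≠] 0) (𝓝 0) := by
  refine tendsto_nhdsWithin_of_tendsto_nhds ?_
  refine Fin.cases ?_ (fun j => ?_) i
  · exact tendsto_id
  · exact tendsto_const_nhds

/-- Small time shifts in both directions stay in the interval because it is open; this is why the
calculus works on `(0,T)` and `t = 0` is reached by a limit at the end. -/
lemma eventually_shift_mem (i : Fin 4) {t : ℝ} (ht : t ∈ Ioo 0 T) :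
    ∀ᶠ s in 𝓝[≠] (0 : ℝ), t + timeStep i s ∈ Ioo 0 T := by
  have h : Tendsto (fun s => t + timeStep i s) (𝓝[≠] 0) (𝓝 t) := by
    simpa using (tendsto_timeStep i).const_add t
  exact h.eventually (Ioo_mem_nhds ht.1 ht.2)

lemma eventually_ae_shift {P : ℝ → Torus → Prop} (h : ∀ t ∈ Ioo 0 T, ∀ᵐ x, P t x) (i : Fin 4)
    {t : ℝ} (ht : t ∈ Ioo 0 T) :
    ∀ᶠ s in 𝓝[≠] (0 : ℝ), ∀ᵐ x, P (t + timeStep i s) (x + spaceStep i s) := by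
  filter_upwards [eventually_shift_mem i ht] with s hs
  exact (measurePreserving_translate (spaceStep i s)).quasiMeasurePreserving.ae (h _ hs)

lemma HasD.congr {i : Fin 4} {u u' g g' : Field} (h : HasD T i u g)
    (hu : ∀ t ∈ Ioo 0 T, u t =ᵐ[volume] u' t) (hg : ∀ t ∈ Ioo 0 T, g t =ᵐ[volume] g' t) :
    HasD T i u' g' := fun t ht => by
  refine (h t ht).congr' ?_
  filter_upwards [eventually_ae_shift hu i ht] with s hs
  refine eLpNorm_congr_ae ?_
  filter_upwards [hs, hu t ht, hg t ht] with x h1 h2 h3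
  simp only [shift, h1, h2, h3]

lemma ShiftContinuous.congr {i : Fin 4} {u u' : Field} (h : ShiftContinuous T i u)
    (hu : ∀ t ∈ Ioo 0 T, u t =ᵐ[volume] u' t) : ShiftContinuous T i u' := fun t ht => by
  refine (h t ht).congr' ?_
  filter_upwards [eventually_ae_shift hu i ht] with s hs
  refine eLpNorm_congr_ae ?_
  filter_upwards [hs, hu t ht] with x h1 h2
  simp only [shift, h1, h2]

lemma Reg.congr {k : ℕ} {B : ℝ → ℝ} {u u' : Field} (h : Reg T k B u)
    (hu : ∀ t ∈ Ioo 0 T, u t =ᵐ[volume] u' t)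
    (hm : ∀ t, AEStronglyMeasurable (u' t) volume) : Reg T k B u' := by
  cases k with
  | zero => exact ⟨hm, fun t ht => by rw [normTwo, ← eLpNorm_congr_ae (hu t ht)]; exact h.2 t ht⟩
  | succ k =>
    refine ⟨hm, fun t ht => ?_, fun i => (h.2.2.1 i).congr hu, fun i => ?_⟩
    · filter_upwards [h.2.1 t ht, hu t ht] with x h1 h2
      rwa [← h2]
    · obtain ⟨g, hg, hr⟩ := h.2.2.2 i
      exact ⟨g, hg.congr hu fun t _ => ae_eq_refl _, hr⟩

lemma Reg.mono {k : ℕ} {B B' : ℝ → ℝ} {u : Field} (h : Reg T k B u)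
    (hB : ∀ t ∈ Ioo 0 T, B t ≤ B' t) : Reg T k B' u := by
  induction k generalizing u with
  | zero => exact ⟨h.1, fun t ht => (h.2 t ht).trans (ENNReal.ofReal_le_ofReal (hB t ht))⟩
  | succ k ih =>
    refine ⟨h.1, fun t ht => ?_, h.2.2.1, fun i => ?_⟩
    · filter_upwards [h.2.1 t ht] with x hx
      exact hx.trans (hB t ht)
    · obtain ⟨g, hg, hr⟩ := h.2.2.2 i
      exact ⟨g, hg, ih hr⟩

lemma Reg.of_succ {k : ℕ} {B : ℝ → ℝ} {u : Field} (h : Reg T (k + 1) B u) : Reg T k B u := by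
  induction k generalizing u with
  | zero => exact ⟨h.1, fun t ht => normTwo_le_of_ae (h.2.1 t ht)⟩
  | succ k ih =>
    refine ⟨h.1, h.2.1, h.2.2.1, fun i => ?_⟩
    obtain ⟨g, hg, hr⟩ := h.2.2.2 i
    exact ⟨g, hg, ih hr⟩

lemma Reg.normTwo_le {k : ℕ} {B : ℝ → ℝ} {u : Field} (h : Reg T k B u) {t : ℝ}
    (ht : t ∈ Ioo 0 T) : normTwo (u t) ≤ ENNReal.ofReal (B t) := by
  cases k with
  | zero => exact h.2 t ht
  | succ k => exact normTwo_le_of_ae (h.2.1 t ht)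

lemma HasD.add {i : Fin 4} {u w g h : Field} (hu : HasD T i u g) (hw : HasD T i w h)
    (mu : ∀ t, AEStronglyMeasurable (u t) volume) (mw : ∀ t, AEStronglyMeasurable (w t) volume)
    (mg : ∀ t, AEStronglyMeasurable (g t) volume) (mh : ∀ t, AEStronglyMeasurable (h t) volume) :
    HasD T i (fun t x => u t x + w t x) (fun t x => g t x + h t x) := fun t ht => by
  have h1 := (hu t ht).add (hw t ht)
  rw [add_zero] at h1
  refine tendsto_of_tendsto_of_tendsto_of_le_of_le tendsto_const_nhds h1 (fun _ => zero_le)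
    fun s => ?_
  have e : (fun x => s⁻¹ * (shift i s (fun t x => u t x + w t x) t x - (u t x + w t x)) -
      (g t x + h t x)) = fun x => (s⁻¹ * (shift i s u t x - u t x) - g t x) +
      (s⁻¹ * (shift i s w t x - w t x) - h t x) := by
    funext x
    simp only [shift]
    ring
  simp only [e]
  exact normTwo_add_le ((((aesm_shift mu i s t).sub (mu t)).const_mul _).sub (mg t))
    ((((aesm_shift mw i s t).sub (mw t)).const_mul _).sub (mh t))

lemma ShiftContinuous.add {i : Fin 4} {u w : Field} (hu : ShiftContinuous T i u)
    (hw : ShiftContinuous T i w) (mu : ∀ t, AEStronglyMeasurable (u t) volume)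
    (mw : ∀ t, AEStronglyMeasurable (w t) volume) :
    ShiftContinuous T i (fun t x => u t x + w t x) := fun t ht => by
  have h1 := (hu t ht).add (hw t ht)
  rw [add_zero] at h1
  refine tendsto_of_tendsto_of_tendsto_of_le_of_le tendsto_const_nhds h1 (fun _ => zero_le)
    fun s => ?_
  have e : (fun x => shift i s (fun t x => u t x + w t x) t x - (u t x + w t x)) =
      fun x => (shift i s u t x - u t x) + (shift i s w t x - w t x) := by
    funext x
    simp only [shift]
    ring
  simp only [e]
  exact normSup_add_le ((aesm_shift mu i s t).sub (mu t)) ((aesm_shift mw i s t).sub (mw t))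

lemma Reg.add {k : ℕ} {B B' : ℝ → ℝ} {u w : Field} (hB : ∀ t ∈ Ioo 0 T, 0 ≤ B t)
    (hB' : ∀ t ∈ Ioo 0 T, 0 ≤ B' t) (hu : Reg T k B u)
    (hw : Reg T k B' w) : Reg T k (fun t => B t + B' t) (fun t x => u t x + w t x) := by
  induction k generalizing u w with
  | zero =>
    refine ⟨fun t => (hu.1 t).add (hw.1 t), fun t ht => ?_⟩
    rw [ENNReal.ofReal_add (hB t ht) (hB' t ht)]
    exact (normTwo_add_le (hu.1 t) (hw.1 t)).trans (add_le_add (hu.2 t ht) (hw.2 t ht))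
  | succ k ih =>
    refine ⟨fun t => (hu.1 t).add (hw.1 t), fun t ht => ?_, fun i =>
      (hu.2.2.1 i).add (hw.2.2.1 i) hu.1 hw.1, fun i => ?_⟩
    · filter_upwards [hu.2.1 t ht, hw.2.1 t ht] with x h1 h2
      exact (abs_add_le _ _).trans (add_le_add h1 h2)
    · obtain ⟨g, hg, hr⟩ := hu.2.2.2 i
      obtain ⟨h, hh, hr'⟩ := hw.2.2.2 i
      exact ⟨_, hg.add hh hu.1 hw.1 hr.aesm hr'.aesm, ih hr hr'⟩

lemma Reg.const (k : ℕ) (c : ℝ) : Reg T k (fun _ => |c|) (fun _ _ => c) := by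
  induction k generalizing c with
  | zero =>
    exact ⟨fun t => aestronglyMeasurable_const, fun t ht =>
      normTwo_le_of_ae (Eventually.of_forall fun x => le_rfl)⟩
  | succ k ih =>
    refine ⟨fun t => aestronglyMeasurable_const, fun t ht => Eventually.of_forall fun x => le_rfl,
      fun i t ht => ?_, fun i => ⟨fun _ _ => 0, fun t ht => ?_, (ih 0).mono fun t ht => ?_⟩⟩
    · simp only [shift, sub_self]
      rw [show normSup (fun _ : Torus => (0 : ℝ)) = 0 from eLpNorm_zero]
      exact tendsto_const_nhds
    · simp [shift]
    · simp

lemma normSup_ne_top {a : Torus → ℝ} {B : ℝ} (h : ∀ᵐ x, |a x| ≤ B) : normSup a ≠ ⊤ :=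
  ((normSup_le_of_ae h).trans_lt ENNReal.ofReal_lt_top).ne

/-- The discrete Leibniz rule. The shifted `u` multiplies an `L²` null sequence and its increment
multiplies `h`, so shifts of `u` have to converge uniformly; for `w` boundedness is enough. -/
lemma HasD.mul {i : Fin 4} {u w g h : Field} {B B' : ℝ → ℝ}
    (hu : HasD T i u g) (hw : HasD T i w h) (cu : ShiftContinuous T i u)
    (bu : ∀ t ∈ Ioo 0 T, ∀ᵐ x, |u t x| ≤ B t) (bw : ∀ t ∈ Ioo 0 T, ∀ᵐ x, |w t x| ≤ B' t)
    (mu : ∀ t, AEStronglyMeasurable (u t) volume) (mw : ∀ t, AEStronglyMeasurable (w t) volume)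
    (mg : ∀ t, AEStronglyMeasurable (g t) volume) (mh : ∀ t, AEStronglyMeasurable (h t) volume)
    (nh : ∀ t ∈ Ioo 0 T, normTwo (h t) ≠ ⊤) :
    HasD T i (fun t x => u t x * w t x) (fun t x => g t x * w t x + u t x * h t x) :=
    fun t ht => by
  have hu0 := normSup_ne_top (bu t ht)
  have hw0 := normSup_ne_top (bw t ht)
  have l1 : Tendsto (fun s => (normSup (u t) + normSup fun x => shift i s u t x - u t x) *
      normTwo fun x => s⁻¹ * (shift i s w t x - w t x) - h t x) (𝓝[≠] 0) (𝓝 0) := by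
    have := ENNReal.Tendsto.mul (tendsto_const_nhds.add (cu t ht)) (Or.inr ENNReal.zero_ne_top)
      (hw t ht) (Or.inr (show normSup (u t) + 0 ≠ ⊤ by simpa using hu0))
    simpa using this
  have l2 : Tendsto (fun s => (normSup fun x => shift i s u t x - u t x) * normTwo (h t))
      (𝓝[≠] 0) (𝓝 0) := by
    simpa using ENNReal.Tendsto.mul_const (cu t ht) (Or.inr (nh t ht))
  have l3 : Tendsto (fun s => normSup (w t) *
      normTwo fun x => s⁻¹ * (shift i s u t x - u t x) - g t x) (𝓝[≠] 0) (𝓝 0) := by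
    simpa using ENNReal.Tendsto.const_mul (hu t ht) (Or.inr hw0)
  have l4 := (l1.add l2).add l3
  rw [add_zero, add_zero] at l4
  refine tendsto_of_tendsto_of_tendsto_of_le_of_le tendsto_const_nhds l4 (fun _ => zero_le)
    fun s => ?_
  have e : (fun x => s⁻¹ * (shift i s (fun t x => u t x * w t x) t x - (u t x * w t x)) -
      (g t x * w t x + u t x * h t x)) = fun x =>
      (shift i s u t x * (s⁻¹ * (shift i s w t x - w t x) - h t x) +
      (shift i s u t x - u t x) * h t x) +
      w t x * (s⁻¹ * (shift i s u t x - u t x) - g t x) := by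
    funext x
    simp only [shift]
    ring
  have m1 : AEStronglyMeasurable (fun x => s⁻¹ * (shift i s w t x - w t x) - h t x) volume :=
    (((aesm_shift mw i s t).sub (mw t)).const_mul s⁻¹).sub (mh t)
  have m2 : AEStronglyMeasurable (fun x => shift i s u t x - u t x) volume := (aesm_shift mu i s t).sub (mu t)
  have m3 : AEStronglyMeasurable (fun x => s⁻¹ * (shift i s u t x - u t x) - g t x) volume :=
    (((aesm_shift mu i s t).sub (mu t)).const_mul s⁻¹).sub (mg t)
  have m0 := aesm_shift mu i s t
  simp only [e]
  refine (normTwo_add_le ((m0.mul m1).add (m2.mul (mh t))) ((mw t).mul m3)).trans ?_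
  refine add_le_add ((normTwo_add_le (m0.mul m1) (m2.mul (mh t))).trans (add_le_add ?_ ?_)) ?_
  · refine (normTwo_mul_le _ m1).trans ?_
    gcongr
    have e2 : shift i s u t = fun x => u t x + (shift i s u t x - u t x) := by
      funext x
      ring
    conv_lhs => rw [e2]
    exact normSup_add_le (mu t) m2
  · exact normTwo_mul_le _ (mh t)
  · exact normTwo_mul_le _ m3

lemma ShiftContinuous.mul {i : Fin 4} {u w : Field} {B B' : ℝ → ℝ}
    (hu : ShiftContinuous T i u) (hw : ShiftContinuous T i w)
    (bu : ∀ t ∈ Ioo 0 T, ∀ᵐ x, |u t x| ≤ B t) (bw : ∀ t ∈ Ioo 0 T, ∀ᵐ x, |w t x| ≤ B' t)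
    (mu : ∀ t, AEStronglyMeasurable (u t) volume) (mw : ∀ t, AEStronglyMeasurable (w t) volume) :
    ShiftContinuous T i (fun t x => u t x * w t x) := fun t ht => by
  have hu0 := normSup_ne_top (bu t ht)
  have hw0 := normSup_ne_top (bw t ht)
  have l1 : Tendsto (fun s => (normSup (u t) + normSup fun x => shift i s u t x - u t x) *
      normSup fun x => shift i s w t x - w t x) (𝓝[≠] 0) (𝓝 0) := by
    have := ENNReal.Tendsto.mul (tendsto_const_nhds.add (hu t ht)) (Or.inr ENNReal.zero_ne_top)
      (hw t ht) (Or.inr (show normSup (u t) + 0 ≠ ⊤ by simpa using hu0))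
    simpa using this
  have l2 : Tendsto (fun s => normSup (w t) *
      normSup fun x => shift i s u t x - u t x) (𝓝[≠] 0) (𝓝 0) := by
    simpa using ENNReal.Tendsto.const_mul (hu t ht) (Or.inr hw0)
  have l4 := l1.add l2
  rw [add_zero] at l4
  refine tendsto_of_tendsto_of_tendsto_of_le_of_le tendsto_const_nhds l4 (fun _ => zero_le)
    fun s => ?_
  have e : (fun x => shift i s (fun t x => u t x * w t x) t x - (u t x * w t x)) = fun x =>
      shift i s u t x * (shift i s w t x - w t x) + w t x * (shift i s u t x - u t x) := by
    funext x
    simp only [shift]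
    ring
  have m1 : AEStronglyMeasurable (fun x => shift i s w t x - w t x) volume :=
    (aesm_shift mw i s t).sub (mw t)
  have m2 : AEStronglyMeasurable (fun x => shift i s u t x - u t x) volume :=
    (aesm_shift mu i s t).sub (mu t)
  simp only [e]
  refine (normSup_add_le ((aesm_shift mu i s t).mul m1) ((mw t).mul m2)).trans ?_
  refine add_le_add ?_ (normSup_mul_le _ m2)
  refine (normSup_mul_le _ m1).trans ?_
  gcongr
  have e2 : shift i s u t = fun x => u t x + (shift i s u t x - u t x) := by
    funext x
    ring
  conv_lhs => rw [e2]
  exact normSup_add_le (mu t) m2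

lemma nonneg_of_ae_abs_le {a : Torus → ℝ} {B : ℝ} (h : ∀ᵐ x, |a x| ≤ B) : 0 ≤ B := by
  obtain ⟨x, hx⟩ := h.exists
  exact (abs_nonneg _).trans hx

/-- Products of regular fields, one of them bounded. -/
lemma Reg.mul_of_bounded {k : ℕ} {B B' : ℝ → ℝ} {u w : Field} (hB : ∀ t ∈ Ioo 0 T, 0 ≤ B t)
    (hu : Reg T k B u) (hw : Reg T k B' w) (bw : ∀ t ∈ Ioo 0 T, ∀ᵐ x, |w t x| ≤ B' t) :
    Reg T k (fun t => 2 ^ k * (B t * B' t)) (fun t x => u t x * w t x) := by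
  have hB' : ∀ t ∈ Ioo 0 T, 0 ≤ B' t := fun t ht => nonneg_of_ae_abs_le (bw t ht)
  induction k generalizing u w B B' with
  | zero =>
    refine ⟨fun t => (hu.1 t).mul (hw.1 t), fun t ht => ?_⟩
    simp only [mul_comm (u t _)]
    refine (normTwo_mul_le _ (hu.1 t)).trans ?_
    rw [pow_zero, one_mul, mul_comm (B t), ENNReal.ofReal_mul (hB' t ht)]
    exact mul_le_mul' (normSup_le_of_ae (bw t ht)) (hu.2 t ht)
  | succ k ih =>
    refine ⟨fun t => (hu.1 t).mul (hw.1 t), fun t ht => ?_, fun i =>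
      (hu.2.2.1 i).mul (hw.2.2.1 i) hu.2.1 hw.2.1 hu.1 hw.1, fun i => ?_⟩
    · filter_upwards [hu.2.1 t ht, hw.2.1 t ht] with x h1 h2
      rw [abs_mul]
      refine (mul_le_mul h1 h2 (abs_nonneg _) (hB t ht)).trans ?_
      exact le_mul_of_one_le_left (mul_nonneg (hB t ht) (hB' t ht))
        (one_le_pow₀ (by norm_num))
    · obtain ⟨g, hg, hr⟩ := hu.2.2.2 i
      obtain ⟨h, hh, hr'⟩ := hw.2.2.2 i
      refine ⟨_, hg.mul hh (hu.2.2.1 i) hu.2.1 hw.2.1 hu.1 hw.1 hr.aesm hr'.aesm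
        (fun t ht => ((hr'.normTwo_le ht).trans_lt ENNReal.ofReal_lt_top).ne), ?_⟩
      -- In each Leibniz term the differentiated factor may end up merely in `L²`, but the
      -- undifferentiated one is still bounded, which is all that the induction asks. The roles are
      -- exchanged for the second term; two terms per order give `2 ^ k`.
      have h1 := ih hB hr hw.of_succ hw.2.1 hB'
      have h2 := ih hB' hr' hu.of_succ hu.2.1 hB
      have e : (fun (t : ℝ) (x : Torus) => h t x * u t x) = fun t x => u t x * h t x := by
        funext t x
        ring
      rw [e] at h2
      have hp : ∀ t ∈ Ioo 0 T, 0 ≤ 2 ^ k * (B t * B' t) := fun t ht =>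
        mul_nonneg (by positivity) (mul_nonneg (hB t ht) (hB' t ht))
      refine (Reg.add hp (fun t ht => by rw [mul_comm (B' t)]; exact hp t ht) h1 h2).mono
        fun t ht => le_of_eq ?_
      ring

/-- Products of regular fields. -/
lemma Reg.mul {k : ℕ} {B B' : ℝ → ℝ} {u w : Field} (hu : Reg T (k + 1) B u)
    (hw : Reg T (k + 1) B' w) :
    Reg T (k + 1) (fun t => 2 ^ (k + 1) * (B t * B' t)) (fun t x => u t x * w t x) :=
  Reg.mul_of_bounded (fun t ht => nonneg_of_ae_abs_le (hu.2.1 t ht)) hu hw hw.2.1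

/-! ### Composition with smooth functions -/

/-- A measurable function that is smooth on `(0,∞)`. -/
structure SmoothPos (φ : ℝ → ℝ) : Prop where
  measurable : Measurable φ
  contDiffOn : ContDiffOn ℝ ∞ φ (Ioi 0)

lemma SmoothPos.deriv {φ : ℝ → ℝ} (h : SmoothPos φ) : SmoothPos (deriv φ) :=
  ⟨measurable_deriv φ, h.contDiffOn.deriv_of_isOpen isOpen_Ioi (by simp)⟩

lemma SmoothPos.hasDerivAt {φ : ℝ → ℝ} (h : SmoothPos φ) {x : ℝ} (hx : 0 < x) :
    HasDerivAt φ (_root_.deriv φ x) x :=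
  ((h.contDiffOn.contDiffAt (Ioi_mem_nhds hx)).differentiableAt (by simp)).hasDerivAt

lemma SmoothPos.exists_lipschitz {φ : ℝ → ℝ} (h : SmoothPos φ) : ∃ C, 0 ≤ C ∧
    ∀ x ∈ Icc (1 / 2 : ℝ) 2, ∀ y ∈ Icc (1 / 2 : ℝ) 2, |φ y - φ x| ≤ C * |y - x| := by
  have hpos : ∀ x ∈ Icc (1 / 2 : ℝ) 2, 0 < x := fun x hx => by linarith [hx.1]
  have hc : ContinuousOn (_root_.deriv φ) (Icc (1 / 2) 2) :=
    h.deriv.contDiffOn.continuousOn.mono fun x hx => hpos x hx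
  obtain ⟨C, hC⟩ := isCompact_Icc.exists_bound_of_continuousOn hc
  refine ⟨C, (norm_nonneg _).trans (hC 1 (by norm_num)), fun x hx y hy => ?_⟩
  exact (convex_Icc (1 / 2 : ℝ) 2).norm_image_sub_le_of_norm_hasDerivWithin_le
    (fun z hz => (h.hasDerivAt (hpos z hz)).hasDerivWithinAt) hC hx hy

lemma SmoothPos.exists_taylor {φ : ℝ → ℝ} (h : SmoothPos φ) : ∃ C, 0 ≤ C ∧
    ∀ x ∈ Icc (1 / 2 : ℝ) 2, ∀ y ∈ Icc (1 / 2 : ℝ) 2,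
      |φ y - φ x - _root_.deriv φ x * (y - x)| ≤ C * |y - x| ^ 2 := by
  obtain ⟨C, hC, hL⟩ := h.deriv.exists_lipschitz
  have hpos : ∀ x ∈ Icc (1 / 2 : ℝ) 2, 0 < x := fun x hx => by linarith [hx.1]
  refine ⟨C, hC, fun x hx y hy => ?_⟩
  have hsub : uIcc x y ⊆ Icc (1 / 2 : ℝ) 2 := uIcc_subset_Icc hx hy
  have key := (convex_uIcc x y).norm_image_sub_le_of_norm_hasDerivWithin_le
    -- Subtracting the tangent leaves a function whose derivative on the segment is at most `C|y -
    -- x|`, by the Lipschitz bound for `φ'`.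
    (f := fun z => φ z - _root_.deriv φ x * z) (f' := fun z => _root_.deriv φ z - _root_.deriv φ x)
    (C := C * |y - x|)
    (fun z hz => ((h.hasDerivAt (hpos z (hsub hz))).sub
      (by simpa using (hasDerivAt_id z).const_mul (_root_.deriv φ x))).hasDerivWithinAt)
    (fun z hz => (hL x hx z (hsub hz)).trans
      (mul_le_mul_of_nonneg_left (abs_sub_left_of_mem_uIcc hz) hC))
    left_mem_uIcc right_mem_uIcc
  simp only [Real.norm_eq_abs] at key
  calc _ = |φ y - _root_.deriv φ x * y - (φ x - _root_.deriv φ x * x)| := by congr 1; ring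
    _ ≤ _ := key
    _ = _ := by ring

lemma ShiftContinuous.comp {i : Fin 4} {y : Field} {φ : ℝ → ℝ} (hφ : SmoothPos φ)
    (hy : ShiftContinuous T i y) (ry : ∀ t ∈ Ioo 0 T, ∀ᵐ x, 1 + y t x ∈ Icc (1 / 2 : ℝ) 2) :
    ShiftContinuous T i (fun t x => φ (1 + y t x) - φ 1) := fun t ht => by
  obtain ⟨C, hC, hL⟩ := hφ.exists_lipschitz
  have l1 : Tendsto (fun s => ENNReal.ofReal C * normSup fun x => shift i s y t x - y t x)
      (𝓝[≠] 0) (𝓝 0) := by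
    simpa using ENNReal.Tendsto.const_mul (hy t ht) (Or.inr ENNReal.ofReal_ne_top)
  refine tendsto_of_tendsto_of_tendsto_of_le_of_le' tendsto_const_nhds l1
    (Eventually.of_forall fun _ => zero_le) ?_
  filter_upwards [eventually_ae_shift ry i ht] with s hs
  refine normSup_le_of_ae_le ?_
  filter_upwards [hs, ry t ht] with x h1 h2
  have := hL _ h2 _ h1
  simp only [shift]
  calc _ = |φ (1 + y (t + timeStep i s) (x + spaceStep i s)) - φ (1 + y t x)| := by
        congr 1; ring
    _ ≤ _ := this
    _ = _ := by congr 2; ring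

/-- The Taylor remainder divided by `s` is at most the increment of `y` times its difference
quotient. The increment tends to zero in `L^∞` and the quotient stays bounded in `L²`. -/
lemma HasD.comp {i : Fin 4} {y g : Field} {φ : ℝ → ℝ} (hφ : SmoothPos φ)
    (hy : ShiftContinuous T i y) (hg : HasD T i y g)
    (ry : ∀ t ∈ Ioo 0 T, ∀ᵐ x, 1 + y t x ∈ Icc (1 / 2 : ℝ) 2)
    (my : ∀ t, AEStronglyMeasurable (y t) volume) (mg : ∀ t, AEStronglyMeasurable (g t) volume)
    (ng : ∀ t ∈ Ioo 0 T, normTwo (g t) ≠ ⊤) :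
    HasD T i (fun t x => φ (1 + y t x) - φ 1) (fun t x => g t x * deriv φ (1 + y t x)) :=
    fun t ht => by
  obtain ⟨C, hC, hL⟩ := hφ.exists_taylor
  obtain ⟨C', hC', hL'⟩ := hφ.deriv.exists_lipschitz
  have hd : ∀ᵐ x, |deriv φ (1 + y t x)| ≤ C' * 2 + |deriv φ 1| := by
    filter_upwards [ry t ht] with x hx
    have h1 := hL' 1 (by norm_num) _ hx
    have h2 : |1 + y t x - 1| ≤ 2 := by
      rw [abs_le]
      constructor <;> linarith [hx.1, hx.2]
    have h3 := abs_sub_abs_le_abs_sub (deriv φ (1 + y t x)) (deriv φ 1)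
    have h4 := mul_le_mul_of_nonneg_left h2 hC'
    linarith
  have md : AEStronglyMeasurable (fun x => deriv φ (1 + y t x)) volume :=
    (hφ.deriv.measurable.comp_aemeasurable
      ((my t).aemeasurable.const_add 1)).aestronglyMeasurable
  have l1 : Tendsto (fun s => (normSup fun x => C * (shift i s y t x - y t x)) *
      ((normTwo fun x => s⁻¹ * (shift i s y t x - y t x) - g t x) + normTwo (g t)))
      (𝓝[≠] 0) (𝓝 0) := by
    have l0 : Tendsto (fun s => normSup fun x => C * (shift i s y t x - y t x))
        (𝓝[≠] 0) (𝓝 0) := by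
      have : Tendsto (fun s => ENNReal.ofReal C * normSup fun x => shift i s y t x - y t x)
          (𝓝[≠] 0) (𝓝 0) := by
        simpa using ENNReal.Tendsto.const_mul (hy t ht) (Or.inr ENNReal.ofReal_ne_top)
      refine tendsto_of_tendsto_of_tendsto_of_le_of_le tendsto_const_nhds this
        (fun _ => zero_le) fun s => normSup_le_of_ae_le (Eventually.of_forall fun x => ?_)
      rw [abs_mul, abs_of_nonneg hC]
    have := ENNReal.Tendsto.mul l0 (Or.inr (show 0 + normTwo (g t) ≠ ⊤ by simpa using ng t ht))
      ((hg t ht).add tendsto_const_nhds) (Or.inr ENNReal.zero_ne_top)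
    simpa using this
  have l2 : Tendsto (fun s => normSup (fun x => deriv φ (1 + y t x)) *
      normTwo fun x => s⁻¹ * (shift i s y t x - y t x) - g t x) (𝓝[≠] 0) (𝓝 0) := by
    simpa using ENNReal.Tendsto.const_mul (hg t ht) (Or.inr (normSup_ne_top hd))
  have l3 := l1.add l2
  rw [add_zero] at l3
  refine tendsto_of_tendsto_of_tendsto_of_le_of_le' tendsto_const_nhds l3
    (Eventually.of_forall fun _ => zero_le) ?_
  filter_upwards [eventually_ae_shift ry i ht] with s hs
  have e : (fun x => s⁻¹ * (shift i s (fun t x => φ (1 + y t x) - φ 1) t x -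
      (φ (1 + y t x) - φ 1)) - g t x * deriv φ (1 + y t x)) = fun x =>
      s⁻¹ * (φ (1 + shift i s y t x) - φ (1 + y t x) -
        deriv φ (1 + y t x) * (shift i s y t x - y t x)) +
      deriv φ (1 + y t x) * (s⁻¹ * (shift i s y t x - y t x) - g t x) := by
    funext x
    simp only [shift]
    ring
  have ms := aesm_shift my i s t
  have m1 : AEStronglyMeasurable (fun x => s⁻¹ * (shift i s y t x - y t x) - g t x) volume :=
    ((ms.sub (my t)).const_mul s⁻¹).sub (mg t)
  have m2 : AEStronglyMeasurable (fun x => s⁻¹ * (shift i s y t x - y t x)) volume :=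
    (ms.sub (my t)).const_mul s⁻¹
  have mφ : ∀ {a : Torus → ℝ}, AEStronglyMeasurable a volume →
      AEStronglyMeasurable (fun x => φ (1 + a x)) volume := fun ha =>
    (hφ.measurable.comp_aemeasurable (ha.aemeasurable.const_add 1)).aestronglyMeasurable
  have m3 : AEStronglyMeasurable (fun x => s⁻¹ * (φ (1 + shift i s y t x) - φ (1 + y t x) -
      deriv φ (1 + y t x) * (shift i s y t x - y t x))) volume :=
    (((mφ ms).sub (mφ (my t))).sub (md.mul (ms.sub (my t)))).const_mul _
  simp only [e]
  refine (normTwo_add_le m3 (md.mul m1)).trans (add_le_add ?_ (normTwo_mul_le _ m1))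
  have b1 : normTwo (fun x => s⁻¹ * (φ (1 + shift i s y t x) - φ (1 + y t x) -
      deriv φ (1 + y t x) * (shift i s y t x - y t x))) ≤
      normTwo (fun x => C * (shift i s y t x - y t x) *
        (s⁻¹ * (shift i s y t x - y t x))) := by
    refine eLpNorm_mono_ae ?_
    filter_upwards [hs, ry t ht] with x h1 h2
    have h3 := hL _ h2 _ h1
    have h4 : 1 + y (t + timeStep i s) (x + spaceStep i s) - (1 + y t x) =
        shift i s y t x - y t x := by
      simp only [shift]; ring
    rw [h4] at h3
    simp only [Real.norm_eq_abs, abs_mul, abs_of_nonneg hC]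
    refine (mul_le_mul_of_nonneg_left h3 (abs_nonneg _)).trans (le_of_eq ?_)
    ring
  refine b1.trans ((normTwo_mul_le _ m2).trans ?_)
  gcongr
  have e2 : (fun x => s⁻¹ * (shift i s y t x - y t x)) = fun x =>
      (s⁻¹ * (shift i s y t x - y t x) - g t x) + g t x := by
    funext x
    ring
  rw [e2]
  exact normTwo_add_le m1 (mg t)

/-- Smooth functions of regular fields are regular. -/
lemma Reg.comp {R : ℝ} (hR : 0 ≤ R) (k : ℕ) : ∀ {φ : ℝ → ℝ}, SmoothPos φ → ∃ C, 0 ≤ C ∧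
    ∀ (T : ℝ) (B : ℝ → ℝ) (y : Field), (∀ t ∈ Ioo 0 T, 0 ≤ B t) → (∀ t ∈ Ioo 0 T, B t ≤ R) →
      (∀ t ∈ Ioo 0 T, ∀ᵐ x, 1 + y t x ∈ Icc (1 / 2 : ℝ) 2) → Reg T k B y →
      Reg T k (fun t => C * B t) (fun t x => φ (1 + y t x) - φ 1) := by
  induction k with
  | zero =>
    intro φ hφ
    obtain ⟨C, hC, hL⟩ := hφ.exists_lipschitz
    refine ⟨C, hC, fun T B y hB0 hB1 ry hy => ⟨fun t => ?_, fun t ht => ?_⟩⟩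
    · exact (hφ.measurable.comp_aemeasurable
        ((hy.1 t).aemeasurable.const_add 1)).aestronglyMeasurable.sub aestronglyMeasurable_const
    · rw [ENNReal.ofReal_mul hC]
      refine (normTwo_le_of_ae_le (c := C) (b := y t) ?_).trans (by gcongr; exact hy.2 t ht)
      filter_upwards [ry t ht] with x hx
      simpa using hL 1 (by norm_num) _ hx
  | succ k ih =>
    intro φ hφ
    obtain ⟨C, hC, hL⟩ := hφ.exists_lipschitz
    obtain ⟨C', hC', hL'⟩ := hφ.deriv.exists_lipschitz
    obtain ⟨K, hK, hreg⟩ := ih hφ.deriv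
    -- `C` serves the supremum bound. The other terms serve the derivative `g φ'(1 + y)`, split into
    -- `g (φ'(1 + y) - φ'(1))`, which is of order `B² ≤ R B`, and `g φ'(1)`.
    refine ⟨C + 2 ^ k * ((C' + K) * R) + 2 ^ k * |deriv φ 1|, by positivity,
      fun T B y hB0 hB1 ry hy => ?_⟩
    refine ⟨fun t => (hφ.measurable.comp_aemeasurable
        ((hy.1 t).aemeasurable.const_add 1)).aestronglyMeasurable.sub aestronglyMeasurable_const,
      fun t ht => ?_, fun i => (hy.2.2.1 i).comp hφ ry, fun i => ?_⟩
    · filter_upwards [ry t ht, hy.2.1 t ht] with x hx h1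
      have h2 := hL 1 (by norm_num) _ hx
      rw [add_sub_cancel_left] at h2
      refine h2.trans ((mul_le_mul_of_nonneg_left h1 hC).trans ?_)
      refine mul_le_mul_of_nonneg_right ?_ (hB0 t ht)
      have : 0 ≤ 2 ^ k * ((C' + K) * R) + 2 ^ k * |deriv φ 1| := by positivity
      linarith
    · obtain ⟨g, hg, hr⟩ := hy.2.2.2 i
      refine ⟨_, hg.comp hφ (hy.2.2.1 i) ry hy.1 hr.aesm
        (fun t ht => ((hr.normTwo_le ht).trans_lt ENNReal.ofReal_lt_top).ne), ?_⟩
      -- The bound is enlarged from `K` to `C' + K` so that it also dominates the supremum of this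
      -- factor, as the product rule requires.
      have r1 := (hreg T B y hB0 hB1 ry hy.of_succ).mono (B' := fun t => (C' + K) * B t)
        fun t ht => mul_le_mul_of_nonneg_right (by linarith) (hB0 t ht)
      have r2 := hr.mul_of_bounded hB0 r1 (fun t ht => by
        filter_upwards [ry t ht, hy.2.1 t ht] with x hx h1
        have h2 := hL' 1 (by norm_num) _ hx
        rw [add_sub_cancel_left] at h2
        refine h2.trans ((mul_le_mul_of_nonneg_left h1 hC').trans ?_)
        exact mul_le_mul_of_nonneg_right (by linarith) (hB0 t ht))
      have r3 := hr.mul_of_bounded hB0 (Reg.const k (deriv φ 1))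
        (fun t ht => Eventually.of_forall fun x => le_rfl)
      have r4 := Reg.add (fun t ht => by have := hB0 t ht; positivity)
        (fun t ht => by have := hB0 t ht; positivity) r2 r3
      have e : (fun (t : ℝ) (x : Torus) => g t x * (deriv φ (1 + y t x) - deriv φ 1) +
          g t x * deriv φ 1) = fun t x => g t x * deriv φ (1 + y t x) := by
        funext t x
        ring
      rw [e] at r4
      refine r4.mono fun t ht => ?_
      have h0 := hB0 t ht
      have h1 : B t * ((C' + K) * B t) ≤ (C' + K) * R * B t := by
        rw [mul_comm (B t), mul_right_comm]
        exact mul_le_mul_of_nonneg_right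
          (mul_le_mul_of_nonneg_left (hB1 t ht) (by positivity)) h0
      have h2 := mul_le_mul_of_nonneg_left h1 (by positivity : (0 : ℝ) ≤ 2 ^ k)
      have h3 : 0 ≤ C * B t := by positivity
      nlinarith

end

section

/-! ### Velocity moments of functions on phase space -/

/-- The moment of a function on phase space against a function of the velocity. -/
def momFun (θ : Vel → ℝ) (f : Phase → ℝ) (x : Torus) : ℝ := ∫ v, f (x, v) * θ v

lemma aesm_prod (f : L2) :
    AEStronglyMeasurable (fun p : Phase => f p) ((volume : Measure Torus).prod volume) := by
  rw [← Measure.volume_eq_prod]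
  exact Lp.aestronglyMeasurable f

lemma integrable_sq (f : L2) :
    Integrable (fun p : Phase => f p ^ 2) ((volume : Measure Torus).prod volume) := by
  rw [← Measure.volume_eq_prod]
  exact (memLp_two_iff_integrable_sq (Lp.aestronglyMeasurable f)).1 (Lp.memLp f)

lemma ae_memLp_slice (f : L2) : ∀ᵐ x : Torus, MemLp (fun v : Vel => f (x, v)) 2 := by
  filter_upwards [(integrable_sq f).prod_right_ae, (aesm_prod f).prodMk_left] with x h1 h2
  exact (memLp_two_iff_integrable_sq h2).2 h1

lemma ae_slice {P : Phase → Prop} (h : ∀ᵐ p, P p) : ∀ᵐ x : Torus, ∀ᵐ v : Vel, P (x, v) := by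
  rw [Measure.volume_eq_prod] at h
  exact Measure.ae_ae_of_ae_prod h

lemma ae_fst {P : Torus → Prop} (h : ∀ᵐ x, P x) : ∀ᵐ q : Phase, P q.1 := by
  rw [Measure.volume_eq_prod]
  exact Measure.quasiMeasurePreserving_fst.ae h

lemma integrable_slice_mul {g θ : Vel → ℝ} (hg : MemLp g 2) (hθ : MemLp θ 2) :
    Integrable fun v => g v * θ v :=
  hg.integrable_mul hθ

lemma inner_toLp {θ g : Vel → ℝ} (hθ : MemLp θ 2) (hg : MemLp g 2) :
    inner ℝ (hθ.toLp θ) (hg.toLp g) = ∫ v, g v * θ v := by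
  rw [L2.inner_def]
  refine integral_congr_ae ?_
  filter_upwards [hθ.coeFn_toLp, hg.coeFn_toLp] with v h1 h2
  rw [h1, h2]
  simp

lemma norm_toLp_sq {g : Vel → ℝ} (hg : MemLp g 2) : ‖hg.toLp g‖ ^ 2 = ∫ v, g v ^ 2 := by
  rw [← real_inner_self_eq_norm_sq, inner_toLp hg hg]
  simp only [sq]

lemma sq_integral_mul_le {θ g : Vel → ℝ} (hθ : MemLp θ 2) (hg : MemLp g 2) :
    (∫ v, g v * θ v) ^ 2 ≤ (∫ v, θ v ^ 2) * ∫ v, g v ^ 2 := by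
  rw [← inner_toLp hθ hg, ← norm_toLp_sq hθ, ← norm_toLp_sq hg, ← mul_pow, ← sq_abs]
  exact pow_le_pow_left₀ (abs_nonneg _) (abs_real_inner_le_norm _ _) 2

lemma norm_sq_eq_integral (f : L2) : ‖f‖ ^ 2 = ∫ x : Torus, ∫ v : Vel, f (x, v) ^ 2 := by
  rw [← integral_prod _ (integrable_sq f), ← Measure.volume_eq_prod,
    ← real_inner_self_eq_norm_sq, L2.inner_def]
  refine integral_congr_ae (Eventually.of_forall fun p => ?_)
  simp [sq]

lemma norm_sq_Hx (u : Hx) : ‖u‖ ^ 2 = ∫ x, u x ^ 2 := by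
  rw [← real_inner_self_eq_norm_sq, L2.inner_def]
  refine integral_congr_ae (Eventually.of_forall fun p => ?_)
  simp [sq]

lemma aesm_momFun {θ : Vel → ℝ} (hθ : MemLp θ 2) (f : L2) :
    AEStronglyMeasurable (momFun θ f) volume := by
  have h : AEStronglyMeasurable (fun p : Torus × Vel => f p * θ p.2)
      ((volume : Measure Torus).prod volume) :=
    (aesm_prod f).mul hθ.1.comp_snd
  exact h.integral_prod_right'

lemma ae_momFun_sq_le {θ : Vel → ℝ} (hθ : MemLp θ 2) (f : L2) :
    ∀ᵐ x, momFun θ f x ^ 2 ≤ (∫ v, θ v ^ 2) * ∫ v, f (x, v) ^ 2 := by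
  filter_upwards [ae_memLp_slice f] with x hx
  exact sq_integral_mul_le hθ hx

lemma memLp_momFun {θ : Vel → ℝ} (hθ : MemLp θ 2) (f : L2) : MemLp (momFun θ f) 2 := by
  rw [memLp_two_iff_integrable_sq (aesm_momFun hθ f)]
  refine ((integrable_sq f).integral_prod_left.const_mul (∫ v, θ v ^ 2)).mono'
    ((aesm_momFun hθ f).pow 2) ?_
  filter_upwards [ae_momFun_sq_le hθ f] with x hx
  rwa [Real.norm_eq_abs, abs_of_nonneg (sq_nonneg _)]

lemma norm_toLp_momFun_le {θ : Vel → ℝ} (hθ : MemLp θ 2) (f : L2) :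
    ‖(memLp_momFun hθ f).toLp _‖ ≤ √(∫ v, θ v ^ 2) * ‖f‖ := by
  refine abs_le_of_sq_le_sq' ?_ (by positivity) |>.2
  rw [mul_pow, Real.sq_sqrt (integral_nonneg fun v => sq_nonneg _), norm_sq_Hx,
    norm_sq_eq_integral, ← integral_const_mul]
  refine integral_mono_ae ?_ ((integrable_sq f).integral_prod_left.const_mul _) ?_
  · exact (memLp_two_iff_integrable_sq (Lp.aestronglyMeasurable _)).1 (Lp.memLp _)
  · filter_upwards [ae_momFun_sq_le hθ f, (memLp_momFun hθ f).coeFn_toLp] with x h1 h2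
    rwa [h2]

/-- The moment operator `L²(𝕋³ × ℝ³) → L²(𝕋³)` of a polynomial, `f ↦ ∫ f p √m dv`. -/
def mom (p : Poly) : L2 →L[ℝ] Hx :=
  LinearMap.mkContinuous
    { toFun := fun f => (memLp_momFun (memLp_weight p) f).toLp _
      map_add' := fun f g => by
        rw [← MemLp.toLp_add]
        refine MemLp.toLp_congr _ _ ?_
        filter_upwards [ae_memLp_slice f, ae_memLp_slice g, ae_slice (Lp.coeFn_add f g)]
          with x h1 h2 h3
        simp only [momFun, Pi.add_apply]
        rw [← integral_add (integrable_slice_mul h1 (memLp_weight p))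
          (integrable_slice_mul h2 (memLp_weight p))]
        refine integral_congr_ae ?_
        filter_upwards [h3] with v hv
        rw [hv, Pi.add_apply, add_mul]
      map_smul' := fun c f => by
        rw [RingHom.id_apply, ← MemLp.toLp_const_smul]
        refine MemLp.toLp_congr _ _ ?_
        filter_upwards [ae_slice (Lp.coeFn_smul c f)] with x h3
        simp only [momFun, Pi.smul_apply, smul_eq_mul]
        rw [← integral_const_mul]
        refine integral_congr_ae ?_
        filter_upwards [h3] with v hv
        rw [hv, Pi.smul_apply, smul_eq_mul, mul_assoc] }
    √(∫ v, weight p v ^ 2) (fun f => norm_toLp_momFun_le (memLp_weight p) f)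

lemma coeFn_mom (p : Poly) (f : L2) :
    mom p f =ᵐ[volume] fun x => ∫ v, f (x, v) * weight p v :=
  (memLp_momFun (memLp_weight p) f).coeFn_toLp

lemma mom_append (p q : Poly) (f : L2) : mom (p ++ q) f = mom p f + mom q f := by
  refine Lp.ext ?_
  filter_upwards [coeFn_mom (p ++ q) f, coeFn_mom p f, coeFn_mom q f,
    Lp.coeFn_add (mom p f) (mom q f), ae_memLp_slice f] with x h1 h2 h3 h4 h5
  rw [h1, h4, Pi.add_apply, h2, h3, ← integral_add (integrable_slice_mul h5 (memLp_weight p))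
    (integrable_slice_mul h5 (memLp_weight q))]
  refine integral_congr_ae (Eventually.of_forall fun v => ?_)
  simp only [weight, Poly.ev_append]
  ring

lemma mom_smul (c : ℤ) (p : Poly) (f : L2) : mom (Poly.smul c p) f = (c : ℝ) • mom p f := by
  refine Lp.ext ?_
  filter_upwards [coeFn_mom (Poly.smul c p) f, coeFn_mom p f,
    Lp.coeFn_smul (c : ℝ) (mom p f)] with x h1 h2 h4
  rw [h1, h4, Pi.smul_apply, h2, smul_eq_mul, ← integral_const_mul]
  refine integral_congr_ae (Eventually.of_forall fun v => ?_)
  simp only [weight, Poly.ev_smul]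
  ring

lemma mom_congr {p q : Poly} (h : ∀ v, p.ev v = q.ev v) (f : L2) : mom p f = mom q f := by
  refine Lp.ext ?_
  filter_upwards [coeFn_mom p f, coeFn_mom q f] with x h1 h2
  rw [h1, h2]
  refine integral_congr_ae (Eventually.of_forall fun v => ?_)
  simp only [weight, h]

/-! ### The kernel of the linearized operator -/

/-- An orthogonal basis of the kernel of the linearized operator, without the weight `√m`. -/
def ker : Fin 8 → Poly := ![Poly.one, Poly.X 0, Poly.X 1, Poly.X 2,
  Poly.sq ++ Poly.smul (-3) Poly.one, Poly.heat 0, Poly.heat 1, Poly.heat 2]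

/-- The squared norms of the basis of the kernel. -/
def kerNorm : Fin 8 → ℤ := ![1, 1, 1, 1, 6, 10, 10, 10]

lemma gauss_ker (j k : Fin 8) :
    ((ker j).mul (ker k)).gauss = if j = k then kerNorm j else 0 := by
  revert j k; decide

lemma kerNorm_pos (k : Fin 8) : 0 < kerNorm k := by revert k; decide

/-- The squared distance to the kernel of the linearized operator. -/
def microSq (f : L2) : ℝ := ‖f‖ ^ 2 - ∑ k, ‖mom (ker k) f‖ ^ 2 / kerNorm k

/-- Bessel's inequality in velocity for almost every `x`, integrated over the torus. -/
lemma bessel {ι : Type*} [Fintype ι] [DecidableEq ι] (p : ι → Poly) (c : ι → ℤ)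
    (hc : ∀ i, 0 < c i) (h : ∀ i j, ((p i).mul (p j)).gauss = if i = j then c i else 0) (f : L2) :
    ∑ i, ‖mom (p i) f‖ ^ 2 / c i ≤ ‖f‖ ^ 2 := by
  have hcR : ∀ i, (0 : ℝ) < c i := fun i => by exact_mod_cast hc i
  have hi : ∀ i, Integrable fun x => (mom (p i) f) x ^ 2 := fun i =>
    (memLp_two_iff_integrable_sq (Lp.aestronglyMeasurable _)).1 (Lp.memLp _)
  simp only [norm_sq_Hx, norm_sq_eq_integral, ← integral_div]
  rw [← integral_finsetSum _ fun i _ => (hi i).div_const _]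
  refine integral_mono_ae (integrable_finsetSum _ fun i _ => (hi i).div_const _)
    (integrable_sq f).integral_prod_left ?_
  have hae : ∀ᵐ x, ∀ i, mom (p i) f x = ∫ v, f (x, v) * weight (p i) v :=
    ae_all_iff.2 fun i => coeFn_mom (p i) f
  filter_upwards [hae, ae_memLp_slice f] with x h1 h2
  let e : ι → Lp ℝ 2 (volume : Measure Vel) := fun i =>
    (√(c i))⁻¹ • (memLp_weight (p i)).toLp _
  have ho : Orthonormal ℝ e := by
    rw [orthonormal_iff_ite]
    intro i j
    simp only [e, inner_smul_left, inner_smul_right, inner_toLp, integral_weight_mul_weight, h]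
    by_cases hij : i = j
    · subst hij
      simp only [if_true, RCLike.conj_to_real]
      rw [← mul_assoc, ← mul_inv, Real.mul_self_sqrt (hcR i).le, inv_mul_cancel₀ (hcR i).ne']
    · simp [hij, Ne.symm hij]
  have := ho.sum_inner_products_le (x := h2.toLp _) (s := Finset.univ)
  rw [norm_toLp_sq] at this
  refine le_trans (le_of_eq (Finset.sum_congr rfl fun i _ => ?_)) this
  simp only [e, inner_smul_left, inner_toLp, h1, RCLike.conj_to_real, Real.norm_eq_abs, sq_abs]
  rw [mul_pow, inv_pow, Real.sq_sqrt (hcR i).le, inv_mul_eq_div]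

lemma microSq_nonneg (f : L2) : 0 ≤ microSq f :=
  sub_nonneg.2 (bessel ker kerNorm kerNorm_pos gauss_ker f)

lemma gauss_mul_comm (p q : Poly) : (p.mul q).gauss = (q.mul p).gauss := by
  have h := integral_weight_mul_weight p q
  simp only [mul_comm (weight p _)] at h
  rw [integral_weight_mul_weight] at h
  exact_mod_cast h.symm

lemma gauss_mul_self_nonneg (p : Poly) : 0 ≤ (p.mul p).gauss := by
  have h := integral_weight_mul_weight p p
  have h1 : 0 ≤ ∫ v, weight p v * weight p v := integral_nonneg fun v => mul_self_nonneg _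
  rw [h] at h1
  exact_mod_cast h1

lemma mom_eq_zero {p : Poly} (hp : (p.mul p).gauss = 0) (f : L2) : mom p f = 0 := by
  have h : ∫ v, weight p v ^ 2 = 0 := by
    simp only [sq, integral_weight_mul_weight, hp, Int.cast_zero]
  have h1 := (integral_eq_zero_iff_of_nonneg (fun v => sq_nonneg (weight p v))
    ((memLp_two_iff_integrable_sq (memLp_weight p).1).1 (memLp_weight p))).1 h
  refine Lp.ext ?_
  filter_upwards [coeFn_mom p f, Lp.coeFn_zero ℝ 2 (volume : Measure Torus)] with x h2 h3
  rw [h2, h3, Pi.zero_apply, integral_eq_zero_of_ae]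
  filter_upwards [h1] with v hv
  have : weight p v = 0 := by simpa using hv
  simp [this]

/-- Moments against polynomials orthogonal to the kernel are controlled by the distance to the
kernel. -/
lemma norm_sq_mom_le_microSq {p : Poly} (h : ∀ k, (p.mul (ker k)).gauss = 0) (f : L2) :
    ‖mom p f‖ ^ 2 ≤ (p.mul p).gauss * microSq f := by
  -- A polynomial of norm zero cannot be normalized, but then its moment vanishes.
  rcases (gauss_mul_self_nonneg p).eq_or_lt with hp | hp
  · rw [mom_eq_zero hp.symm, ← hp]
    simp
  have h' : ∀ k, ((ker k).mul p).gauss = 0 := fun k => by rw [gauss_mul_comm, h]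
  -- Bessel's inequality for the orthogonal family of the kernel enlarged by `p`, which sits at the
  -- index `none`.
  have := bessel (ι := Option (Fin 8)) (fun o => o.elim p ker)
    (fun o => o.elim (p.mul p).gauss kerNorm)
    (fun o => by cases o <;> simp [hp, kerNorm_pos])
    (fun o o' => by
      cases o <;> cases o' <;> simp [h, h', gauss_ker]) f
  rw [Fintype.sum_option] at this
  have hpR : (0 : ℝ) < (p.mul p).gauss := by exact_mod_cast hp
  simp only [Option.elim] at this
  rw [← le_sub_iff_add_le, div_le_iff₀ hpR, mul_comm] at this
  exact this

lemma integrable_tensor (u : Hx) (p : Poly) (f : L2) :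
    Integrable (fun q : Phase => u q.1 * weight p q.2 * f q)
      ((volume : Measure Torus).prod volume) := by
  have h1 : MemLp (fun q : Torus × Vel => u q.1 * weight p q.2) 2
      ((volume : Measure Torus).prod volume) := by
    have hm : AEStronglyMeasurable (fun q : Torus × Vel => u q.1 * weight p q.2)
        ((volume : Measure Torus).prod volume) :=
      (Lp.aestronglyMeasurable u).comp_fst.mul (memLp_weight p).1.comp_snd
    rw [memLp_two_iff_integrable_sq hm]
    have := ((memLp_two_iff_integrable_sq (Lp.aestronglyMeasurable u)).1 (Lp.memLp u)).mul_prod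
      ((memLp_two_iff_integrable_sq (memLp_weight p).1).1 (memLp_weight p))
    simpa only [mul_pow] using this
  have h2 : MemLp (fun q : Torus × Vel => f q) 2 ((volume : Measure Torus).prod volume) := by
    rw [← Measure.volume_eq_prod]
    exact Lp.memLp f
  exact h1.integrable_mul h2

lemma integral_tensor (u : Hx) (p : Poly) (f : L2) :
    ∫ q : Phase, u q.1 * weight p q.2 * f q = inner ℝ u (mom p f) := by
  refine (integral_prod _ (integrable_tensor u p f)).trans ?_
  rw [L2.inner_def]
  refine integral_congr_ae ?_
  filter_upwards [coeFn_mom p f] with x hx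
  rw [hx, RCLike.inner_apply, RCLike.conj_to_real, ← integral_mul_const]
  refine integral_congr_ae (Eventually.of_forall fun v => ?_)
  ring

/-- At `Pr = 0` both projections enter with coefficient one. Each factor `1/√6` or `1/√10` occurs
twice, which produces the inverse squared norms `1/6` and `1/10`. -/
lemma linearOp_eq (f : L2) : ∀ᵐ q : Phase, linearOp 0 f q =
    ∑ k, (kerNorm k : ℝ)⁻¹ * (mom (ker k) f q.1 * weight (ker k) q.2) - f q := by
  have h : ∀ᵐ x : Torus, ∀ k, mom (ker k) f x = ∫ v, f (x, v) * weight (ker k) v :=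
    ae_all_iff.2 fun k => coeFn_mom (ker k) f
  filter_upwards [ae_fst h] with q hq
  simp only [hq]
  have s6 : √6 * √6 = (6 : ℝ) := Real.mul_self_sqrt (by norm_num)
  have s10 : √10 * √10 = (10 : ℝ) := Real.mul_self_sqrt (by norm_num)
  have e0 : ∀ u : Vel, sqrtMaxwellian u = weight Poly.one u := fun u => by simp [weight]
  have e1 : ∀ (i : Fin 3) (u : Vel), u i * sqrtMaxwellian u = weight (Poly.X i) u :=
    fun i u => by simp [weight]
  have e2 : ∀ u : Vel, (‖u‖ ^ 2 - 3) / √6 * sqrtMaxwellian u =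
      (√6)⁻¹ * weight (Poly.sq ++ Poly.smul (-3) Poly.one) u := fun u => by
    simp [weight]; ring
  have e3 : ∀ (i : Fin 3) (u : Vel), u i * (‖u‖ ^ 2 - 5) / √10 * sqrtMaxwellian u =
      (√10)⁻¹ * weight (Poly.heat i) u := fun i u => by
    simp [weight, Poly.heat]; ring
  unfold linearOp projC projNC
  simp only [e1, e2, e3]
  -- Separate from the previous rewriting, since `e0` would also match the `√m` inside the left
  -- sides of `e1`, `e2`, `e3`.
  simp only [e0]
  have e4 : ∀ (c : ℝ) (θ : Vel → ℝ), ∫ u, f (q.1, u) * (c * θ u) = c * ∫ u, f (q.1, u) * θ u := by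
    intro c θ
    rw [← integral_const_mul]
    refine integral_congr_ae (Eventually.of_forall fun v => ?_)
    ring
  simp only [e4, Fin.sum_univ_eight, Fin.sum_univ_three, ker, kerNorm]
  simp only [Matrix.cons_val]
  have i6 : (√6)⁻¹ * (√6)⁻¹ = (6 : ℝ)⁻¹ := by rw [← mul_inv, s6]
  have i10 : (√10)⁻¹ * (√10)⁻¹ = (10 : ℝ)⁻¹ := by rw [← mul_inv, s10]
  push_cast
  rw [← i6, ← i10]
  ring

/-- The operator is a projection minus the identity, so its quadratic form is minus the squared
distance to the range of the projection. -/
lemma integral_linearOp (f : L2) : ∫ q : Phase, linearOp 0 f q * f q = -microSq f := by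
  have hi : ∀ k, Integrable (fun q : Phase => mom (ker k) f q.1 * weight (ker k) q.2 * f q) :=
    fun k => integrable_tensor _ _ f
  have e : ∀ᵐ q : Phase, linearOp 0 f q * f q = ∑ k, (kerNorm k : ℝ)⁻¹ *
      (mom (ker k) f q.1 * weight (ker k) q.2 * f q) - f q ^ 2 := by
    filter_upwards [linearOp_eq f] with q hq
    rw [hq, sub_mul, Finset.sum_mul, sq]
    simp only [mul_assoc]
  rw [integral_congr_ae e, integral_sub (integrable_finsetSum _ fun k _ => (hi k).const_mul _)
    ((memLp_two_iff_integrable_sq (Lp.aestronglyMeasurable f)).1 (Lp.memLp f)),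
    integral_finsetSum _ fun k _ => (hi k).const_mul _]
  simp only [integral_const_mul, integral_tensor, real_inner_self_eq_norm_sq, microSq]
  have : ∫ q : Phase, f q ^ 2 = ‖f‖ ^ 2 := by
    rw [← real_inner_self_eq_norm_sq, L2.inner_def]
    refine integral_congr_ae (Eventually.of_forall fun p => ?_)
    simp [sq]
  rw [this, neg_sub]
  congr 1
  exact Finset.sum_congr rfl fun k _ => inv_mul_eq_div _ _

end

section

/-! ### Weak derivatives of moments -/

lemma hasDerivAt_mFourier_axis (n : Fin 3 → ℤ) (i : Fin 3) (x : Torus) :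
    HasDerivAt (fun s : ℝ => UnitAddTorus.mFourier n (x + axis i s))
      (2 * Real.pi * Complex.I * n i * UnitAddTorus.mFourier n x) 0 := by
  have e : (fun s : ℝ => UnitAddTorus.mFourier n (x + axis i s)) = fun s : ℝ =>
      UnitAddTorus.mFourier n x * Complex.exp (2 * Real.pi * Complex.I * n i * s) := by
    funext s
    rw [mFourier_apply_add, mFourier_axis]
  rw [e]
  have h := (((Complex.ofRealCLM.hasDerivAt (x := (0 : ℝ))).const_mul
    (2 * Real.pi * Complex.I * n i : ℂ)).cexp).const_mul (UnitAddTorus.mFourier n x)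
  refine h.congr_deriv ?_
  simp
  ring

lemma contDiff_mFourier_coe (n : Fin 3 → ℤ) :
    ContDiff ℝ ∞ fun y : Fin 3 → ℝ => UnitAddTorus.mFourier n fun i => (y i : UnitAddCircle) := by
  have e : (fun y : Fin 3 → ℝ => UnitAddTorus.mFourier n fun i => (y i : UnitAddCircle)) =
      fun y => ∏ i, Complex.exp (2 * Real.pi * Complex.I * n i * Complex.ofRealCLM (y i)) := by
    funext y
    simp only [UnitAddTorus.mFourier, ContinuousMap.coe_mk]
    refine Finset.prod_congr rfl fun i _ => ?_
    rw [fourier_coe_apply]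
    simp
  rw [e]
  refine contDiff_prod fun i _ => ContDiff.cexp (contDiff_const.mul ?_)
  exact Complex.ofRealCLM.contDiff.comp (contDiff_apply ℝ ℝ i)

/-- The product of a function of the position and a function of the velocity. -/
def tensor (a : Torus → ℝ) (b : Vel → ℝ) (q : Phase) : ℝ := a q.1 * b q.2

lemma isTest_tensor {a : Torus → ℝ} {b : Vel → ℝ}
    (ha : ContDiff ℝ ∞ fun y : Fin 3 → ℝ => a fun i => (y i : UnitAddCircle))
    (hb : ContDiff ℝ ∞ b) (hc : HasCompactSupport b) : IsTest (tensor a b) where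
  smooth := (ha.comp contDiff_fst).mul (hb.comp contDiff_snd)
  compact := by
    refine HasCompactSupport.intro (K := univ ×ˢ tsupport b) (isCompact_univ.prod hc)
      fun q hq => ?_
    have : q.2 ∉ tsupport b := fun h => hq ⟨mem_univ _, h⟩
    simp [tensor, image_eq_zero_of_notMem_tsupport this]

lemma partialX_tensor {a a' : Torus → ℝ} (b : Vel → ℝ) (i : Fin 3)
    (h : ∀ x, HasDerivAt (fun s => a (x + axis i s)) (a' x) 0) :
    partialX i (tensor a b) = tensor a' b := by
  funext q
  exact ((h q.1).mul_const (b q.2)).deriv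

/-- The cutoff in the velocity at radius `R + 1`. -/
def cutoff (R : ℕ) : ContDiffBump (0 : Vel) := ⟨R + 1, R + 2, by positivity, by linarith⟩

lemma tendsto_cutoff (v : Vel) : Tendsto (fun R : ℕ => cutoff R v) atTop (𝓝 1) := by
  refine tendsto_const_nhds.congr' ?_
  obtain ⟨N, hN⟩ := exists_nat_ge ‖v‖
  filter_upwards [eventually_ge_atTop N] with R hR
  refine ((cutoff R).one_of_mem_closedBall ?_).symm
  rw [mem_closedBall_zero_iff]
  have : (N : ℝ) ≤ R := by exact_mod_cast hR
  change ‖v‖ ≤ (R : ℝ) + 1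
  linarith

lemma integrable_mul_weight {a : Torus → ℝ} (ha : Continuous a) (p : Poly) (f : L2) :
    Integrable fun q : Phase => f q * tensor a (weight p) q := by
  have hm : MemLp a 2 (volume : Measure Torus) := ha.memLp_of_hasCompactSupport
    (HasCompactSupport.of_compactSpace a)
  have h := integrable_tensor (hm.toLp a) p f
  refine Integrable.congr h ?_
  filter_upwards [ae_fst hm.coeFn_toLp] with q hq
  simp only [tensor, hq]
  ring

/-- Weighted polynomials are not compactly supported in velocity, hence not test functions.
Dominated convergence removes the cutoff, which an `x`-derivative does not touch. -/
lemma tendsto_integral_cutoff {a : Torus → ℝ} (ha : Continuous a) (p : Poly) (f : L2) :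
    Tendsto (fun R : ℕ => ∫ q : Phase, f q * tensor a (fun v => cutoff R v * weight p v) q) atTop
      (𝓝 (∫ q : Phase, f q * tensor a (weight p) q)) := by
  refine tendsto_integral_of_dominated_convergence
    (fun q => ‖f q * tensor a (weight p) q‖) (fun R => ?_) (integrable_mul_weight ha p f).norm
    (fun R => Eventually.of_forall fun q => ?_) (Eventually.of_forall fun q => ?_)
  · refine (Lp.aestronglyMeasurable f).mul (Continuous.aestronglyMeasurable ?_)
    exact (ha.comp continuous_fst).mul (((cutoff R).continuous.comp continuous_snd).mul
      ((contDiff_weight p).continuous.comp continuous_snd))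
  · simp only [tensor, norm_mul]
    have h0 : ‖cutoff R q.2‖ ≤ 1 := by
      rw [Real.norm_of_nonneg (cutoff R).nonneg]
      exact (cutoff R).le_one
    have h1 : ‖cutoff R q.2‖ * ‖weight p q.2‖ ≤ ‖weight p q.2‖ :=
      mul_le_of_le_one_left (norm_nonneg _) h0
    gcongr
  · have := ((tendsto_cutoff q.2).mul_const (weight p q.2)).const_mul (f q * a q.1)
    simp only [one_mul] at this
    simpa only [tensor, mul_assoc] using this

lemma IsWeakDerivX.integral_tensor_eq {i : Fin 3} {f g : L2} (h : IsWeakDerivX i f g)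
    {a a' : Torus → ℝ} (ha : Continuous a) (ha' : Continuous a')
    (hs : ContDiff ℝ ∞ fun y : Fin 3 → ℝ => a fun i => (y i : UnitAddCircle))
    (hd : ∀ x, HasDerivAt (fun s => a (x + axis i s)) (a' x) 0) (p : Poly) :
    ∫ q : Phase, f q * tensor a' (weight p) q = -∫ q : Phase, g q * tensor a (weight p) q := by
  have h1 := tendsto_integral_cutoff ha' p f
  have h2 := (tendsto_integral_cutoff ha p g).neg
  refine tendsto_nhds_unique h1 (h2.congr fun R => ?_)
  have := h (tensor a fun v => cutoff R v * weight p v)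
    (isTest_tensor hs ((cutoff R).contDiff.mul (contDiff_weight p))
      ((cutoff R).hasCompactSupport.mul_right))
  rw [partialX_tensor _ i hd] at this
  exact this.symm

/-- Test functions are real, so the exponential is split into real and imaginary parts. -/
lemma coef_mom (n : Fin 3 → ℤ) (p : Poly) (f : L2) : coef n (mom p f) =
    (∫ q : Phase, f q * tensor (fun x => (UnitAddTorus.mFourier (-n) x).re) (weight p) q : ℝ) +
    (∫ q : Phase, f q * tensor (fun x => (UnitAddTorus.mFourier (-n) x).im) (weight p) q : ℝ) *
      Complex.I := by
  have key : ∀ a : Torus → ℝ, Continuous a →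
      ∫ q : Phase, f q * tensor a (weight p) q = ∫ x, a x * mom p f x := by
    intro a ha
    refine (integral_prod _ (integrable_mul_weight ha p f)).trans ?_
    refine integral_congr_ae ?_
    filter_upwards [coeFn_mom p f] with x hx
    rw [hx, ← integral_const_mul]
    refine integral_congr_ae (Eventually.of_forall fun v => ?_)
    simp only [tensor]
    ring
  have hr : Continuous fun x => (UnitAddTorus.mFourier (-n) x).re :=
    Complex.continuous_re.comp (UnitAddTorus.mFourier (-n)).continuous
  have hi : Continuous fun x => (UnitAddTorus.mFourier (-n) x).im :=
    Complex.continuous_im.comp (UnitAddTorus.mFourier (-n)).continuous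
  have hint : ∀ a : Torus → ℝ, Continuous a → Integrable fun x => a x * mom p f x := by
    intro a ha
    have hm : MemLp a 2 (volume : Measure Torus) := ha.memLp_of_hasCompactSupport
      (HasCompactSupport.of_compactSpace a)
    exact hm.integrable_mul (Lp.memLp _)
  rw [key _ hr, key _ hi, coef_eq_integral, ← integral_complex_ofReal, ← integral_complex_ofReal,
    ← integral_mul_const, ← integral_add (hint _ hr).ofReal ((hint _ hi).ofReal.mul_const _)]
  refine integral_congr_ae (Eventually.of_forall fun x => ?_)
  simp only
  conv_lhs => rw [← Complex.re_add_im (UnitAddTorus.mFourier (-n) x)]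
  push_cast
  ring

/-- Moments of weak derivatives are derivatives of moments. -/
lemma isDerivX_mom {i : Fin 3} {f g : L2} (h : IsWeakDerivX i f g) (p : Poly) :
    IsDerivX i (mom p f) (mom p g) := fun n => by
  have hr : Continuous fun x => (UnitAddTorus.mFourier (-n) x).re :=
    Complex.continuous_re.comp (UnitAddTorus.mFourier (-n)).continuous
  have hi : Continuous fun x => (UnitAddTorus.mFourier (-n) x).im :=
    Complex.continuous_im.comp (UnitAddTorus.mFourier (-n)).continuous
  have hE := hasDerivAt_mFourier_axis (-n) i
  have hsr := Complex.reCLM.contDiff.comp (contDiff_mFourier_coe (-n))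
  have hsi := Complex.imCLM.contDiff.comp (contDiff_mFourier_coe (-n))
  have dr : ∀ x, HasDerivAt (fun s => (UnitAddTorus.mFourier (-n) (x + axis i s)).re)
      (2 * Real.pi * n i * (UnitAddTorus.mFourier (-n) x).im) 0 := fun x => by
    have := Complex.reCLM.hasFDerivAt.comp_hasDerivAt (0 : ℝ) (hE x)
    refine this.congr_deriv ?_
    simp
  have di : ∀ x, HasDerivAt (fun s => (UnitAddTorus.mFourier (-n) (x + axis i s)).im)
      (-(2 * Real.pi * n i) * (UnitAddTorus.mFourier (-n) x).re) 0 := fun x => by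
    have := Complex.imCLM.hasFDerivAt.comp_hasDerivAt (0 : ℝ) (hE x)
    refine this.congr_deriv ?_
    simp
  have e1 := h.integral_tensor_eq hr (hi.const_mul _) hsr dr p
  have e2 := h.integral_tensor_eq hi (hr.const_mul _) hsi di p
  have l : ∀ (c : ℝ) (a : Torus → ℝ), ∫ q : Phase, f q * tensor (fun x => c * a x) (weight p) q =
      c * ∫ q : Phase, f q * tensor a (weight p) q := by
    intro c a
    rw [← integral_const_mul]
    refine integral_congr_ae (Eventually.of_forall fun q => ?_)
    simp only [tensor]
    ring
  rw [l] at e1 e2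
  rw [coef_mom, coef_mom, ← neg_eq_iff_eq_neg.2 e1, ← neg_eq_iff_eq_neg.2 e2]
  push_cast
  linear_combination (2 * Real.pi * n i *
    ((∫ q : Phase, f q * tensor (fun x => (UnitAddTorus.mFourier (-n) x).im) (weight p) q : ℝ) : ℂ)) *
    (-Complex.I_sq)

end

section

/-! ### Moments of a solution as regular fields -/

lemma IsDerivX.sub {i : Fin 3} {u g w h : Hx} (hu : IsDerivX i u g) (hw : IsDerivX i w h) :
    IsDerivX i (u - w) (g - h) := fun n => by
  rw [map_sub, map_sub, hu n, hw n, mul_sub]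

lemma IsDerivX.translate {i : Fin 3} {u g : Hx} (hu : IsDerivX i u g) (y : Torus) :
    IsDerivX i (translate y u) (translate y g) := fun n => by
  rw [coef_translate, coef_translate, hu n]
  ring

lemma order_add_single {n : ℕ} (α : Fin n → ℕ) (i : Fin n) :
    order (α + Pi.single i 1) = order α + 1 := by
  simp [order, Finset.sum_add_distrib]

lemma order_zero {n : ℕ} : order (0 : Fin n → ℕ) = 0 := by simp [order]

lemma mem_multiIndices {n N : ℕ} {α : Fin n → ℕ} : α ∈ multiIndices n N ↔ order α ≤ N := by
  simp only [multiIndices, Finset.mem_filter, Fintype.mem_piFinset, Finset.mem_range,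
    and_iff_right_iff_imp]
  intro h i
  exact Nat.lt_succ_of_le ((Finset.single_le_sum (fun j _ => Nat.zero_le (α j))
    (Finset.mem_univ i)).trans h)

/-- The norm of the pure space-time derivatives of order at most `N`. -/
def bnd (N : ℕ) (D : (Fin 4 → ℕ) → (Fin 3 → ℕ) → ℝ → L2) (t : ℝ) : ℝ :=
  √(∑ α ∈ multiIndices 4 N, ‖D α 0 t‖ ^ 2)

lemma bnd_nonneg (N : ℕ) (D : (Fin 4 → ℕ) → (Fin 3 → ℕ) → ℝ → L2) (t : ℝ) : 0 ≤ bnd N D t :=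
  Real.sqrt_nonneg _

lemma bnd_sq (N : ℕ) (D : (Fin 4 → ℕ) → (Fin 3 → ℕ) → ℝ → L2) (t : ℝ) :
    bnd N D t ^ 2 = ∑ α ∈ multiIndices 4 N, ‖D α 0 t‖ ^ 2 :=
  Real.sq_sqrt (Finset.sum_nonneg fun _ _ => sq_nonneg _)

variable {N : ℕ} {T : ℝ} {f : ℝ → L2} {D : (Fin 4 → ℕ) → (Fin 3 → ℕ) → ℝ → L2}

lemma norm_le_bnd {α : Fin 4 → ℕ} (hα : order α ≤ N) (t : ℝ) : ‖D α 0 t‖ ≤ bnd N D t := by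
  refine Real.le_sqrt_of_sq_le ?_
  exact Finset.single_le_sum (f := fun α => ‖D α 0 t‖ ^ 2) (fun _ _ => sq_nonneg _)
    (mem_multiIndices.2 hα)

/-- The moment of a derivative, as a field. -/
def momField (D : (Fin 4 → ℕ) → (Fin 3 → ℕ) → ℝ → L2) (p : Poly) (α : Fin 4 → ℕ) : Field :=
  fun t x => mom p (D α 0 t) x

lemma aesm_momField (p : Poly) (α : Fin 4 → ℕ) (t : ℝ) :
    AEStronglyMeasurable (momField D p α t) volume :=
  Lp.aestronglyMeasurable _

lemma normTwo_coe (u : Hx) : normTwo u = ENNReal.ofReal ‖u‖ := by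
  rw [Lp.norm_def, ENNReal.ofReal_toReal (Lp.eLpNorm_ne_top u)]

lemma HasDerivatives.hasDerivAt (h : HasDerivatives N T f D) {α : Fin 4 → ℕ} (hα : order α < N)
    {t : ℝ} (ht : t ∈ Ioo 0 T) : HasDerivAt (D α 0) (D (α + Pi.single 0 1) 0 t) t :=
  (h.time α 0 (by simpa [order_zero] using hα) t (Ioo_subset_Ico_self ht)).hasDerivAt
    (Ico_mem_nhds ht.1 ht.2)

lemma HasDerivatives.isDerivX (h : HasDerivatives N T f D) {α : Fin 4 → ℕ} (hα : order α < N)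
    {t : ℝ} (ht : t ∈ Ico 0 T) (p : Poly) (i : Fin 3) :
    IsDerivX i (mom p (D α 0 t)) (mom p (D (α + Pi.single i.succ 1) 0 t)) :=
  isDerivX_mom (h.space α 0 (by simpa [order_zero] using hα) i t ht) p

lemma tendsto_normTwo_of_hasDerivAt {F : ℝ → Hx} {g : Hx} (h : HasDerivAt F g 0) :
    Tendsto (fun s => normTwo fun x => s⁻¹ * (F s x - F 0 x) - g x) (𝓝[≠] 0) (𝓝 0) := by
  have h1 := hasDerivAt_iff_tendsto_slope.1 h
  have h2 : Tendsto (fun s => ENNReal.ofReal ‖slope F 0 s - g‖) (𝓝[≠] 0) (𝓝 0) := by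
    have := ENNReal.tendsto_ofReal (tendsto_iff_norm_sub_tendsto_zero.1 h1)
    simpa using this
  refine h2.congr fun s => ?_
  rw [← normTwo_coe]
  refine eLpNorm_congr_ae ?_
  rw [slope_def_module, sub_zero]
  filter_upwards [Lp.coeFn_sub (s⁻¹ • (F s - F 0)) g, Lp.coeFn_smul s⁻¹ (F s - F 0),
    Lp.coeFn_sub (F s) (F 0)] with x h1 h2 h3
  rw [h1, Pi.sub_apply, h2, Pi.smul_apply, h3, Pi.sub_apply, smul_eq_mul]

lemma hasD_zero_of_hasDerivAt {u g : ℝ → Hx} (h : ∀ t ∈ Ioo 0 T, HasDerivAt u (g t) t) :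
    HasD T 0 (fun t x => u t x) (fun t x => g t x) := fun t ht => by
  have h1 : HasDerivAt (fun s => u (t + s)) (g t) 0 := by
    have h2 := h t ht
    rw [← add_zero t] at h2
    simpa using h2.comp_const_add t 0
  refine (tendsto_normTwo_of_hasDerivAt h1).congr fun s => ?_
  congr 1
  funext x
  simp [shift, timeStep, spaceStep]

lemma hasD_succ_of_isDerivX {u g : ℝ → Hx} {j : Fin 3}
    (h : ∀ t ∈ Ioo 0 T, IsDerivX j (u t) (g t)) :
    HasD T j.succ (fun t x => u t x) (fun t x => g t x) := fun t ht => by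
  refine (tendsto_normTwo_of_hasDerivAt (hasDerivAt_translate j (h t ht))).congr fun s =>
    eLpNorm_congr_ae ?_
  filter_upwards [coeFn_translate (axis j s) (u t)] with x hx
  rw [hx, axis_zero, translate_zero]
  simp [shift, timeStep, spaceStep]

lemma HasDerivatives.hasD (h : HasDerivatives N T f D) {α : Fin 4 → ℕ} (hα : order α < N)
    (p : Poly) (i : Fin 4) :
    HasD T i (momField D p α) (momField D p (α + Pi.single i 1)) := by
  induction i using Fin.cases with
  | zero =>
    exact hasD_zero_of_hasDerivAt fun t ht =>
      (mom p).hasFDerivAt.comp_hasDerivAt t (h.hasDerivAt hα ht)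
  | succ j =>
    exact hasD_succ_of_isDerivX fun t ht => h.isDerivX hα (Ioo_subset_Ico_self ht) p j

/-- Used on increments of a moment in time or along an axis: continuity in `L²` of the moment and of
its pure second spatial derivatives becomes uniform convergence. -/
lemma tendsto_normSup_of_sobolev {l : Filter ℝ} {w : ℝ → Hx} {g h : ℝ → Fin 3 → Hx}
    (hg : ∀ᶠ s in l, ∀ i, IsDerivX i (w s) (g s i))
    (hh : ∀ᶠ s in l, ∀ i, IsDerivX i (g s i) (h s i))
    (w0 : Tendsto w l (𝓝 0)) (h0 : ∀ i, Tendsto (fun s => h s i) l (𝓝 0)) :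
    Tendsto (fun s => normSup (w s)) l (𝓝 0) := by
  have h1 : Tendsto (fun s => ENNReal.ofReal (sobolevConst * (‖w s‖ + ∑ i, ‖h s i‖))) l
      (𝓝 0) := by
    have := ENNReal.tendsto_ofReal ((w0.norm.add
      (tendsto_finsetSum Finset.univ fun i _ => (h0 i).norm)).const_mul sobolevConst)
    simpa using this
  refine tendsto_of_tendsto_of_tendsto_of_le_of_le' tendsto_const_nhds h1
    (Eventually.of_forall fun _ => zero_le) ?_
  filter_upwards [hg, hh] with s h2 h3
  exact normSup_le_of_ae (sobolev h2 h3)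

lemma HasDerivatives.continuousAt (h : HasDerivatives N T f D) {α : Fin 4 → ℕ}
    (hα : order α ≤ N) {t : ℝ} (ht : t ∈ Ioo 0 T) : ContinuousAt (D α 0) t :=
  (h.continuousOn α 0 (by simpa [order_zero] using hα)).continuousAt (Ico_mem_nhds ht.1 ht.2)

/-- The two spare orders in `hα` are the second spatial derivatives consumed by the Sobolev
inequality. -/
lemma HasDerivatives.shiftContinuous (h : HasDerivatives N T f D) {α : Fin 4 → ℕ}
    (hα : order α + 2 ≤ N) (p : Poly) (i : Fin 4) :
    ShiftContinuous T i (momField D p α) := fun t ht => by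
  have o1 : order α < N := by omega
  have o2 : ∀ j : Fin 3, order (α + Pi.single j.succ 1) < N := fun j => by
    rw [order_add_single]; omega
  have o3 : ∀ j : Fin 3, order (α + Pi.single j.succ 1 + Pi.single j.succ 1) ≤ N := fun j => by
    rw [order_add_single, order_add_single]; omega
  have ht' := Ioo_subset_Ico_self ht
  induction i using Fin.cases with
  | zero =>
    have hev : ∀ᶠ s in 𝓝[≠] (0 : ℝ), t + s ∈ Ico 0 T :=
      (eventually_shift_mem (0 : Fin 4) ht).mono fun s hs => Ioo_subset_Ico_self hs
    have hc : ∀ β, order β ≤ N → Tendsto (fun s => mom p (D β 0 (t + s)) - mom p (D β 0 t))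
        (𝓝[≠] 0) (𝓝 0) := by
      intro β hβ
      have l0 : Tendsto (fun s : ℝ => t + s) (𝓝[≠] 0) (𝓝 t) := by
        have := (tendsto_timeStep (0 : Fin 4)).const_add t
        rw [add_zero] at this
        exact this
      have l1 := ((mom p).continuous.tendsto _).comp ((h.continuousAt hβ ht).tendsto.comp l0)
      simpa using l1.sub_const (mom p (D β 0 t))
    have key := tendsto_normSup_of_sobolev
      (w := fun s => mom p (D α 0 (t + s)) - mom p (D α 0 t))
      (hev.mono fun s hs j => (h.isDerivX o1 hs p j).sub (h.isDerivX o1 ht' p j))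
      (hev.mono fun s hs j => (h.isDerivX (o2 j) hs p j).sub (h.isDerivX (o2 j) ht' p j))
      (hc α o1.le) (fun j => hc _ (o3 j))
    refine key.congr fun s => eLpNorm_congr_ae ?_
    filter_upwards [Lp.coeFn_sub (mom p (D α 0 (t + s))) (mom p (D α 0 t))] with x hx
    rw [hx]
    simp [momField, shift, timeStep, spaceStep]
  | succ k =>
    have hc : ∀ u : Hx, Tendsto (fun s => translate (axis k s) u - u) (𝓝[≠] 0) (𝓝 0) := by
      intro u
      have l1 := ((continuous_translate u).comp (continuous_axis k)).tendsto 0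
      simp only [Function.comp_def, axis_zero, translate_zero] at l1
      simpa using (tendsto_nhdsWithin_of_tendsto_nhds (s := {0}ᶜ) l1).sub_const u
    have key := tendsto_normSup_of_sobolev
      (w := fun s => translate (axis k s) (mom p (D α 0 t)) - mom p (D α 0 t))
      (l := 𝓝[≠] 0)
      (Eventually.of_forall fun s j =>
        ((h.isDerivX o1 ht' p j).translate (axis k s)).sub (h.isDerivX o1 ht' p j))
      (Eventually.of_forall fun s j =>
        ((h.isDerivX (o2 j) ht' p j).translate (axis k s)).sub (h.isDerivX (o2 j) ht' p j))
      (hc _) (fun j => hc _)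
    refine key.congr fun s => eLpNorm_congr_ae ?_
    filter_upwards [coeFn_translate (axis k s) (mom p (D α 0 t)),
      Lp.coeFn_sub (translate (axis k s) (mom p (D α 0 t))) (mom p (D α 0 t))] with x h1 h2
    rw [h2, Pi.sub_apply, h1]
    simp [momField, shift, timeStep, spaceStep]

lemma norm_mom_le_bnd (p : Poly) {α : Fin 4 → ℕ} (hα : order α ≤ N) (t : ℝ) :
    ‖mom p (D α 0 t)‖ ≤ ‖mom p‖ * bnd N D t :=
  ((mom p).le_opNorm _).trans (mul_le_mul_of_nonneg_left (norm_le_bnd hα t) (norm_nonneg _))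

lemma sobolevConst_nonneg : 0 ≤ sobolevConst := Real.sqrt_nonneg _

lemma HasDerivatives.ae_abs_momField_le (h : HasDerivatives N T f D) {α : Fin 4 → ℕ}
    (hα : order α + 2 ≤ N) (p : Poly) {t : ℝ} (ht : t ∈ Ico 0 T) :
    ∀ᵐ x, |momField D p α t x| ≤ (1 + 4 * sobolevConst) * ‖mom p‖ * bnd N D t := by
  have o1 : order α < N := by omega
  have o2 : ∀ j : Fin 3, order (α + Pi.single j.succ 1) < N := fun j => by
    rw [order_add_single]; omega
  have o3 : ∀ j : Fin 3, order (α + Pi.single j.succ 1 + Pi.single j.succ 1) ≤ N := fun j => by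
    rw [order_add_single, order_add_single]; omega
  filter_upwards [sobolev (fun j => h.isDerivX o1 ht p j) (fun j => h.isDerivX (o2 j) ht p j)]
    with x hx
  refine hx.trans ?_
  have h1 : ‖mom p (D α 0 t)‖ + ∑ j : Fin 3, ‖mom p (D (α + Pi.single j.succ 1 +
      Pi.single j.succ 1) 0 t)‖ ≤ 4 * (‖mom p‖ * bnd N D t) := by
    have := Finset.sum_le_sum (s := Finset.univ) fun (j : Fin 3) _ =>
      norm_mom_le_bnd (D := D) p (o3 j) t
    simp only [Finset.sum_const, Finset.card_univ, Fintype.card_fin, nsmul_eq_mul] at this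
    have h2 := norm_mom_le_bnd (D := D) p o1.le t
    push_cast at this
    linarith
  have h2 := mul_le_mul_of_nonneg_left h1 sobolevConst_nonneg
  have h3 : 0 ≤ ‖mom p‖ * bnd N D t := mul_nonneg (norm_nonneg _) (bnd_nonneg _ _ _)
  calc _ ≤ _ := h2
    _ ≤ _ := by linarith

/-- The `+ 1` comes from Sobolev: derivatives up to order `k - 1` must be bounded, which costs two
more, so `|α| + (k - 1) + 2` may not exceed `N`. -/
lemma HasDerivatives.reg_momField (h : HasDerivatives N T f D) (p : Poly) (k : ℕ)
    {α : Fin 4 → ℕ} (hα : order α + k + 1 ≤ N) :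
    Reg T k (fun t => (1 + 4 * sobolevConst) * ‖mom p‖ * bnd N D t) (momField D p α) := by
  induction k generalizing α with
  | zero =>
    refine ⟨aesm_momField p α, fun t ht => ?_⟩
    rw [show momField D p α t = mom p (D α 0 t) from rfl, normTwo_coe]
    refine ENNReal.ofReal_le_ofReal ((norm_mom_le_bnd (D := D) (α := α) p
      (show order α ≤ N by omega) t).trans ?_)
    have := sobolevConst_nonneg
    have h3 : 0 ≤ ‖mom p‖ * bnd N D t := mul_nonneg (norm_nonneg _) (bnd_nonneg _ _ _)
    beta_reduce
    rw [mul_assoc]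
    exact le_mul_of_one_le_left h3 (by linarith)
  | succ k ih =>
    exact ⟨aesm_momField p α,
      fun t ht => h.ae_abs_momField_le (by omega) p (Ioo_subset_Ico_self ht),
      fun i => h.shiftContinuous (by omega) p i,
      fun i => ⟨_, h.hasD (by omega) p i, ih (by rw [order_add_single]; omega)⟩⟩

end

section

/-! ### Families of regular fields depending on a solution -/

/-- The constant in the Sobolev bound for the moments that determine density, velocity and
temperature. -/
def momentConst : ℝ :=
  (1 + 4 * sobolevConst) * (‖mom Poly.one‖ + ∑ i, ‖mom (Poly.X i)‖ + ‖mom Poly.sq‖)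

lemma momentConst_nonneg : 0 ≤ momentConst := by
  have := sobolevConst_nonneg
  unfold momentConst
  positivity

/-- The bound on the norm of a solution under which density and temperature are close to `1`. -/
def smallNorm : ℝ := (100 * (1 + momentConst))⁻¹

lemma smallNorm_pos : 0 < smallNorm := by
  have := momentConst_nonneg
  unfold smallNorm
  positivity

lemma smallNorm_le_one : smallNorm ≤ 1 := by
  have := momentConst_nonneg
  exact inv_le_one_of_one_le₀ (by linarith)

lemma momentConst_mul_smallNorm : momentConst * smallNorm ≤ 1 / 100 := by
  have := momentConst_nonneg
  rw [smallNorm, ← div_eq_mul_inv, div_le_iff₀ (by positivity)]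
  linarith

variable {N : ℕ} {T : ℝ} {f : ℝ → L2} {D : (Fin 4 → ℕ) → (Fin 3 → ℕ) → ℝ → L2}

lemma HasDerivatives.continuousOn_sq (h : HasDerivatives N T f D) {α : Fin 4 → ℕ}
    {β : Fin 3 → ℕ} (hα : order α + order β ≤ N) :
    ContinuousOn (fun t => ‖D α β t‖ ^ 2) (Ico 0 T) :=
  (h.continuousOn α β hα).norm.pow 2

lemma HasDerivatives.intervalIntegrable_sq (h : HasDerivatives N T f D) {α : Fin 4 → ℕ}
    {β : Fin 3 → ℕ} (hα : order α + order β ≤ N) {t : ℝ} (ht : t ∈ Ico 0 T) :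
    IntervalIntegrable (fun t => ‖D α β t‖ ^ 2) volume 0 t := by
  refine ContinuousOn.intervalIntegrable ?_
  rw [uIcc_of_le ht.1]
  exact (h.continuousOn_sq hα).mono fun s hs => ⟨hs.1, hs.2.trans_lt ht.2⟩

/-- The terms with velocity derivatives are nonnegative and are dropped; they play no further part.
-/
lemma HasDerivatives.bnd_sq_add_le_energy (h : HasDerivatives N T f D) {t : ℝ}
    (ht : t ∈ Ico 0 T) :
    1 / 2 * bnd N D t ^ 2 + ∫ s in (0 : ℝ)..t, bnd N D s ^ 2 ≤ energy N D t := by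
  have key : ∀ g : (Fin 4 → ℕ) → (Fin 3 → ℕ) → ℝ, (∀ α β, 0 ≤ g α β) →
      ∑ α ∈ multiIndices 4 N, g α 0 ≤ ∑ ab ∈ multiIndexPairs N, g ab.1 ab.2 := by
    intro g hg
    rw [← Finset.sum_image (f := fun ab : (Fin 4 → ℕ) × (Fin 3 → ℕ) => g ab.1 ab.2)
      (g := fun α => (α, (0 : Fin 3 → ℕ))) (fun a _ b _ hab => (Prod.ext_iff.1 hab).1)]
    refine Finset.sum_le_sum_of_subset_of_nonneg ?_ fun _ _ _ => hg _ _
    intro ab hab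
    obtain ⟨α, hα, rfl⟩ := Finset.mem_image.1 hab
    simp only [multiIndexPairs, Finset.mem_filter, Finset.mem_product, order_zero]
    exact ⟨⟨hα, mem_multiIndices.2 (by simp [order_zero])⟩, mem_multiIndices.1 hα⟩
  simp only [bnd_sq, energy]
  rw [intervalIntegral.integral_finsetSum fun α hα => h.intervalIntegrable_sq
    (by simpa [order_zero] using mem_multiIndices.1 hα) ht]
  have h1 := key (fun α β => ‖D α β t‖ ^ 2) fun _ _ => sq_nonneg _
  have h2 := key (fun α β => ∫ s in (0 : ℝ)..t, ‖D α β s‖ ^ 2) fun α β =>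
    intervalIntegral.integral_nonneg ht.1 fun _ _ => sq_nonneg _
  linarith

/-- Small solutions that satisfy the conservation laws. -/
structure Solution (N : ℕ) (τ₀ η w : ℝ) where
  T : ℝ
  f : ℝ → L2
  D : (Fin 4 → ℕ) → (Fin 3 → ℕ) → ℝ → L2
  sol : IsSolution 0 τ₀ η w N T f D
  small : ∀ t ∈ Ico 0 T, energy N D t ≤ smallNorm ^ 2 / 2
  same : SameConserved (f 0)
  third : ∀ i : Fin 3, ∫ p : Phase, density (f 0) p * (p.2 i * ‖p.2‖ ^ 2) = 0

variable {τ₀ η w : ℝ}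

/-- The norm of the pure space-time derivatives of a solution. -/
def Solution.b (ξ : Solution N τ₀ η w) (t : ℝ) : ℝ := bnd N ξ.D t

lemma Solution.b_nonneg (ξ : Solution N τ₀ η w) (t : ℝ) : 0 ≤ ξ.b t := bnd_nonneg _ _ _

/-- Half of `b²` is part of the energy, which explains the threshold `smallNorm ^ 2 / 2`. -/
lemma Solution.b_le (ξ : Solution N τ₀ η w) {t : ℝ} (ht : t ∈ Ico 0 ξ.T) :
    ξ.b t ≤ smallNorm := by
  have h1 := ξ.sol.derivatives.bnd_sq_add_le_energy ht
  have h2 := ξ.small t ht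
  have h3 : 0 ≤ ∫ s in (0 : ℝ)..t, bnd N ξ.D s ^ 2 :=
    intervalIntegral.integral_nonneg ht.1 fun _ _ => sq_nonneg _
  refine abs_le_of_sq_le_sq' ?_ smallNorm_pos.le |>.2
  unfold Solution.b
  linarith

lemma Solution.b_le_one (ξ : Solution N τ₀ η w) {t : ℝ} (ht : t ∈ Ico 0 ξ.T) : ξ.b t ≤ 1 :=
  (ξ.b_le ht).trans smallNorm_le_one

/-- A family of fields, one for each solution, whose derivatives up to order `k` are bounded by
the `j`-th power of the norm of the solution, uniformly in the solution. -/
def Sm (k j : ℕ) (u : Solution N τ₀ η w → Field) : Prop :=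
  ∃ C, 0 ≤ C ∧ ∀ ξ, Reg ξ.T k (fun t => C * ξ.b t ^ j) (u ξ)

namespace Sm

variable {k j l : ℕ} {u z : Solution N τ₀ η w → Field}

lemma add (hu : Sm k j u) (hz : Sm k j z) : Sm k j fun ξ t x => u ξ t x + z ξ t x := by
  obtain ⟨C, hC, h⟩ := hu
  obtain ⟨C', hC', h'⟩ := hz
  refine ⟨C + C', by positivity, fun ξ => ?_⟩
  have hb := fun t => pow_nonneg (ξ.b_nonneg t) j
  simpa only [add_mul] using Reg.add (fun t _ => mul_nonneg hC (hb t))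
    (fun t _ => mul_nonneg hC' (hb t)) (h ξ) (h' ξ)

lemma mul (hu : Sm (k + 1) j u) (hz : Sm (k + 1) l z) :
    Sm (k + 1) (j + l) fun ξ t x => u ξ t x * z ξ t x := by
  obtain ⟨C, hC, h⟩ := hu
  obtain ⟨C', hC', h'⟩ := hz
  refine ⟨2 ^ (k + 1) * (C * C'), by positivity, fun ξ => ((h ξ).mul (h' ξ)).mono fun t _ => ?_⟩
  exact le_of_eq (by ring)

lemma const (c : ℝ) : Sm k 0 fun (_ : Solution N τ₀ η w) _ _ => c :=
  ⟨|c|, abs_nonneg c, fun ξ => by simpa using Reg.const k c⟩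

lemma const_mul (c : ℝ) (hu : Sm (k + 1) j u) : Sm (k + 1) j fun ξ t x => c * u ξ t x := by
  simpa only [zero_add] using (const c).mul hu

lemma sub (hu : Sm (k + 1) j u) (hz : Sm (k + 1) j z) :
    Sm (k + 1) j fun ξ t x => u ξ t x - z ξ t x := by
  simpa only [neg_one_mul, ← sub_eq_add_neg] using hu.add (hz.const_mul (-1))

lemma sum {u : Fin 3 → Solution N τ₀ η w → Field} (h : ∀ i, Sm k j (u i)) :
    Sm k j fun ξ t x => ∑ i, u i ξ t x := by
  simpa only [Fin.sum_univ_three] using ((h 0).add (h 1)).add (h 2)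

/-- Lower powers dominate because `b ≤ 1`. -/
lemma weaken (hu : Sm k (j + 1) u) : Sm k j u := by
  obtain ⟨C, hC, h⟩ := hu
  refine ⟨C, hC, fun ξ => (h ξ).mono fun t ht => mul_le_mul_of_nonneg_left ?_ hC⟩
  rw [pow_succ]
  exact mul_le_of_le_one_right (pow_nonneg (ξ.b_nonneg t) j)
    (ξ.b_le_one (Ioo_subset_Ico_self ht))

/-- Multiplication by a field close to `1`. -/
lemma mul_one_add (hu : Sm (k + 1) j u) (hz : Sm (k + 1) 1 z) :
    Sm (k + 1) j fun ξ t x => u ξ t x * (1 + z ξ t x) := by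
  simpa only [mul_add, mul_one] using hu.add (hu.mul hz).weaken

lemma comp {φ : ℝ → ℝ} (hφ : SmoothPos φ) (hu : Sm k 1 u)
    (hr : ∀ ξ, ∀ t ∈ Ioo 0 ξ.T, ∀ᵐ x, 1 + u ξ t x ∈ Icc (1 / 2 : ℝ) 2) :
    Sm k 1 fun ξ t x => φ (1 + u ξ t x) - φ 1 := by
  obtain ⟨C, hC, h⟩ := hu
  obtain ⟨K, hK, hcomp⟩ := Reg.comp hC k hφ
  refine ⟨K * C, by positivity, fun ξ => ?_⟩
  have hb := ξ.b_nonneg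
  refine (hcomp ξ.T _ (u ξ) (fun t _ => mul_nonneg hC (pow_nonneg (hb t) 1)) (fun t ht => ?_)
    (hr ξ) (h ξ)).mono fun t _ => le_of_eq (by ring)
  rw [pow_one]
  exact mul_le_of_le_one_right hC (ξ.b_le_one (Ioo_subset_Ico_self ht))

end Sm

end

section

/-! ### The macroscopic quantities as regular fields -/

lemma smoothPos_inv : SmoothPos fun x : ℝ => x⁻¹ :=
  ⟨measurable_inv, fun _ hx => (contDiffAt_inv ℝ (ne_of_gt hx)).contDiffWithinAt⟩

lemma smoothPos_rpow (a : ℝ) : SmoothPos fun x : ℝ => x ^ a :=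
  ⟨measurable_id.pow_const a,
    fun _ hx => (Real.contDiffAt_rpow_const_of_ne (ne_of_gt hx)).contDiffWithinAt⟩

lemma Poly.gauss_XSq (i : Fin 3) : (XSq i).gauss = 0 := by revert i; decide
lemma Poly.gauss_chi (i j : Fin 3) : (chi i j).gauss = 0 := by revert i j; decide
lemma Poly.gauss_chiSq (i j : Fin 3) : (chiSq i j).gauss = 0 := by revert i j; decide

variable {N : ℕ} {τ₀ η w : ℝ}

/-- The moments of the perturbation. -/
def momF (p : Poly) (ξ : Solution N τ₀ η w) : Field := momField ξ.D p 0

/-- The distribution function at a given time and place. -/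
def slice (ξ : Solution N τ₀ η w) (t : ℝ) (x : Torus) (v : Vel) : ℝ := density (ξ.f t) (x, v)

/-- The perturbation of `1 / ρ`. -/
def invF (ξ : Solution N τ₀ η w) : Field := fun t x => (1 + momF Poly.one ξ t x)⁻¹ - 1⁻¹

/-- The velocity field. -/
def velF (i : Fin 3) (ξ : Solution N τ₀ η w) : Field := fun t x =>
  momF (Poly.X i) ξ t x * (1 + invF ξ t x)

/-- The perturbation of the temperature. -/
def tempF (ξ : Solution N τ₀ η w) : Field := fun t x =>
  invF ξ t x + (1 / 3 * momF Poly.sq ξ t x -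
    1 / 3 * ∑ j, momF (Poly.X j) ξ t x * velF j ξ t x) * (1 + invF ξ t x)

/-- The perturbation of the collision frequency. -/
def freqF (ξ : Solution N τ₀ η w) : Field := fun t x =>
  1 / τ₀ * (((1 + momF Poly.one ξ t x) ^ η - 1 ^ η) +
    ((1 + tempF ξ t x) ^ w - 1 ^ w) * (1 + ((1 + momF Poly.one ξ t x) ^ η - 1 ^ η)))

/-- The heat flux. -/
def heatF (i : Fin 3) (ξ : Solution N τ₀ η w) : Field := fun t x =>
  momF (Poly.XSq i) ξ t x -
    2 * ∑ j, velF j ξ t x * (kronR i j + momF (Poly.X2 i j) ξ t x) -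
    velF i ξ t x * (3 + momF Poly.sq ξ t x) +
    2 * (velF i ξ t x * (∑ j, velF j ξ t x * velF j ξ t x) * (1 + momF Poly.one ξ t x))

/-- The density, velocity and energy are close to those of the Maxwellian. -/
structure NearEquilibrium (ξ : Solution N τ₀ η w) (t : ℝ) (x : Torus) : Prop where
  hasMoments : HasMoments (slice ξ t x)
  vmom_eq : ∀ p, vmom (slice ξ t x) p = p.gauss + momF p ξ t x
  one_le : |momF Poly.one ξ t x| ≤ 1 / 100
  X_le : ∀ i, |momF (Poly.X i) ξ t x| ≤ 1 / 100
  sq_le : |momF Poly.sq ξ t x| ≤ 1 / 100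

lemma ae_hasMoments_density (f : L2) : ∀ᵐ x : Torus, HasMoments (fun v => density f (x, v)) ∧
    ∀ p, vmom (fun v => density f (x, v)) p = p.gauss + mom p f x := by
  have h : ∀ᵐ x : Torus, ∀ p, mom p f x = ∫ v, f (x, v) * weight p v :=
    ae_all_iff.2 fun p => coeFn_mom p f
  filter_upwards [h, ae_memLp_slice f] with x h1 h2
  have e : ∀ (p : Poly) v, p.ev v * density f (x, v) =
      p.ev v * maxwellian v + f (x, v) * weight p v := fun p v => by
    simp only [density, weight]
    ring
  have hi := fun p => integrable_slice_mul h2 (memLp_weight p)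
  refine ⟨fun p => ?_, fun p => ?_⟩
  · simp only [e]
    exact (integrable_ev_mul_maxwellian p).add (hi p)
  · simp only [vmom, e]
    rw [integral_add (integrable_ev_mul_maxwellian p) (hi p), integral_ev_mul_maxwellian, h1]

lemma ae_nearEquilibrium (hN : 3 ≤ N) (ξ : Solution N τ₀ η w) {t : ℝ} (ht : t ∈ Ico 0 ξ.T) :
    ∀ᵐ x, NearEquilibrium ξ t x := by
  -- `momentConst` contains the sum of these operator norms, so one smallness condition serves all
  -- the moments that determine density, velocity and temperature.
  have key : ∀ p, ‖mom p‖ ≤ ‖mom Poly.one‖ + ∑ i, ‖mom (Poly.X i)‖ + ‖mom Poly.sq‖ →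
      ∀ᵐ x, |momF p ξ t x| ≤ 1 / 100 := by
    intro p hp
    filter_upwards [ξ.sol.derivatives.ae_abs_momField_le (α := 0)
      (by rw [order_zero]; omega) p ht] with x hx
    refine hx.trans (le_trans ?_ momentConst_mul_smallNorm)
    have := sobolevConst_nonneg
    exact mul_le_mul (mul_le_mul_of_nonneg_left hp (by positivity)) (ξ.b_le ht)
      (ξ.b_nonneg t) momentConst_nonneg
  have hX : ∀ i, ‖mom (Poly.X i)‖ ≤ ∑ i, ‖mom (Poly.X i)‖ := fun i =>
    Finset.single_le_sum (f := fun i => ‖mom (Poly.X i)‖) (fun _ _ => norm_nonneg _)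
      (Finset.mem_univ i)
  have n1 := norm_nonneg (mom Poly.one)
  have n2 := norm_nonneg (mom Poly.sq)
  have n3 : 0 ≤ ∑ i, ‖mom (Poly.X i)‖ := Finset.sum_nonneg fun _ _ => norm_nonneg _
  filter_upwards [ae_hasMoments_density (ξ.f t), key Poly.one (by linarith),
    ae_all_iff.2 fun i => key (Poly.X i) (by linarith [hX i]), key Poly.sq (by linarith)]
    with x h1 h2 h3 h4
  refine ⟨h1.1, fun p => ?_, h2, h3, h4⟩
  rw [momF, momField, ξ.sol.derivatives.zero t ht]
  exact h1.2 p

/-! ### Identification of the macroscopic quantities with the fields. -/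

namespace NearEquilibrium

variable {ξ : Solution N τ₀ η w} {t : ℝ} {x : Torus}

lemma rho_eq (h : NearEquilibrium ξ t x) : rho (slice ξ t x) = 1 + momF Poly.one ξ t x := by
  rw [Shakhov.rho_eq, h.vmom_eq, show Poly.one.gauss = 1 by decide, Int.cast_one]

lemma vmom_X_eq (h : NearEquilibrium ξ t x) (i : Fin 3) :
    vmom (slice ξ t x) (Poly.X i) = momF (Poly.X i) ξ t x := by
  rw [h.vmom_eq, Poly.gauss_X, Int.cast_zero, zero_add]

lemma vmom_sq_eq (h : NearEquilibrium ξ t x) :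
    vmom (slice ξ t x) Poly.sq = 3 + momF Poly.sq ξ t x := by
  rw [h.vmom_eq, show Poly.sq.gauss = 3 by decide]
  norm_num

lemma one_add_mem (h : NearEquilibrium ξ t x) :
    1 + momF Poly.one ξ t x ∈ Icc (99 / 100 : ℝ) (101 / 100) := by
  have := abs_le.1 h.one_le
  constructor <;> linarith

lemma rho_pos (h : NearEquilibrium ξ t x) : 0 < rho (slice ξ t x) := by
  rw [h.rho_eq]
  linarith [h.one_add_mem.1]

lemma one_add_invF (h : NearEquilibrium ξ t x) :
    1 + invF ξ t x = (rho (slice ξ t x))⁻¹ := by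
  rw [invF, h.rho_eq]
  norm_num

lemma velF_eq (h : NearEquilibrium ξ t x) (i : Fin 3) :
    bulkVelocity (slice ξ t x) i = velF i ξ t x := by
  rw [bulkVelocity_apply h.hasMoments, velF, h.one_add_invF, h.vmom_X_eq, mul_comm]

lemma one_add_tempF (h : NearEquilibrium ξ t x) : 1 + tempF ξ t x =
    (1 + 1 / 3 * momF Poly.sq ξ t x - 1 / 3 * ∑ j, momF (Poly.X j) ξ t x * velF j ξ t x) *
      (rho (slice ξ t x))⁻¹ := by
  rw [← h.one_add_invF, tempF]
  ring

lemma temperature_eq (h : NearEquilibrium ξ t x) :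
    temperature (slice ξ t x) = 1 + tempF ξ t x := by
  have h1 := Shakhov.vmom_sq_eq h.hasMoments h.rho_pos
  have h2 : ∑ j, momF (Poly.X j) ξ t x * velF j ξ t x = rho (slice ξ t x) *
      ∑ j, bulkVelocity (slice ξ t x) j * bulkVelocity (slice ξ t x) j := by
    rw [Finset.mul_sum]
    refine Finset.sum_congr rfl fun j _ => ?_
    rw [← h.vmom_X_eq, rho_mul_bulkVelocity h.hasMoments h.rho_pos, h.velF_eq, mul_assoc]
  rw [h.one_add_tempF, h2, eq_mul_inv_iff_mul_eq₀ h.rho_pos.ne']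
  rw [h.vmom_sq_eq] at h1
  linarith

lemma one_add_tempF_mem (h : NearEquilibrium ξ t x) :
    1 + tempF ξ t x ∈ Icc (1 / 2 : ℝ) 2 := by
  have hr := h.one_add_mem
  rw [← h.rho_eq] at hr
  have hr0 := h.rho_pos
  have hU : ∀ j, |momF (Poly.X j) ξ t x * velF j ξ t x| ≤ 1 / 100 := by
    intro j
    have h1 : |(rho (slice ξ t x))⁻¹| ≤ 2 := by
      rw [abs_of_pos (inv_pos.2 hr0), inv_le_comm₀ hr0 (by norm_num)]
      linarith [hr.1]
    rw [velF, h.one_add_invF, abs_mul, abs_mul]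
    have h2 := h.X_le j
    have h3 : |momF (Poly.X j) ξ t x| * |(rho (slice ξ t x))⁻¹| ≤ 1 / 100 * 2 :=
      mul_le_mul h2 h1 (abs_nonneg _) (by norm_num)
    have := mul_le_mul h2 h3 (by positivity) (by norm_num)
    linarith
  have h0 := abs_le.1 (hU 0)
  have h1 := abs_le.1 (hU 1)
  have h2 := abs_le.1 (hU 2)
  have h3 := abs_le.1 h.sq_le
  rw [h.one_add_tempF, ← div_eq_mul_inv, Fin.sum_univ_three, mem_Icc, le_div_iff₀ hr0,
    div_le_iff₀ hr0]
  constructor <;> linarith [hr.1, hr.2]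

lemma temperature_pos (h : NearEquilibrium ξ t x) : 0 < temperature (slice ξ t x) := by
  rw [h.temperature_eq]
  linarith [h.one_add_tempF_mem.1]

lemma collisionFreq_eq (h : NearEquilibrium ξ t x) :
    collisionFreq τ₀ η w (slice ξ t x) = 1 / τ₀ + freqF ξ t x := by
  rw [collisionFreq, h.rho_eq, h.temperature_eq, freqF, Real.one_rpow, Real.one_rpow]
  ring

lemma heatFlux_eq (h : NearEquilibrium ξ t x) (i : Fin 3) :
    heatFlux (slice ξ t x) i = heatF i ξ t x := by
  have e2 : ∀ j, vmom (slice ξ t x) (Poly.X2 i j) = kronR i j + momF (Poly.X2 i j) ξ t x :=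
    fun j => by rw [h.vmom_eq, Poly.gauss_X2, kronR]
  rw [heatFlux_apply h.hasMoments h.rho_pos, heatF]
  simp only [h.velF_eq, e2, h.vmom_sq_eq, h.rho_eq]
  rw [h.vmom_eq, Poly.gauss_XSq]
  push_cast
  ring

end NearEquilibrium

/-! ### Uniform regularity of the macroscopic fields. -/

section regular

variable {k : ℕ}

lemma sm_momF (hk : k + 2 ≤ N) (p : Poly) :
    Sm (k + 1) 1 (momF p : Solution N τ₀ η w → Field) := by
  have := sobolevConst_nonneg
  refine ⟨(1 + 4 * sobolevConst) * ‖mom p‖, by positivity, fun ξ => ?_⟩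
  simp only [pow_one]
  exact ξ.sol.derivatives.reg_momField p (k + 1) (α := 0)
    (by rw [order_zero]; omega)

lemma sm_invF (hN : 3 ≤ N) (hk : k + 2 ≤ N) :
    Sm (k + 1) 1 (invF : Solution N τ₀ η w → Field) :=
  (sm_momF hk Poly.one).comp smoothPos_inv fun ξ t ht => by
    filter_upwards [ae_nearEquilibrium hN ξ (Ioo_subset_Ico_self ht)] with x hx
    exact Icc_subset_Icc (by norm_num) (by norm_num) hx.one_add_mem

lemma sm_velF (hN : 3 ≤ N) (hk : k + 2 ≤ N) (i : Fin 3) :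
    Sm (k + 1) 1 (velF i : Solution N τ₀ η w → Field) :=
  (sm_momF hk _).mul_one_add (sm_invF hN hk)

lemma sm_tempF (hN : 3 ≤ N) (hk : k + 2 ≤ N) :
    Sm (k + 1) 1 (tempF : Solution N τ₀ η w → Field) :=
  (sm_invF hN hk).add (Sm.mul_one_add (((sm_momF hk _).const_mul _).sub
    (Sm.const_mul _ (Sm.sum fun j => (sm_momF hk _).mul (sm_velF hN hk j)).weaken))
      (sm_invF hN hk))

lemma sm_freqF (hN : 3 ≤ N) (hk : k + 2 ≤ N) :
    Sm (k + 1) 1 (freqF : Solution N τ₀ η w → Field) := by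
  have h1 := (sm_momF (τ₀ := τ₀) (η := η) (w := w) hk Poly.one).comp (smoothPos_rpow η)
    fun ξ t ht => by
      filter_upwards [ae_nearEquilibrium hN ξ (Ioo_subset_Ico_self ht)] with x hx
      exact Icc_subset_Icc (by norm_num) (by norm_num) hx.one_add_mem
  have h2 := (sm_tempF (τ₀ := τ₀) (η := η) (w := w) hN hk).comp (smoothPos_rpow w)
    fun ξ t ht => by
      filter_upwards [ae_nearEquilibrium hN ξ (Ioo_subset_Ico_self ht)] with x hx
      exact hx.one_add_tempF_mem
  exact (h1.add (h2.mul_one_add h1)).const_mul _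

lemma Sm.mul_const_add {c : ℝ} {u z : Solution N τ₀ η w → Field} {j : ℕ} (hu : Sm (k + 1) j u)
    (hz : Sm (k + 1) 1 z) : Sm (k + 1) j fun ξ t x => u ξ t x * (c + z ξ t x) := by
  simpa only [mul_add, mul_comm _ c] using (hu.const_mul c).add (hu.mul hz).weaken

lemma sm_heatF (hN : 3 ≤ N) (hk : k + 2 ≤ N) (i : Fin 3) :
    Sm (k + 1) 1 (heatF i : Solution N τ₀ η w → Field) := by
  have hU := sm_velF (τ₀ := τ₀) (η := η) (w := w) hN hk
  have hm := sm_momF (τ₀ := τ₀) (η := η) (w := w) hk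
  have hS : Sm (k + 1) 2 fun (ξ : Solution N τ₀ η w) t x => ∑ j, velF j ξ t x * velF j ξ t x :=
    Sm.sum fun j => (hU j).mul (hU j)
  exact (((hm _).sub (Sm.const_mul _ (Sm.sum fun j => (hU j).mul_const_add (hm _)))).sub
    ((hU i).mul_const_add (hm _))).add
    (Sm.const_mul _ (((hU i).mul hS).weaken.weaken.mul_one_add (hm _)))

end regular

/-! ### The collision terms as quadratic fields -/

/-- The collision term tested against `v_i |v|²`. -/
def collXSqF (i : Fin 3) (ξ : Solution N τ₀ η w) : Field := fun t x =>
  (-2 * ∑ j, velF j ξ t x * (momF (Poly.X2 i j) ξ t x -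
    -- The bracket is `ρT - 1`: the equilibrium values of the second moment and of the pressure have
    -- cancelled, so every summand is a product of perturbations.
    kronR i j * (momF Poly.one ξ t x + tempF ξ t x * (1 + momF Poly.one ξ t x)) -
    velF i ξ t x * velF j ξ t x * (1 + momF Poly.one ξ t x))) * (1 / τ₀ + freqF ξ t x)

/-- The traceless part of the tensor `3 a ⊗ b`. -/
def tracelessF (a b : Fin 3 → Solution N τ₀ η w → Field) (i j : Fin 3)
    (ξ : Solution N τ₀ η w) : Field := fun t x =>
  3 * (a i ξ t x * b j ξ t x) - kronR i j * ∑ k, a k ξ t x * b k ξ t x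

/-- The nonlinear part of the collision term tested against `3 v_i v_j - δ_ij |v|²`. -/
def collChiF (i j : Fin 3) (ξ : Solution N τ₀ η w) : Field := fun t x =>
  (tracelessF velF velF i j ξ t x * (1 + momF Poly.one ξ t x)) * (1 / τ₀ + freqF ξ t x) -
    freqF ξ t x * momF (Poly.chi i j) ξ t x

/-- The nonlinear part of the collision term tested against `(3 v_i v_j - δ_ij |v|²) |v|²`. -/
def collChiSqF (i j : Fin 3) (ξ : Solution N τ₀ η w) : Field := fun t x =>
  (tracelessF velF velF i j ξ t x * (1 + momF Poly.one ξ t x) *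
      (7 + (7 * tempF ξ t x + ∑ k, velF k ξ t x * velF k ξ t x)) +
    7 / 5 * (tracelessF velF heatF i j ξ t x + tracelessF heatF velF i j ξ t x)) *
      (1 / τ₀ + freqF ξ t x) - freqF ξ t x * momF (Poly.chiSq i j) ξ t x

section

variable {k : ℕ}

lemma sm_tracelessF {a b : Fin 3 → Solution N τ₀ η w → Field} (ha : ∀ i, Sm (k + 1) 1 (a i))
    (hb : ∀ i, Sm (k + 1) 1 (b i)) (i j : Fin 3) : Sm (k + 1) 2 (tracelessF a b i j) :=
  (((ha i).mul (hb j)).const_mul 3).sub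
    (Sm.const_mul _ (Sm.sum fun l => (ha l).mul (hb l)))

/-- The velocity field supplies one power of `b` and the stress deviation the other. -/
lemma sm_collXSqF (hN : 3 ≤ N) (hk : k + 2 ≤ N) (i : Fin 3) :
    Sm (k + 1) 2 (collXSqF i : Solution N τ₀ η w → Field) := by
  have hU := sm_velF (τ₀ := τ₀) (η := η) (w := w) hN hk
  have hm := sm_momF (τ₀ := τ₀) (η := η) (w := w) hk
  exact (Sm.const_mul _ (Sm.sum fun j => (hU j).mul (((hm _).sub (((hm _).add
    ((sm_tempF hN hk).mul_one_add (hm _))).const_mul _)).sub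
    (((hU i).mul (hU j)).weaken.mul_one_add (hm _))))).mul_const_add (sm_freqF hN hk)

lemma sm_collChiF (hN : 3 ≤ N) (hk : k + 2 ≤ N) (i j : Fin 3) :
    Sm (k + 1) 2 (collChiF i j : Solution N τ₀ η w → Field) := by
  have hU := sm_velF (τ₀ := τ₀) (η := η) (w := w) hN hk
  have hm := sm_momF (τ₀ := τ₀) (η := η) (w := w) hk
  have hf := sm_freqF (τ₀ := τ₀) (η := η) (w := w) hN hk
  exact (((sm_tracelessF hU hU i j).mul_one_add (hm _)).mul_const_add hf).sub (hf.mul (hm _))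

lemma sm_collChiSqF (hN : 3 ≤ N) (hk : k + 2 ≤ N) (i j : Fin 3) :
    Sm (k + 1) 2 (collChiSqF i j : Solution N τ₀ η w → Field) := by
  have hU := sm_velF (τ₀ := τ₀) (η := η) (w := w) hN hk
  have hq := sm_heatF (τ₀ := τ₀) (η := η) (w := w) hN hk
  have hm := sm_momF (τ₀ := τ₀) (η := η) (w := w) hk
  have hf := sm_freqF (τ₀ := τ₀) (η := η) (w := w) hN hk
  have hS : Sm (k + 1) 2 fun (ξ : Solution N τ₀ η w) t x => ∑ j, velF j ξ t x * velF j ξ t x :=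
    Sm.sum fun j => (hU j).mul (hU j)
  exact (((((sm_tracelessF hU hU i j).mul_one_add (hm _)).mul_const_add
    (((sm_tempF hN hk).const_mul _).add hS.weaken)).add
    (((sm_tracelessF hU hq i j).add (sm_tracelessF hq hU i j)).const_mul _)).mul_const_add
      hf).sub (hf.mul (hm _))

end

/-! ### Agreement of the collision moments with the quadratic fields. -/

namespace NearEquilibrium

variable {ξ : Solution N τ₀ η w} {t : ℝ} {x : Torus}

lemma collision_XSq_eq (h : NearEquilibrium ξ t x) (i : Fin 3) :
    collisionFreq τ₀ η w (slice ξ t x) * collision (slice ξ t x) (Poly.XSq i) =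
      collXSqF i ξ t x := by
  have e2 : ∀ j, vmom (slice ξ t x) (Poly.X2 i j) = kronR i j + momF (Poly.X2 i j) ξ t x :=
    fun j => by rw [h.vmom_eq, Poly.gauss_X2, kronR]
  rw [collision_XSq h.hasMoments h.rho_pos h.temperature_pos, h.collisionFreq_eq, collXSqF,
    mul_comm]
  simp only [h.velF_eq, h.rho_eq, h.temperature_eq, e2]
  congr 2
  refine Finset.sum_congr rfl fun j _ => ?_
  ring

lemma collision_chi_eq (h : NearEquilibrium ξ t x) (i j : Fin 3) :
    collisionFreq τ₀ η w (slice ξ t x) * collision (slice ξ t x) (Poly.chi i j) =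
      collChiF i j ξ t x - 1 / τ₀ * momF (Poly.chi i j) ξ t x := by
  rw [collision_chi h.hasMoments h.rho_pos h.temperature_pos, h.collisionFreq_eq, collChiF,
    h.vmom_eq, Poly.gauss_chi, tracelessF]
  simp only [h.velF_eq, h.rho_eq]
  push_cast
  ring

lemma collision_chiSq_eq (h : NearEquilibrium ξ t x) (i j : Fin 3) :
    collisionFreq τ₀ η w (slice ξ t x) * collision (slice ξ t x) (Poly.chiSq i j) =
      collChiSqF i j ξ t x - 1 / τ₀ * momF (Poly.chiSq i j) ξ t x := by
  rw [collision_chiSq h.hasMoments h.rho_pos h.temperature_pos, h.collisionFreq_eq, collChiSqF,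
    h.vmom_eq, Poly.gauss_chiSq]
  simp only [tracelessF, h.velF_eq, h.rho_eq, h.heatFlux_eq, h.temperature_eq,
    Fin.sum_univ_three]
  push_cast
  ring

end NearEquilibrium

end

section

/-! ### The moment equations -/

/-- Needed because `Reg` only asserts that some derivative exists; uniqueness identifies it with the
derivative of the moment equation. -/
lemma HasD.unique {T : ℝ} {i : Fin 4} {u g g' : Field} (h : HasD T i u g) (h' : HasD T i u g')
    (mu : ∀ t, AEStronglyMeasurable (u t) volume) (mg : ∀ t, AEStronglyMeasurable (g t) volume)
    (mg' : ∀ t, AEStronglyMeasurable (g' t) volume) {t : ℝ} (ht : t ∈ Ioo 0 T) :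
    g t =ᵐ[volume] g' t := by
  have h1 := (h' t ht).add (h t ht)
  rw [add_zero] at h1
  have h2 : normTwo (fun x => g t x - g' t x) ≤ 0 := by
    refine ge_of_tendsto h1 (Eventually.of_forall fun s => ?_)
    have m1 : ∀ {z : Field}, (∀ t, AEStronglyMeasurable (z t) volume) → AEStronglyMeasurable
        (fun x => s⁻¹ * (shift i s u t x - u t x) - z t x) volume := fun hz =>
      (((aesm_shift mu i s t).sub (mu t)).const_mul _).sub (hz t)
    refine le_trans (le_of_eq ?_) (eLpNorm_sub_le (m1 mg') (m1 mg) (by norm_num))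
    congr 1
    funext x
    simp only [Pi.sub_apply]
    ring
  have h3 := (eLpNorm_eq_zero_iff ((mg t).sub (mg' t)) (by norm_num)).1 (le_zero_iff.1 h2)
  filter_upwards [h3] with x hx
  exact sub_eq_zero.1 hx

lemma IsDerivX.sum {i : Fin 3} {u g : Fin 3 → Hx} (h : ∀ k, IsDerivX i (u k) (g k)) :
    IsDerivX i (∑ k, u k) (∑ k, g k) := by
  simpa only [Fin.sum_univ_three] using ((h 0).add (h 1)).add (h 2)

lemma exists_eq_add_single {n : ℕ} {γ : Fin n → ℕ} (hγ : γ ≠ 0) :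
    ∃ (β : Fin n → ℕ) (i : Fin n), γ = β + Pi.single i 1 := by
  obtain ⟨i, hi⟩ := Function.ne_iff.1 hγ
  refine ⟨γ - Pi.single i 1, i, funext fun j => ?_⟩
  rw [Pi.zero_apply] at hi
  by_cases hj : j = i
  · subst hj; simp; omega
  · simp [hj]

variable {N : ℕ} {τ₀ η w : ℝ}

/-- The moments of the derivatives of a solution. -/
def Solution.mm (ξ : Solution N τ₀ η w) (p : Poly) (γ : Fin 4 → ℕ) (t : ℝ) : Hx :=
  mom p (ξ.D γ 0 t)

/-- The moment of `∂_t f + v · ∇_x f + c f`, and its derivatives. -/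
def Solution.transport (ξ : Solution N τ₀ η w) (p : Poly) (c : ℝ) (γ : Fin 4 → ℕ) (t : ℝ) : Hx :=
  ξ.mm p (γ + Pi.single 0 1) t + ∑ k : Fin 3, ξ.mm ((Poly.X k).mul p) (γ + Pi.single k.succ 1) t +
    c • ξ.mm p γ t

lemma Solution.hasDerivAt_mm (ξ : Solution N τ₀ η w) (p : Poly) {γ : Fin 4 → ℕ}
    (hγ : order γ < N) {t : ℝ} (ht : t ∈ Ioo 0 ξ.T) :
    HasDerivAt (ξ.mm p γ) (ξ.mm p (γ + Pi.single 0 1) t) t :=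
  (mom p).hasFDerivAt.comp_hasDerivAt t (ξ.sol.derivatives.hasDerivAt hγ ht)

lemma Solution.isDerivX_mm (ξ : Solution N τ₀ η w) (p : Poly) {γ : Fin 4 → ℕ}
    (hγ : order γ < N) {t : ℝ} (ht : t ∈ Ico 0 ξ.T) (j : Fin 3) :
    IsDerivX j (ξ.mm p γ t) (ξ.mm p (γ + Pi.single j.succ 1) t) :=
  ξ.sol.derivatives.isDerivX hγ ht p j

lemma Solution.hasD_transport (ξ : Solution N τ₀ η w) (p : Poly) (c : ℝ) {γ : Fin 4 → ℕ}
    (hγ : order γ + 1 < N) (i : Fin 4) :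
    HasD ξ.T i (fun t x => ξ.transport p c γ t x)
      (fun t x => ξ.transport p c (γ + Pi.single i 1) t x) := by
  have ho : ∀ j : Fin 4, order (γ + Pi.single j 1) < N := fun j => by
    rw [order_add_single]; omega
  induction i using Fin.cases with
  | zero =>
    refine hasD_zero_of_hasDerivAt fun t ht => ?_
    simp only [Solution.transport, add_right_comm γ (Pi.single 0 1)]
    exact ((ξ.hasDerivAt_mm p (ho 0) ht).add (HasDerivAt.fun_sum fun k _ =>
      ξ.hasDerivAt_mm _ (ho k.succ) ht)).add ((ξ.hasDerivAt_mm p (by omega) ht).const_smul c)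
  | succ j =>
    refine hasD_succ_of_isDerivX fun t ht => ?_
    have ht' := Ioo_subset_Ico_self ht
    simp only [Solution.transport, add_right_comm γ (Pi.single j.succ 1)]
    exact ((ξ.isDerivX_mm p (ho 0) ht' j).add (IsDerivX.sum fun k =>
      ξ.isDerivX_mm _ (ho k.succ) ht' j)).add ((ξ.isDerivX_mm p (by omega) ht' j).smul c)

lemma Solution.coeFn_transport (ξ : Solution N τ₀ η w) (p : Poly) (c : ℝ) (γ : Fin 4 → ℕ)
    (t : ℝ) : ξ.transport p c γ t =ᵐ[volume] fun x => ξ.mm p (γ + Pi.single 0 1) t x +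
      ∑ k : Fin 3, ξ.mm ((Poly.X k).mul p) (γ + Pi.single k.succ 1) t x +
      c * ξ.mm p γ t x := by
  simp only [Solution.transport, Fin.sum_univ_three]
  refine (Lp.coeFn_add _ _).trans ?_
  refine (((Lp.coeFn_add _ _).trans ((ae_eq_refl _).add ((Lp.coeFn_add _ _).trans
    ((Lp.coeFn_add _ _).add (ae_eq_refl _))))).add (Lp.coeFn_smul _ _)).trans ?_
  exact Eventually.of_forall fun x => rfl

/-- The derivatives of the moment equations inherit a quadratic bound from the right side. -/
lemma exists_norm_transport_le (hN : 3 ≤ N) {p : Poly} {c : ℝ} {u : Solution N τ₀ η w → Field}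
    (hu : Sm (N - 1) 2 u)
    (h : ∀ ξ, ∀ t ∈ Ioo 0 ξ.T, u ξ t =ᵐ[volume] ξ.transport p c 0 t) :
    ∃ C, 0 ≤ C ∧ ∀ (ξ : Solution N τ₀ η w), ∀ γ, order γ < N → ∀ t ∈ Ioo 0 ξ.T,
      ‖ξ.transport p c γ t‖ ≤ C * ξ.b t ^ 2 := by
  obtain ⟨C, hC, hreg⟩ := hu
  refine ⟨C, hC, fun ξ => ?_⟩
  have hm : ∀ γ t, AEStronglyMeasurable (fun x => ξ.transport p c γ t x) volume :=
    fun γ t => Lp.aestronglyMeasurable _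
  -- Each derivative applied to the moment equation uses up one order of regularity, so `n + k`
  -- stays equal to `N - 1`.
  have key : ∀ n, ∀ γ, order γ = n → ∀ k, n + k = N - 1 →
      Reg ξ.T k (fun t => C * ξ.b t ^ 2) (fun t x => ξ.transport p c γ t x) := by
    intro n
    induction n with
    | zero =>
      intro γ hγ k hk
      have : γ = 0 := funext fun i => by
        simpa using (Finset.sum_eq_zero_iff.1 hγ) i (Finset.mem_univ i)
      subst this
      rw [zero_add] at hk
      subst hk
      exact (hreg ξ).congr (h ξ) (hm 0)
    | succ n ih =>
      intro γ hγ k hk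
      obtain ⟨β, i, rfl⟩ := exists_eq_add_single (γ := γ) (by
        rintro rfl
        simp [order_zero] at hγ)
      rw [order_add_single] at hγ
      have hr := ih β (by omega) (k + 1) (by omega)
      obtain ⟨g, hg, hgr⟩ := hr.2.2.2 i
      have hd := ξ.hasD_transport p c (γ := β) (by omega) i
      exact hgr.congr (fun t ht => hg.unique hd hr.aesm hgr.aesm (hm _) ht) (hm _)
  intro γ hγ t ht
  have h1 := (key _ γ rfl (N - 1 - order γ) (by omega)).normTwo_le ht
  rw [normTwo_coe] at h1
  exact (ENNReal.ofReal_le_ofReal_iff (mul_nonneg hC (sq_nonneg _))).1 h1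

/-- The kinetic equation multiplied by `p` and integrated in `v`. The equation carries one factor
`√m`, which is the weight of the moments. -/
lemma Solution.ae_transport_eq (ξ : Solution N τ₀ η w) (p : Poly) {t : ℝ} (ht : t ∈ Ico 0 ξ.T) :
    ∀ᵐ x, ξ.transport p 0 0 t x =
      collisionFreq τ₀ η w (slice ξ t x) * collision (slice ξ t x) p := by
  have hs : ∀ i : Fin 4, ∀ᵐ x, MemLp (fun v => ξ.D (Pi.single i 1) 0 t (x, v)) 2 := fun i =>
    ae_memLp_slice _
  have hm : ∀ (q : Poly) (i : Fin 4), ∀ᵐ x, mom q (ξ.D (Pi.single i 1) 0 t) x =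
      ∫ v, ξ.D (Pi.single i 1) 0 t (x, v) * weight q v := fun q i => coeFn_mom _ _
  filter_upwards [ξ.coeFn_transport p 0 0 t, ae_slice (ξ.sol.equation t ht),
    ae_all_iff.2 hs, hm p 0, ae_all_iff.2 fun k : Fin 3 => hm ((Poly.X k).mul p) k.succ]
    with x h1 h2 h3 h4 h5
  rw [h1]
  simp only [zero_add, zero_mul, add_zero, Solution.mm, h4, h5]
  rw [collision, ← integral_const_mul, ← integral_finsetSum _ fun k _ =>
    integrable_slice_mul (h3 _) (memLp_weight _), ← integral_add
    (integrable_slice_mul (h3 _) (memLp_weight _)) (integrable_finsetSum _ fun k _ =>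
    integrable_slice_mul (h3 _) (memLp_weight _))]
  refine integral_congr_ae ?_
  filter_upwards [h2] with v hv
  rw [mul_left_comm, slice]
  have e : collisionFreq τ₀ η w (slice ξ t x) *
      (shakhovOp 0 (slice ξ t x) v - density (ξ.f t) (x, v)) = _ := hv.symm
  rw [e]
  simp only [weight, Poly.ev_mul, Poly.ev_X, Fin.sum_univ_three]
  ring

/-- The polynomials whose moments are conserved up to a quadratic error. -/
inductive Poly.IsInvariant : Poly → Prop
  | one : IsInvariant one
  | X (i : Fin 3) : IsInvariant (X i)
  | sq : IsInvariant sq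
  | XSq (i : Fin 3) : IsInvariant (XSq i)

lemma Sm.zero (k j : ℕ) : Sm k j fun (_ : Solution N τ₀ η w) _ _ => (0 : ℝ) :=
  ⟨0, le_rfl, fun ξ => by simpa using Reg.const k 0⟩

lemma exists_transport_le_of_isInvariant (hN : 3 ≤ N) {p : Poly} (hp : p.IsInvariant) :
    ∃ C, 0 ≤ C ∧ ∀ (ξ : Solution N τ₀ η w), ∀ γ, order γ < N → ∀ t ∈ Ioo 0 ξ.T,
      ‖ξ.transport p 0 γ t‖ ≤ C * ξ.b t ^ 2 := by
  obtain ⟨k, rfl⟩ : ∃ k, N = k + 2 := ⟨N - 2, by omega⟩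
  have key : ∀ (u : Solution (k + 2) τ₀ η w → Field), (∀ ξ t x, NearEquilibrium ξ t x →
      collisionFreq τ₀ η w (slice ξ t x) * collision (slice ξ t x) p = u ξ t x) →
      ∀ ξ, ∀ t ∈ Ioo 0 ξ.T, u ξ t =ᵐ[volume] ξ.transport p 0 0 t := by
    intro u hu ξ t ht
    have ht' := Ioo_subset_Ico_self ht
    filter_upwards [ae_nearEquilibrium hN ξ ht', ξ.ae_transport_eq p ht'] with x h1 h2
    rw [h2, hu ξ t x h1]
  -- For the exactly conserved moments the right side is the zero field, which is trivially
  -- quadratic.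
  have hz : (∀ (ξ : Solution (k + 2) τ₀ η w) t x, NearEquilibrium ξ t x →
      collision (slice ξ t x) p = 0) → ∃ C, 0 ≤ C ∧ ∀ (ξ : Solution (k + 2) τ₀ η w), ∀ γ,
      order γ < k + 2 → ∀ t ∈ Ioo 0 ξ.T, ‖ξ.transport p 0 γ t‖ ≤ C * ξ.b t ^ 2 := fun h =>
    exists_norm_transport_le hN (Sm.zero _ 2) (key _ fun ξ t x hx => by
      rw [h ξ t x hx, mul_zero])
  cases hp with
  | one => exact hz fun ξ t x h => collision_one h.hasMoments h.rho_pos h.temperature_pos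
  | X i => exact hz fun ξ t x h => collision_X h.hasMoments h.rho_pos h.temperature_pos i
  | sq => exact hz fun ξ t x h => collision_sq h.hasMoments h.rho_pos h.temperature_pos
  | XSq i =>
    exact exists_norm_transport_le hN (sm_collXSqF hN le_rfl i)
      (key _ fun ξ t x h => h.collision_XSq_eq i)

/-- The linear damping is moved to the left, as the parameter `1/τ₀` of `transport`, so that the
right side is purely quadratic. -/
lemma exists_transport_le_of_relaxing (hN : 3 ≤ N) {p : Poly} (u : Solution N τ₀ η w → Field)
    (hu : Sm (N - 1) 2 u) (h : ∀ ξ t x, NearEquilibrium ξ t x →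
      collisionFreq τ₀ η w (slice ξ t x) * collision (slice ξ t x) p =
        u ξ t x - 1 / τ₀ * momF p ξ t x) :
    ∃ C, 0 ≤ C ∧ ∀ (ξ : Solution N τ₀ η w), ∀ γ, order γ < N → ∀ t ∈ Ioo 0 ξ.T,
      ‖ξ.transport p (1 / τ₀) γ t‖ ≤ C * ξ.b t ^ 2 := by
  refine exists_norm_transport_le hN hu fun ξ t ht => ?_
  have ht' := Ioo_subset_Ico_self ht
  filter_upwards [ae_nearEquilibrium hN ξ ht', ξ.ae_transport_eq p ht',
    ξ.coeFn_transport p 0 0 t, ξ.coeFn_transport p (1 / τ₀) 0 t] with x h1 h2 h3 h4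
  have h5 := h ξ t x h1
  rw [← h2, h3] at h5
  rw [h4]
  simp only [momF, momField, Solution.mm] at h5 ⊢
  linarith

lemma exists_transport_chi_le (hN : 3 ≤ N) (i j : Fin 3) :
    ∃ C, 0 ≤ C ∧ ∀ (ξ : Solution N τ₀ η w), ∀ γ, order γ < N → ∀ t ∈ Ioo 0 ξ.T,
      ‖ξ.transport (Poly.chi i j) (1 / τ₀) γ t‖ ≤ C * ξ.b t ^ 2 := by
  obtain ⟨k, rfl⟩ : ∃ k, N = k + 2 := ⟨N - 2, by omega⟩
  exact exists_transport_le_of_relaxing hN _ (sm_collChiF hN le_rfl i j)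
    fun ξ t x h => h.collision_chi_eq i j

lemma exists_transport_chiSq_le (hN : 3 ≤ N) (i j : Fin 3) :
    ∃ C, 0 ≤ C ∧ ∀ (ξ : Solution N τ₀ η w), ∀ γ, order γ < N → ∀ t ∈ Ioo 0 ξ.T,
      ‖ξ.transport (Poly.chiSq i j) (1 / τ₀) γ t‖ ≤ C * ξ.b t ^ 2 := by
  obtain ⟨k, rfl⟩ : ∃ k, N = k + 2 := ⟨N - 2, by omega⟩
  exact exists_transport_le_of_relaxing hN _ (sm_collChiSqF hN le_rfl i j)
    fun ξ t x h => h.collision_chiSq_eq i j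

end

section

/-! ### Quantities controlled by the microscopic part and quadratic terms -/

variable {N : ℕ} {τ₀ η w : ℝ}

/-- The norm of the microscopic parts of the derivatives. -/
def Solution.micro (ξ : Solution N τ₀ η w) (t : ℝ) : ℝ :=
  √(∑ α ∈ multiIndices 4 N, microSq (ξ.D α 0 t))

/-- The quadratic error terms. -/
def Solution.quad (ξ : Solution N τ₀ η w) (t : ℝ) : ℝ :=
  ξ.b t ^ 2 + ∫ s in (0 : ℝ)..t, ξ.b s ^ 2

lemma Solution.micro_nonneg (ξ : Solution N τ₀ η w) (t : ℝ) : 0 ≤ ξ.micro t := Real.sqrt_nonneg _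

lemma Solution.micro_sq (ξ : Solution N τ₀ η w) (t : ℝ) :
    ξ.micro t ^ 2 = ∑ α ∈ multiIndices 4 N, microSq (ξ.D α 0 t) :=
  Real.sq_sqrt (Finset.sum_nonneg fun _ _ => microSq_nonneg _)

lemma Solution.integral_sq_nonneg (ξ : Solution N τ₀ η w) {t : ℝ} (ht : 0 ≤ t) :
    0 ≤ ∫ s in (0 : ℝ)..t, ξ.b s ^ 2 :=
  intervalIntegral.integral_nonneg ht fun _ _ => sq_nonneg _

/-- A family of functions that is bounded by the microscopic part and quadratic terms. -/
def Controlled (u : Solution N τ₀ η w → ℝ → Hx) : Prop :=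
  ∃ C, 0 ≤ C ∧ ∀ ξ, ∀ t ∈ Ioo 0 ξ.T, ‖u ξ t‖ ≤ C * (ξ.micro t + ξ.quad t)

lemma Solution.quad_nonneg (ξ : Solution N τ₀ η w) {t : ℝ} (ht : 0 ≤ t) : 0 ≤ ξ.quad t :=
  add_nonneg (sq_nonneg _) (ξ.integral_sq_nonneg ht)

lemma Solution.sum_nonneg (ξ : Solution N τ₀ η w) {t : ℝ} (ht : t ∈ Ioo 0 ξ.T) :
    0 ≤ ξ.micro t + ξ.quad t :=
  add_nonneg (ξ.micro_nonneg t) (ξ.quad_nonneg ht.1.le)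

namespace Controlled

variable {u z : Solution N τ₀ η w → ℝ → Hx}

lemma add (hu : Controlled u) (hz : Controlled z) : Controlled fun ξ t => u ξ t + z ξ t := by
  obtain ⟨C, hC, h⟩ := hu
  obtain ⟨C', hC', h'⟩ := hz
  refine ⟨C + C', by positivity, fun ξ t ht => (norm_add_le _ _).trans ?_⟩
  rw [add_mul]
  exact add_le_add (h ξ t ht) (h' ξ t ht)

lemma smul (c : ℝ) (hu : Controlled u) : Controlled fun ξ t => c • u ξ t := by
  obtain ⟨C, hC, h⟩ := hu
  refine ⟨|c| * C, by positivity, fun ξ t ht => ?_⟩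
  rw [norm_smul, mul_assoc, Real.norm_eq_abs]
  exact mul_le_mul_of_nonneg_left (h ξ t ht) (abs_nonneg c)

lemma sub (hu : Controlled u) (hz : Controlled z) : Controlled fun ξ t => u ξ t - z ξ t := by
  simpa only [neg_one_smul, ← sub_eq_add_neg] using hu.add (hz.smul (-1))

lemma sum {u : Fin 3 → Solution N τ₀ η w → ℝ → Hx} (h : ∀ i, Controlled (u i)) :
    Controlled fun ξ t => ∑ i, u i ξ t := by
  simpa only [Fin.sum_univ_three] using ((h 0).add (h 1)).add (h 2)

lemma congr (hu : Controlled u) (h : ∀ ξ t, u ξ t = z ξ t) : Controlled z := by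
  obtain rfl : u = z := funext fun ξ => funext fun t => h ξ t
  exact hu

lemma of_smul {c : ℝ} (hc : c ≠ 0) (hu : Controlled fun ξ t => c • u ξ t) : Controlled u :=
  (hu.smul c⁻¹).congr fun ξ t => by rw [smul_smul, inv_mul_cancel₀ hc, one_smul]

lemma of_quadratic (h : ∃ C, 0 ≤ C ∧ ∀ ξ, ∀ t ∈ Ioo 0 ξ.T, ‖u ξ t‖ ≤ C * ξ.b t ^ 2) :
    Controlled u := by
  obtain ⟨C, hC, h⟩ := h
  refine ⟨C, hC, fun ξ t ht => (h ξ t ht).trans (mul_le_mul_of_nonneg_left ?_ hC)⟩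
  have h1 := ξ.micro_nonneg t
  have h2 := ξ.integral_sq_nonneg ht.1.le
  unfold Solution.quad
  linarith

end Controlled

lemma Solution.microSq_le (ξ : Solution N τ₀ η w) {α : Fin 4 → ℕ} (hα : order α ≤ N) (t : ℝ) :
    microSq (ξ.D α 0 t) ≤ ξ.micro t ^ 2 := by
  rw [ξ.micro_sq]
  exact Finset.single_le_sum (f := fun α => microSq (ξ.D α 0 t)) (fun _ _ => microSq_nonneg _)
    (mem_multiIndices.2 hα)

/-- Polynomials orthogonal to the kernel of the linearized operator. -/
def Poly.IsMicro (p : Poly) : Prop :=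
  ∀ k, (p.mul (ker k)).gauss = 0

instance (p : Poly) : Decidable p.IsMicro := by unfold Poly.IsMicro; infer_instance

lemma Poly.IsMicro.controlled {p : Poly} (hp : p.IsMicro) {α : Fin 4 → ℕ} (hα : order α ≤ N) :
    Controlled fun (ξ : Solution N τ₀ η w) t => ξ.mm p α t := by
  have hg : (0 : ℝ) ≤ (p.mul p).gauss := by
    exact_mod_cast gauss_mul_self_nonneg p
  refine ⟨√(p.mul p).gauss, Real.sqrt_nonneg _, fun ξ t ht => ?_⟩
  have h1 : ‖ξ.mm p α t‖ ≤ √(p.mul p).gauss * ξ.micro t := by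
    refine abs_le_of_sq_le_sq' ?_ (mul_nonneg (Real.sqrt_nonneg _) (ξ.micro_nonneg t)) |>.2
    rw [mul_pow, Real.sq_sqrt hg]
    exact (norm_sq_mom_le_microSq hp _).trans
      (mul_le_mul_of_nonneg_left (ξ.microSq_le hα t) hg)
  exact h1.trans (mul_le_mul_of_nonneg_left
    (by linarith [ξ.quad_nonneg ht.1.le]) (Real.sqrt_nonneg _))

namespace Poly

/-- Contraction with the tensor `3 (δ_ik δ_jl + δ_il δ_jk) - 2 δ_ij δ_kl` in `l`. -/
def contract (i j k : Fin 3) (q : Fin 3 → Poly) : Poly :=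
  smul (3 * kron i k) (q j) ++ smul (3 * kron j k) (q i) ++ smul (-2 * kron i j) (q k)

/-- The part of `5 v_k (3 v_i v_j - δ_ij |v|²)` that is a harmonic cubic. -/
def cubic (i j k : Fin 3) : Poly :=
  smul 5 ((X k).mul (chi i j)) ++ smul (-1) (contract i j k XSq)

/-- The part of `5 v_k (3 v_i v_j - δ_ij |v|²) |v|²` orthogonal to the kernel. -/
def quintic (i j k : Fin 3) : Poly :=
  smul 5 ((X k).mul (chiSq i j)) ++
    smul (-1) (contract i j k fun l => smul 14 (XSq l) ++ smul (-35) (X l))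

/-- The part of `|v|⁴` orthogonal to the kernel. -/
def quartic : Poly := sq.mul sq ++ smul (-10) sq ++ smul 15 one

lemma isMicro_chi (i j : Fin 3) : (chi i j).IsMicro := by revert i j; decide +kernel
lemma isMicro_chiSq (i j : Fin 3) : (chiSq i j).IsMicro := by revert i j; decide +kernel
-- The contraction with `v|v|²` is the part of `5 v_k χ_ij` that is not harmonic; what is left is a
-- harmonic cubic, orthogonal to everything in the kernel.
lemma isMicro_cubic (i j k : Fin 3) : (cubic i j k).IsMicro := by revert i j k; decide +kernel
-- The projection of `|v|⁴ v` onto the kernel is `35 v + 14 v(|v|² - 5) = 14 v|v|² - 35 v`, from the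
-- Gaussian means `5`, `35`, `315` of `v_l²` times `|v|²`, `|v|⁴`, `|v|⁶`.
lemma isMicro_quintic (i j k : Fin 3) : (quintic i j k).IsMicro := by
  revert i j k; decide +kernel
-- The projection of `|v|⁴` is `15 + 10(|v|² - 3) = 10|v|² - 15`.
lemma isMicro_quartic : quartic.IsMicro := by decide +kernel

end Poly

end

section

/-! ### Korn's inequality -/

/-- With `y i j = ∂_i u_j`, pairing the traceless symmetric gradient with the gradient and using
`hc` gives `3 ∑‖y‖² + (3 - 2)‖div u‖² ≤ s ∑‖y‖`. The right side is absorbed by Young's inequality.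
-/
lemma korn {y : Fin 3 → Fin 3 → Hx} {s : ℝ}
    (hc : ∀ i j, inner ℝ (y i j) (y j i) = inner ℝ (y j j) (y i i))
    (hs : ∀ i j, ‖(3 : ℝ) • y i j + (3 : ℝ) • y j i - (2 * kronR i j) • ∑ k, y k k‖ ≤ s)
    (i j : Fin 3) : ‖y i j‖ ≤ 2 * s := by
  set e := ∑ k, y k k with he
  have h1 : ∀ i j, 3 * ‖y i j‖ ^ 2 + 3 * inner ℝ (y i i) (y j j) - 2 * (kronR i j *
      inner ℝ e (y i j)) ≤ s * ‖y i j‖ := by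
    intro i j
    have h2 := (real_inner_le_norm ((3 : ℝ) • y i j + (3 : ℝ) • y j i - (2 * kronR i j) • e)
      (y i j)).trans (mul_le_mul_of_nonneg_right (hs i j) (norm_nonneg _))
    rw [inner_sub_left, inner_add_left, real_inner_smul_left, real_inner_smul_left,
      real_inner_smul_left, real_inner_self_eq_norm_sq, hc j i] at h2
    linarith
  have h3 := Finset.sum_le_sum (s := Finset.univ) fun i (_ : i ∈ Finset.univ) =>
    Finset.sum_le_sum (s := Finset.univ) fun j (_ : j ∈ Finset.univ) => h1 i j
  have h4 : ∑ i, ∑ j, inner ℝ (y i i) (y j j) = ‖e‖ ^ 2 := by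
    rw [← real_inner_self_eq_norm_sq, he, sum_inner]
    exact Finset.sum_congr rfl fun i _ => (inner_sum _ _ _).symm
  have h5 : ∑ i, ∑ j, kronR i j * inner ℝ e (y i j) = ‖e‖ ^ 2 := by
    calc _ = inner ℝ e (∑ k, y k k) := by
          rw [inner_sum]
          exact Finset.sum_congr rfl fun i _ => by simp [kronR, kron]
      _ = ‖e‖ ^ 2 := by rw [← he, real_inner_self_eq_norm_sq]
  simp only [Finset.sum_add_distrib, Finset.sum_sub_distrib, ← Finset.mul_sum, h4, h5] at h3
  -- Young's inequality with weights chosen to leave `∑‖y‖² ≤ 9s²/8` over the nine entries, well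
  -- below `(2s)²`.
  have h6 : ∑ i, ∑ j, (2 * ‖y i j‖ ^ 2 - s * ‖y i j‖ + s ^ 2 / 8) ≥ 0 :=
    Finset.sum_nonneg fun i _ => Finset.sum_nonneg fun j _ => by
      nlinarith [sq_nonneg (‖y i j‖ - s / 4)]
  simp only [Finset.sum_add_distrib, Finset.sum_sub_distrib, ← Finset.mul_sum, Finset.sum_const,
    Finset.card_univ, Fintype.card_fin, nsmul_eq_mul] at h6
  push_cast at h6
  have h7 : ‖y i j‖ ^ 2 ≤ ∑ i, ∑ j, ‖y i j‖ ^ 2 :=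
    (Finset.single_le_sum (f := fun j => ‖y i j‖ ^ 2) (fun _ _ => sq_nonneg _)
      (Finset.mem_univ j)).trans (Finset.single_le_sum (f := fun i => ∑ j, ‖y i j‖ ^ 2)
      (fun _ _ => Finset.sum_nonneg fun _ _ => sq_nonneg _) (Finset.mem_univ i))
  have hs0 : 0 ≤ s := (norm_nonneg _).trans (hs 0 0)
  refine abs_le_of_sq_le_sq' ?_ (by positivity) |>.2
  nlinarith [sq_nonneg ‖e‖, sq_nonneg s]

/-! ### Macroscopic estimates -/

variable {N : ℕ} {τ₀ η w : ℝ}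

namespace Solution

variable (ξ : Solution N τ₀ η w)

lemma mm_append (p q : Poly) (α : Fin 4 → ℕ) (t : ℝ) :
    ξ.mm (p ++ q) α t = ξ.mm p α t + ξ.mm q α t := mom_append _ _ _

lemma mm_smul (c : ℤ) (p : Poly) (α : Fin 4 → ℕ) (t : ℝ) :
    ξ.mm (Poly.smul c p) α t = (c : ℝ) • ξ.mm p α t := mom_smul _ _ _

lemma mm_congr {p q : Poly} (h : ∀ v, p.ev v = q.ev v) (α : Fin 4 → ℕ) (t : ℝ) :
    ξ.mm p α t = ξ.mm q α t := mom_congr h _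

/-- The sum of the spatial derivatives of the fluxes of a moment. -/
def flux (p : Poly) (γ : Fin 4 → ℕ) (t : ℝ) : Hx :=
  ∑ k : Fin 3, ξ.mm ((Poly.X k).mul p) (γ + Pi.single k.succ 1) t

/-- A multiple of the traceless symmetric gradient of three moments. -/
def strain (q : Fin 3 → Poly) (γ : Fin 4 → ℕ) (i j : Fin 3) (t : ℝ) : Hx :=
  (3 : ℝ) • ξ.mm (q j) (γ + Pi.single i.succ 1) t +
    (3 : ℝ) • ξ.mm (q i) (γ + Pi.single j.succ 1) t -
    (2 * kronR i j) • ∑ k : Fin 3, ξ.mm (q k) (γ + Pi.single k.succ 1) t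

end Solution

lemma order_add_single_le {γ : Fin 4 → ℕ} (hγ : order γ < N) (i : Fin 4) :
    order (γ + Pi.single i 1) ≤ N := by
  rw [order_add_single]; omega

section

variable {γ : Fin 4 → ℕ}

lemma controlled_transport_of_isInvariant (hN : 3 ≤ N) {p : Poly} (hp : p.IsInvariant)
    (hγ : order γ < N) : Controlled fun (ξ : Solution N τ₀ η w) t =>
      ξ.mm p (γ + Pi.single 0 1) t + ξ.flux p γ t := by
  obtain ⟨C, hC, h⟩ := exists_transport_le_of_isInvariant (τ₀ := τ₀) (η := η) (w := w) hN hp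
  refine (Controlled.of_quadratic (u := fun ξ t => ξ.transport p 0 γ t)
    ⟨C, hC, fun ξ t ht => h ξ γ hγ t ht⟩).congr fun ξ t => ?_
  simp [Solution.transport, Solution.flux]

/-- The time derivative and the damping term are moments of the same microscopic polynomial, so only
the flux is left in the equation. -/
lemma controlled_flux_of_relaxing {p : Poly} (hp : p.IsMicro)
    (h : ∃ C, 0 ≤ C ∧ ∀ (ξ : Solution N τ₀ η w), ∀ γ, order γ < N → ∀ t ∈ Ioo 0 ξ.T,
      ‖ξ.transport p (1 / τ₀) γ t‖ ≤ C * ξ.b t ^ 2) (hγ : order γ < N) :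
    Controlled fun (ξ : Solution N τ₀ η w) t => ξ.flux p γ t := by
  obtain ⟨C, hC, h⟩ := h
  refine (((Controlled.of_quadratic (u := fun ξ t => ξ.transport p (1 / τ₀) γ t)
    ⟨C, hC, fun ξ t ht => h ξ γ hγ t ht⟩).sub (hp.controlled (order_add_single_le hγ 0))).sub
    ((hp.controlled hγ.le).smul (1 / τ₀))).congr fun ξ t => ?_
  simp only [Solution.transport, Solution.flux]
  abel

/-- Five times the flux differs from the strain by moments of polynomials orthogonal to the kernel.
-/
lemma controlled_strain {p : Poly} {q : Fin 3 → Poly} {i j : Fin 3}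
    (hp : Controlled fun (ξ : Solution N τ₀ η w) t => ξ.flux p γ t)
    (hq : ∀ k, Poly.IsMicro
      (Poly.smul 5 ((Poly.X k).mul p) ++ Poly.smul (-1) (Poly.contract i j k q)))
    (hγ : order γ < N) : Controlled fun (ξ : Solution N τ₀ η w) t => ξ.strain q γ i j t := by
  refine ((hp.smul 5).sub (Controlled.sum fun k =>
    (hq k).controlled (order_add_single_le hγ k.succ))).congr fun ξ t => ?_
  simp only [Solution.strain, Solution.flux, Solution.mm_append, Solution.mm_smul, Poly.contract,
    Fin.sum_univ_three, kronR]
  fin_cases i <;> fin_cases j <;> simp [kron] <;> module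

lemma controlled_grad_of_strain {q : Fin 3 → Poly} (hγ : order γ < N)
    (h : ∀ i j, Controlled fun (ξ : Solution N τ₀ η w) t => ξ.strain q γ i j t) (i j : Fin 3) :
    Controlled fun (ξ : Solution N τ₀ η w) t => ξ.mm (q j) (γ + Pi.single i.succ 1) t := by
  choose C hC hb using h
  -- Korn's inequality wants one bound `s` for all entries; the sum of the constants provides it.
  refine ⟨2 * ∑ i, ∑ j, C i j, mul_nonneg zero_le_two (Finset.sum_nonneg fun _ _ =>
    Finset.sum_nonneg fun _ _ => hC _ _), fun ξ t ht => ?_⟩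
  have ht' := Ioo_subset_Ico_self ht
  have hd := fun (i j : Fin 3) => ξ.isDerivX_mm (q j) hγ ht' i
  rw [mul_assoc]
  refine korn (y := fun i j => ξ.mm (q j) (γ + Pi.single i.succ 1) t)
    (fun i j => inner_derivX_comm (hd i j) (hd j j) (hd i i) (hd j i)) (fun i j => ?_) i j
  refine (hb i j ξ t ht).trans (mul_le_mul_of_nonneg_right ?_ (ξ.sum_nonneg ht))
  exact (Finset.single_le_sum (f := fun j => C i j) (fun _ _ => hC _ _)
    (Finset.mem_univ j)).trans (Finset.single_le_sum (f := fun i => ∑ j, C i j)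
    (fun _ _ => Finset.sum_nonneg fun _ _ => hC _ _) (Finset.mem_univ i))

lemma controlled_grad_XSq (hN : 3 ≤ N) (hγ : order γ < N) (i j : Fin 3) :
    Controlled fun (ξ : Solution N τ₀ η w) t => ξ.mm (Poly.XSq j) (γ + Pi.single i.succ 1) t :=
  controlled_grad_of_strain hγ (fun i j => controlled_strain (controlled_flux_of_relaxing
    (Poly.isMicro_chi i j) (exists_transport_chi_le hN i j) hγ)
    (fun k => Poly.isMicro_cubic i j k) hγ) i j

/-- The equation for `χ|v|²` controls the gradient of `14 v|v|² - 35 v`, and that of `v|v|²` is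
already known. The coefficient `-35` is what makes `v` accessible. -/
lemma controlled_grad_X (hN : 3 ≤ N) (hγ : order γ < N) (i j : Fin 3) :
    Controlled fun (ξ : Solution N τ₀ η w) t => ξ.mm (Poly.X j) (γ + Pi.single i.succ 1) t := by
  have h := controlled_grad_of_strain (τ₀ := τ₀) (η := η) (w := w) hγ (fun i j =>
    controlled_strain (controlled_flux_of_relaxing (Poly.isMicro_chiSq i j)
    (exists_transport_chiSq_le hN i j) hγ) (fun k => Poly.isMicro_quintic i j k) hγ) i j
  refine Controlled.of_smul (c := 35) (by norm_num)
    ((((controlled_grad_XSq hN hγ i j).smul 14).sub h).congr fun ξ t => ?_)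
  simp only [Solution.mm_append, Solution.mm_smul]
  push_cast
  module

lemma controlled_time_one (hN : 3 ≤ N) (hγ : order γ < N) :
    Controlled fun (ξ : Solution N τ₀ η w) t => ξ.mm Poly.one (γ + Pi.single 0 1) t := by
  refine ((controlled_transport_of_isInvariant hN .one hγ).sub (Controlled.sum fun k =>
    controlled_grad_X hN hγ k k)).congr fun ξ t => ?_
  have e : ∀ k α, ξ.mm ((Poly.X k).mul Poly.one) α t = ξ.mm (Poly.X k) α t := fun k α =>
    ξ.mm_congr (fun v => by simp) α t
  simp only [Solution.flux, e, add_sub_cancel_right]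

lemma controlled_time_sq (hN : 3 ≤ N) (hγ : order γ < N) :
    Controlled fun (ξ : Solution N τ₀ η w) t => ξ.mm Poly.sq (γ + Pi.single 0 1) t :=
  ((controlled_transport_of_isInvariant hN .sq hγ).sub (Controlled.sum fun k =>
    controlled_grad_XSq hN hγ k k)).congr fun _ _ => add_sub_cancel_right _ _

/-- The flux is `3 v_i v_k = χ_ik + δ_ik |v|²`, whose first part is microscopic. -/
lemma controlled_momentum (hN : 3 ≤ N) (hγ : order γ < N) (i : Fin 3) :
    Controlled fun (ξ : Solution N τ₀ η w) t => (3 : ℝ) • ξ.mm (Poly.X i) (γ + Pi.single 0 1) t +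
      ξ.mm Poly.sq (γ + Pi.single i.succ 1) t := by
  refine (((controlled_transport_of_isInvariant hN (.X i) hγ).smul 3).sub
    (Controlled.sum fun k => (Poly.isMicro_chi i k).controlled
      (order_add_single_le hγ k.succ))).congr fun ξ t => ?_
  have e : ∀ k α, ξ.mm ((Poly.X k).mul (Poly.X i)) α t = ξ.mm (Poly.X2 i k) α t := fun k α =>
    ξ.mm_congr (fun v => by simp [Poly.X2, mul_comm]) α t
  simp only [Solution.flux, e, Poly.chi, Solution.mm_append, Solution.mm_smul,
    Fin.sum_univ_three]
  fin_cases i <;> simp [kron] <;> module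

/-- The flux is `3 v_i v_k |v|² = χ_ik |v|² + δ_ik |v|⁴`, and modulo microscopic terms `|v|⁴` is
`10|v|² - 15`. -/
lemma controlled_energyFlux (hN : 3 ≤ N) (hγ : order γ < N) (i : Fin 3) :
    Controlled fun (ξ : Solution N τ₀ η w) t =>
      (3 : ℝ) • ξ.mm (Poly.XSq i) (γ + Pi.single 0 1) t +
        ((10 : ℝ) • ξ.mm Poly.sq (γ + Pi.single i.succ 1) t -
        (15 : ℝ) • ξ.mm Poly.one (γ + Pi.single i.succ 1) t) := by
  refine ((((controlled_transport_of_isInvariant hN (.XSq i) hγ).smul 3).sub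
    (Controlled.sum fun k => (Poly.isMicro_chiSq i k).controlled
      (order_add_single_le hγ k.succ))).sub (Poly.isMicro_quartic.controlled
      (order_add_single_le hγ i.succ))).congr fun ξ t => ?_
  have e : ∀ k α, (3 : ℝ) • ξ.mm ((Poly.X k).mul (Poly.XSq i)) α t =
      ξ.mm (Poly.chiSq i k) α t + (kron i k : ℝ) • ξ.mm (Poly.sq.mul Poly.sq) α t := by
    intro k α
    rw [← ξ.mm_smul (kron i k), ← ξ.mm_append, show (3 : ℝ) = ((3 : ℤ) : ℝ) by norm_num,
      ← ξ.mm_smul]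
    refine ξ.mm_congr (fun v => ?_) α t
    simp [Poly.chiSq, Poly.chi, Poly.X2, Poly.XSq]
    ring
  simp only [Solution.flux, smul_add, e, Poly.quartic, Solution.mm_append,
    Solution.mm_smul, Fin.sum_univ_three]
  fin_cases i <;> simp [kron] <;> module

/-- Without a bound on the time derivative of the momentum, the momentum equation gives no first
derivative of `|v|²`. After one spatial derivative the time derivative falls on a controlled
gradient. -/
lemma controlled_hessian_sq (hN : 3 ≤ N) (hγ : order γ + 1 < N) (i j : Fin 3) :
    Controlled fun (ξ : Solution N τ₀ η w) t =>
      ξ.mm Poly.sq (γ + Pi.single j.succ 1 + Pi.single i.succ 1) t := by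
  have h1 : Controlled fun (ξ : Solution N τ₀ η w) t =>
      ξ.mm (Poly.X i) (γ + Pi.single j.succ 1 + Pi.single 0 1) t := by
    rw [add_right_comm]
    exact controlled_grad_X hN (by rw [order_add_single]; exact hγ) j i
  exact ((controlled_momentum hN (by rw [order_add_single]; exact hγ) i).sub
    (h1.smul 3)).congr fun ξ t => add_sub_cancel_left _ _

lemma controlled_hessian_one (hN : 3 ≤ N) (hγ : order γ + 1 < N) (i j : Fin 3) :
    Controlled fun (ξ : Solution N τ₀ η w) t =>
      ξ.mm Poly.one (γ + Pi.single j.succ 1 + Pi.single i.succ 1) t := by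
  have h1 : Controlled fun (ξ : Solution N τ₀ η w) t =>
      ξ.mm (Poly.XSq i) (γ + Pi.single j.succ 1 + Pi.single 0 1) t := by
    rw [add_right_comm]
    exact controlled_grad_XSq hN (by rw [order_add_single]; exact hγ) j i
  refine Controlled.of_smul (c := 15) (by norm_num) ((((controlled_hessian_sq hN hγ i j).smul
    10).add (h1.smul 3)).sub (controlled_energyFlux hN (γ := γ + Pi.single j.succ 1)
      (by rw [order_add_single]; exact hγ) i) |>.congr fun ξ t => ?_)
  module

end

lemma controlled_of_mean {p : Poly} {γ : Fin 4 → ℕ} (hγ : order γ < N)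
    (hm : ∃ C, 0 ≤ C ∧ ∀ (ξ : Solution N τ₀ η w), ∀ t ∈ Ioo 0 ξ.T,
      |∫ x, ξ.mm p γ t x| ≤ C * (ξ.micro t + ξ.quad t))
    (h : ∀ i : Fin 3, Controlled fun (ξ : Solution N τ₀ η w) t =>
      ξ.mm p (γ + Pi.single i.succ 1) t) :
    Controlled fun (ξ : Solution N τ₀ η w) t => ξ.mm p γ t := by
  obtain ⟨C, hC, hm⟩ := hm
  choose K hK hb using h
  refine ⟨C + ∑ i, K i, add_nonneg hC (Finset.sum_nonneg fun i _ => hK i), fun ξ t ht => ?_⟩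
  have h0 := ξ.sum_nonneg ht
  have h1 := poincare fun i => ξ.isDerivX_mm p hγ (Ioo_subset_Ico_self ht) i
  have h2 : (∫ x, ξ.mm p γ t x) ^ 2 ≤ (C * (ξ.micro t + ξ.quad t)) ^ 2 :=
    sq_le_sq.2 ((hm ξ t ht).trans (le_abs_self _))
  have h3 : ∀ i : Fin 3, ‖ξ.mm p (γ + Pi.single i.succ 1) t‖ ^ 2 ≤
      (K i * (ξ.micro t + ξ.quad t)) ^ 2 := fun i =>
    pow_le_pow_left₀ (norm_nonneg _) (hb i ξ t ht) 2
  have n1 := mul_nonneg hC h0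
  have n2 := fun i => mul_nonneg (hK i) h0
  refine abs_le_of_sq_le_sq' (h1.trans ?_) (mul_nonneg (add_nonneg hC
    (Finset.sum_nonneg fun i _ => hK i)) h0) |>.2
  -- A sum of squares of nonnegative numbers is at most the square of their sum.
  rw [Fin.sum_univ_three] at h1 ⊢
  rw [Fin.sum_univ_three]
  nlinarith [h3 0, h3 1, h3 2, mul_nonneg n1 (n2 0), mul_nonneg n1 (n2 1), mul_nonneg n1 (n2 2),
    mul_nonneg (n2 0) (n2 1), mul_nonneg (n2 0) (n2 2), mul_nonneg (n2 1) (n2 2)]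

/-- Estimates of nontrivial derivatives from those of time derivatives and of second spatial
derivatives. -/
lemma controlled_of_time_of_hessian (hN : 3 ≤ N) {p : Poly}
    (ht : ∀ γ, order γ < N → Controlled fun (ξ : Solution N τ₀ η w) t =>
      ξ.mm p (γ + Pi.single 0 1) t)
    (hh : ∀ γ (i j : Fin 3), order γ + 1 < N → Controlled fun (ξ : Solution N τ₀ η w) t =>
      ξ.mm p (γ + Pi.single j.succ 1 + Pi.single i.succ 1) t)
    {α : Fin 4 → ℕ} (hα : order α ≤ N) (h0 : α ≠ 0) :
    Controlled fun (ξ : Solution N τ₀ η w) t => ξ.mm p α t := by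
  obtain ⟨γ, i, rfl⟩ := exists_eq_add_single h0
  rw [order_add_single] at hα
  induction i using Fin.cases with
  | zero => exact ht γ hα
  | succ i =>
    by_cases hγ : γ = 0
    · subst hγ
      -- A single spatial derivative is out of reach of the Hessian bounds, but it has mean zero, so
      -- Poincaré's inequality recovers it from them.
      refine controlled_of_mean (by rw [order_add_single, order_zero]; omega)
        ⟨0, le_rfl, fun ξ t ht => ?_⟩
        fun j => hh 0 j i (by rw [order_zero]; omega)
      rw [(ξ.isDerivX_mm p hα (Ioo_subset_Ico_self ht) i).integral_eq_zero]
      simp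
    · obtain ⟨β, j, rfl⟩ := exists_eq_add_single hγ
      rw [order_add_single] at hα
      induction j using Fin.cases with
      | zero =>
        rw [add_right_comm]
        exact ht _ (by rw [order_add_single]; omega)
      | succ j => exact hh β i j (by omega)

/-- The moments whose derivatives span the macroscopic part. -/
lemma controlled_of_ne_zero (hN : 3 ≤ N) {p : Poly} (hp : p.IsInvariant) {α : Fin 4 → ℕ}
    (hα : order α ≤ N) (h0 : α ≠ 0) :
    Controlled fun (ξ : Solution N τ₀ η w) t => ξ.mm p α t := by
  have hone : ∀ {α : Fin 4 → ℕ}, order α ≤ N → α ≠ 0 →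
      Controlled fun (ξ : Solution N τ₀ η w) t => ξ.mm Poly.one α t := fun hα h0 =>
    controlled_of_time_of_hessian hN (fun γ hγ => controlled_time_one hN hγ)
      (fun γ i j hγ => controlled_hessian_one hN hγ i j) hα h0
  have hsq : ∀ {α : Fin 4 → ℕ}, order α ≤ N → α ≠ 0 →
      Controlled fun (ξ : Solution N τ₀ η w) t => ξ.mm Poly.sq α t := fun hα h0 =>
    controlled_of_time_of_hessian hN (fun γ hγ => controlled_time_sq hN hγ)
      (fun γ i j hγ => controlled_hessian_sq hN hγ i j) hα h0
  have hne : ∀ (γ : Fin 4 → ℕ) (i : Fin 4), γ + Pi.single i 1 ≠ 0 := fun γ i h => by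
    have := congrArg order h
    rw [order_add_single, order_zero] at this
    omega
  cases hp with
  | one => exact hone hα h0
  | sq => exact hsq hα h0
  | X j =>
    obtain ⟨γ, i, rfl⟩ := exists_eq_add_single h0
    have hγ : order γ < N := by rw [order_add_single] at hα; exact hα
    induction i using Fin.cases with
    | zero =>
      exact Controlled.of_smul (c := 3) (by norm_num) (((controlled_momentum hN hγ j).sub
        (hsq (order_add_single_le hγ _) (hne γ j.succ))).congr fun ξ t =>
          add_sub_cancel_right _ _)
    | succ i => exact controlled_grad_X hN hγ i j
  | XSq j =>
    obtain ⟨γ, i, rfl⟩ := exists_eq_add_single h0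
    have hγ : order γ < N := by rw [order_add_single] at hα; exact hα
    induction i using Fin.cases with
    | zero =>
      exact Controlled.of_smul (c := 3) (by norm_num) (((controlled_energyFlux hN hγ j).sub
        (((hsq (order_add_single_le hγ _) (hne γ j.succ)).smul 10).sub
        ((hone (order_add_single_le hγ _) (hne γ j.succ)).smul 15))).congr fun ξ t =>
          add_sub_cancel_right _ _)
    | succ i => exact controlled_grad_XSq hN hγ i j

end

section

/-! ### Conservation laws -/

lemma integral_density_mul (f : L2) (p : Poly) :
    ∫ q : Phase, density f q * p.ev q.2 = p.gauss + ∫ x, mom p f x := by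
  have e : ∀ q : Phase, density f q * p.ev q.2 =
      p.ev q.2 * maxwellian q.2 + f q * weight p q.2 := fun q => by
    simp only [density, weight]
    ring
  have h1 : Integrable (fun q : Torus × Vel => p.ev q.2 * maxwellian q.2)
      ((volume : Measure Torus).prod volume) := (integrable_ev_mul_maxwellian p).comp_snd _
  have h2 : MemLp (fun q : Torus × Vel => weight p q.2) 2
      ((volume : Measure Torus).prod volume) := (memLp_weight p).comp_snd _
  have h3 : MemLp (fun q : Torus × Vel => f q) 2 ((volume : Measure Torus).prod volume) := by
    rw [← Measure.volume_eq_prod]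
    exact Lp.memLp f
  have h4 := h3.integrable_mul h2
  simp only [e, Measure.volume_eq_prod]
  refine (integral_add h1 h4).trans ?_
  congr 1
  · rw [integral_prod _ h1]
    simp [integral_ev_mul_maxwellian]
  · refine (integral_prod _ h4).trans (integral_congr_ae ?_)
    filter_upwards [coeFn_mom p f] with x hx
    rw [hx]
    rfl

lemma norm_coef_le (n : Fin 3 → ℤ) (u : Hx) : ‖coef n u‖ ≤ ‖u‖ := by
  refine abs_le_of_sq_le_sq' ?_ (norm_nonneg _) |>.2
  exact le_hasSum (hasSum_coef_sq u) n fun _ _ => sq_nonneg _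

variable {N : ℕ} {τ₀ η w : ℝ}

namespace Solution

variable (ξ : Solution N τ₀ η w)

lemma continuousOn_sq : ContinuousOn (fun t => ξ.b t ^ 2) (Ico 0 ξ.T) := by
  simp only [b, bnd_sq]
  exact continuousOn_finsetSum _ fun α hα => ξ.sol.derivatives.continuousOn_sq
    (by simpa [order_zero] using mem_multiIndices.1 hα)

lemma intervalIntegrable_sq {t : ℝ} (ht : t ∈ Ico 0 ξ.T) :
    IntervalIntegrable (fun t => ξ.b t ^ 2) volume 0 t := by
  refine ContinuousOn.intervalIntegrable ?_
  rw [uIcc_of_le ht.1]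
  exact ξ.continuousOn_sq.mono fun s hs => ⟨hs.1, hs.2.trans_lt ht.2⟩

lemma continuousOn_mm (p : Poly) {α : Fin 4 → ℕ} (hα : order α ≤ N) :
    ContinuousOn (ξ.mm p α) (Ico 0 ξ.T) :=
  (mom p).continuous.comp_continuousOn
    (ξ.sol.derivatives.continuousOn α 0 (by simpa [order_zero] using hα))

/-- The fluxes are spatial derivatives and integrate to zero, so the mean evolves through the
collision term alone. -/
lemma coef_zero_mm_time (hN : 3 ≤ N) (p : Poly) {t : ℝ} (ht : t ∈ Ioo 0 ξ.T) :
    coef 0 (ξ.mm p (0 + Pi.single 0 1) t) = coef 0 (ξ.transport p 0 0 t) := by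
  have h : ∀ k : Fin 3, coef 0 (ξ.mm ((Poly.X k).mul p) (0 + Pi.single k.succ 1) t) = 0 :=
    fun k => (ξ.isDerivX_mm _ (by rw [order_zero]; omega) (Ioo_subset_Ico_self ht)
      k).coef_zero_eq
  rw [transport, map_add, map_add, map_sum]
  simp only [h]
  simp

/-- Integrating the quadratic rate of change of the mean in time is what brings `∫₀ᵗ b²` into the
error. -/
lemma norm_coef_zero_sub_le (hN : 3 ≤ N) {p : Poly} {C : ℝ}
    (h : ∀ t ∈ Ioo 0 ξ.T, ‖ξ.transport p 0 0 t‖ ≤ C * ξ.b t ^ 2) {t : ℝ} (ht : t ∈ Ioo 0 ξ.T) :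
    ‖coef 0 (ξ.mm p 0 t) - coef 0 (ξ.mm p 0 0)‖ ≤ C * ∫ s in (0 : ℝ)..t, ξ.b s ^ 2 := by
  have hsub : Icc 0 t ⊆ Ico 0 ξ.T := fun s hs => ⟨hs.1, hs.2.trans_lt ht.2⟩
  have hsub' : Ioo 0 t ⊆ Ioo 0 ξ.T := Ioo_subset_Ioo_right ht.2.le
  have o1 : order (0 + Pi.single 0 1 : Fin 4 → ℕ) ≤ N := by
    rw [order_add_single, order_zero]; omega
  have hi : IntervalIntegrable (fun s => coef 0 (ξ.mm p (0 + Pi.single 0 1) s)) volume 0 t := by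
    refine ContinuousOn.intervalIntegrable ?_
    rw [uIcc_of_le ht.1.le]
    exact (coef 0).continuous.comp_continuousOn ((ξ.continuousOn_mm p o1).mono hsub)
  have hF := intervalIntegral.integral_eq_sub_of_hasDerivAt_of_le (f := fun s => coef 0 (ξ.mm p 0 s))
    ht.1.le ((coef 0).continuous.comp_continuousOn
      ((ξ.continuousOn_mm p (by rw [order_zero]; omega)).mono hsub))
    (fun s hs => (coef 0).hasFDerivAt.comp_hasDerivAt s
      (ξ.hasDerivAt_mm p (by rw [order_zero]; omega) (hsub' hs))) hi
  beta_reduce at hF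
  rw [← hF, ← intervalIntegral.integral_const_mul]
  refine intervalIntegral.norm_integral_le_of_norm_le ht.1.le (Eventually.of_forall fun s hs => ?_)
    ((ξ.intervalIntegrable_sq (Ioo_subset_Ico_self ht)).const_mul C)
  have hs' : s ∈ Ioo 0 ξ.T := ⟨hs.1, hs.2.trans_lt ht.2⟩
  rw [ξ.coef_zero_mm_time hN p hs']
  exact (norm_coef_le _ _).trans (h s hs')

/-- The hypotheses on total mass, momentum, energy and third moment enter here. The third moment of
the Maxwellian is zero, so its vanishing for `F₀` is the same kind of condition as the other three.
-/
lemma integral_mm_zero (hT : 0 < ξ.T) {p : Poly} (hp : p.IsInvariant) :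
    ∫ x, ξ.mm p 0 0 x = 0 := by
  have hz := ξ.sol.derivatives.zero 0 ⟨le_rfl, hT⟩
  have hm : ∀ q : Poly, ∫ p : Phase, maxwellian p.2 * q.ev p.2 = q.gauss := by
    intro q
    have h := integral_fun_snd (μ := (volume : Measure Torus)) (ν := (volume : Measure Vel))
      fun v => maxwellian v * q.ev v
    rw [← Measure.volume_eq_prod] at h
    rw [h]
    simp only [mul_comm (maxwellian _)]
    simp [integral_ev_mul_maxwellian]
  have key : ∀ q : Poly, (∫ p : Phase, density (ξ.f 0) p * q.ev p.2 = q.gauss) →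
      ∫ x, ξ.mm q 0 0 x = 0 := by
    intro q hq
    rw [integral_density_mul, add_eq_left] at hq
    rw [mm, hz]
    exact hq
  refine key p ?_
  cases hp with
  | one =>
    rw [← hm]
    simpa using ξ.same.mass
  | X i =>
    rw [← hm]
    simpa using ξ.same.momentum i
  | sq =>
    rw [← hm]
    simpa using ξ.same.energy
  | XSq i =>
    rw [Poly.gauss_XSq, Int.cast_zero]
    simpa [Poly.XSq] using ξ.third i

end Solution

/-! ### Coercivity -/

lemma controlled_of_isInvariant (hN : 3 ≤ N) {p : Poly} (hp : p.IsInvariant) {α : Fin 4 → ℕ}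
    (hα : order α ≤ N) : Controlled fun (ξ : Solution N τ₀ η w) t => ξ.mm p α t := by
  by_cases h0 : α = 0
  · subst h0
    obtain ⟨C, hC, h⟩ := exists_transport_le_of_isInvariant (τ₀ := τ₀) (η := η) (w := w) hN hp
    have o0 : order (0 : Fin 4 → ℕ) < N := by rw [order_zero]; omega
    refine controlled_of_mean o0 ⟨C, hC, fun ξ t ht => ?_⟩ fun i =>
      controlled_of_ne_zero hN hp (order_add_single_le o0 _) fun h => by
        have := congrArg order h
        rw [order_add_single, order_zero] at this
        omega
    have h1 := ξ.norm_coef_zero_sub_le hN (fun t ht => h ξ 0 o0 t ht) ht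
    rw [coef_zero (ξ.mm p 0 0), ξ.integral_mm_zero (ht.1.trans ht.2) hp, Complex.ofReal_zero,
      sub_zero, coef_zero, Complex.norm_real, Real.norm_eq_abs] at h1
    refine h1.trans (mul_le_mul_of_nonneg_left ?_ hC)
    have h2 := ξ.micro_nonneg t
    have h3 := sq_nonneg (ξ.b t)
    unfold Solution.quad
    linarith
  · exact controlled_of_ne_zero hN hp hα h0

lemma controlled_ker (hN : 3 ≤ N) (k : Fin 8) {α : Fin 4 → ℕ} (hα : order α ≤ N) :
    Controlled fun (ξ : Solution N τ₀ η w) t => ξ.mm (ker k) α t := by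
  have hX := fun i : Fin 3 =>
    controlled_of_isInvariant (τ₀ := τ₀) (η := η) (w := w) hN (.X i) hα
  have hheat : ∀ i : Fin 3, Controlled fun (ξ : Solution N τ₀ η w) t => ξ.mm (Poly.heat i) α t :=
    fun i => by
      refine ((controlled_of_isInvariant hN (.XSq i) hα).sub ((hX i).smul 5)).congr fun ξ t => ?_
      have e : ξ.mm (Poly.heat i) α t = ξ.mm (Poly.XSq i ++ Poly.smul (-5) (Poly.X i)) α t :=
        ξ.mm_congr (fun v => by simp [Poly.heat, Poly.XSq]; ring) α t
      rw [e, ξ.mm_append, ξ.mm_smul]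
      push_cast
      module
  have hone := controlled_of_isInvariant (τ₀ := τ₀) (η := η) (w := w) hN .one hα
  have hsq : Controlled fun (ξ : Solution N τ₀ η w) t =>
      ξ.mm (Poly.sq ++ Poly.smul (-3) Poly.one) α t := by
    refine ((controlled_of_isInvariant hN .sq hα).sub (hone.smul 3)).congr fun ξ t => ?_
    rw [ξ.mm_append, ξ.mm_smul]
    push_cast
    module
  fin_cases k
  exacts [hone, hX 0, hX 1, hX 2, hsq, hheat 0, hheat 1, hheat 2]

lemma exists_sq_le (hN : 3 ≤ N) : ∃ K : ℝ, 1 ≤ K ∧ ∀ (ξ : Solution N τ₀ η w),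
    ∀ t ∈ Ioo 0 ξ.T, ξ.b t ^ 2 ≤ K * (ξ.micro t ^ 2 + ξ.quad t ^ 2) := by
  have h : ∀ (α : Fin 4 → ℕ) (k : Fin 8), ∃ C, 0 ≤ C ∧ (order α ≤ N →
      ∀ (ξ : Solution N τ₀ η w), ∀ t ∈ Ioo 0 ξ.T,
        ‖ξ.mm (ker k) α t‖ ≤ C * (ξ.micro t + ξ.quad t)) := by
    intro α k
    by_cases hα : order α ≤ N
    -- A constant is selected for every multi-index so that `choose` yields a total function; beyond
    -- order `N` it is `0` and never used.
    · obtain ⟨C, hC, h⟩ := controlled_ker (τ₀ := τ₀) (η := η) (w := w) hN k hα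
      exact ⟨C, hC, fun _ => h⟩
    · exact ⟨0, le_rfl, fun h => absurd h hα⟩
  choose C hC hb using h
  set S := ∑ α ∈ multiIndices 4 N, ∑ k, C α k ^ 2 with hS
  have hS0 : 0 ≤ S := Finset.sum_nonneg fun _ _ => Finset.sum_nonneg fun _ _ => sq_nonneg _
  -- The `1` accounts for the microscopic part, and `2 * S` for the kernel components after `(a +
  -- b)² ≤ 2(a² + b²)`.
  refine ⟨1 + 2 * S, by linarith, fun ξ t ht => ?_⟩
  have h1 : ∀ α ∈ multiIndices 4 N, ‖ξ.D α 0 t‖ ^ 2 ≤ microSq (ξ.D α 0 t) +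
      (∑ k, C α k ^ 2) * (ξ.micro t + ξ.quad t) ^ 2 := by
    intro α hα
    rw [Finset.sum_mul]
    have h2 : ∑ k, ‖mom (ker k) (ξ.D α 0 t)‖ ^ 2 / kerNorm k ≤
        ∑ k, C α k ^ 2 * (ξ.micro t + ξ.quad t) ^ 2 := by
      refine Finset.sum_le_sum fun k _ => ?_
      have h3 : (1 : ℝ) ≤ kerNorm k := by exact_mod_cast kerNorm_pos k
      refine (div_le_self (sq_nonneg _) h3).trans ?_
      rw [← mul_pow]
      exact pow_le_pow_left₀ (norm_nonneg _) (hb α k (mem_multiIndices.1 hα) ξ t ht) 2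
    unfold microSq
    linarith
  have h4 := Finset.sum_le_sum h1
  rw [Finset.sum_add_distrib, ← ξ.micro_sq, ← Finset.sum_mul, ← hS] at h4
  rw [Solution.b, bnd_sq]
  refine h4.trans ?_
  have h5 : (ξ.micro t + ξ.quad t) ^ 2 ≤ 2 * (ξ.micro t ^ 2 + ξ.quad t ^ 2) := by
    nlinarith [sq_nonneg (ξ.micro t - ξ.quad t)]
  have h6 := mul_le_mul_of_nonneg_left h5 hS0
  nlinarith [sq_nonneg (ξ.quad t)]

lemma continuous_microSq : Continuous microSq := by
  unfold microSq
  fun_prop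

/-- The moment estimates hold on the open interval only; both sides are continuous from the right at
`0`. -/
lemma Solution.sq_le_at_zero (ξ : Solution N τ₀ η w) (hT : 0 < ξ.T) {K : ℝ} (hK : 0 ≤ K)
    (h : ∀ t ∈ Ioo 0 ξ.T, ξ.b t ^ 2 ≤ K * (ξ.micro t ^ 2 + ξ.quad t ^ 2)) :
    ξ.b 0 ^ 2 ≤ K * (ξ.micro 0 ^ 2 + ξ.quad 0 ^ 2) := by
  have h0 : (0 : ℝ) ∈ Ico 0 ξ.T := ⟨le_rfl, hT⟩
  have hl : 𝓝[Ioo 0 ξ.T] (0 : ℝ) ≤ 𝓝[Ico 0 ξ.T] 0 := nhdsWithin_mono _ Ioo_subset_Ico_self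
  have hb : Tendsto (fun t => ξ.b t ^ 2) (𝓝[Ioo 0 ξ.T] 0) (𝓝 (ξ.b 0 ^ 2)) :=
    (ξ.continuousOn_sq 0 h0).mono_left hl
  have hm : Tendsto (fun t => ξ.micro t ^ 2) (𝓝[Ioo 0 ξ.T] 0) (𝓝 (ξ.micro 0 ^ 2)) := by
    simp only [ξ.micro_sq]
    refine tendsto_finsetSum _ fun α hα => ?_
    exact (continuous_microSq.tendsto _).comp ((ξ.sol.derivatives.continuousOn α 0
      (by simpa [order_zero] using mem_multiIndices.1 hα) 0 h0).mono_left hl)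
  have hs : Tendsto (fun t : ℝ => t) (𝓝[Ioo 0 ξ.T] 0) (𝓝 0) := tendsto_id.mono_left inf_le_left
  have hr : Tendsto (fun t => K * (ξ.micro t ^ 2 + (ξ.b t ^ 2 + t) ^ 2)) (𝓝[Ioo 0 ξ.T] 0)
      (𝓝 (K * (ξ.micro 0 ^ 2 + (ξ.b 0 ^ 2 + 0) ^ 2))) :=
    (hm.add ((hb.add hs).pow 2)).const_mul K
  have hne : (𝓝[Ioo 0 ξ.T] (0 : ℝ)).NeBot := left_nhdsWithin_Ioo_neBot hT
  -- Instead of the continuity of the integral in `quad`, the bound `∫₀ᵗ b² ≤ t`, from `b ≤ 1`, is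
  -- used.
  have key := le_of_tendsto_of_tendsto hb hr (by
    filter_upwards [self_mem_nhdsWithin] with t ht
    refine (h t ht).trans (mul_le_mul_of_nonneg_left (add_le_add le_rfl ?_) hK)
    have ht' := Ioo_subset_Ico_self ht
    refine pow_le_pow_left₀ (ξ.quad_nonneg ht.1.le) (add_le_add le_rfl ?_) 2
    have h1 := intervalIntegral.integral_mono_on ht.1.le (ξ.intervalIntegrable_sq ht')
      (intervalIntegrable_const (c := (1 : ℝ))) fun s hs =>
        pow_le_one₀ (ξ.b_nonneg s) (ξ.b_le_one ⟨hs.1, hs.2.trans_lt ht.2⟩)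
    simpa using h1)
  simpa [Solution.quad] using key

end

end Shakhov

end

/-! ### The coercivity estimate. -/

theorem theorem5p1 (N : ℕ) (hN : 3 ≤ N) (τ₀ η w : ℝ) (hτ₀ : 0 < τ₀) (hη : 0 ≤ η) :
    ∃ M₀ > (0 : ℝ), ∃ δ > (0 : ℝ), ∃ C > (0 : ℝ),
      ∀ (T : ℝ) (_ : 0 < T) (f : ℝ → Shakhov.L2)
        (D : (Fin 4 → ℕ) → (Fin 3 → ℕ) → ℝ → Shakhov.L2),
        Shakhov.IsSolution 0 τ₀ η w N T f D →
        (∀ t ∈ Set.Ico 0 T, Shakhov.energy N D t ≤ M₀) →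
        (∀ᵐ p : Shakhov.Phase, 0 ≤ Shakhov.density (f 0) p) →
        Shakhov.SameConserved (f 0) →
        (∀ i : Fin 3,
          ∫ p : Shakhov.Phase, Shakhov.density (f 0) p * (p.2 i * ‖p.2‖ ^ 2) = 0) →
        ∀ t ∈ Set.Ico 0 T,
          ∑ α ∈ Shakhov.multiIndices 4 N,
              ∫ p : Shakhov.Phase, Shakhov.linearOp 0 (D α 0 t) p * D α 0 t p ≤
            -δ * ∑ α ∈ Shakhov.multiIndices 4 N, ‖D α 0 t‖ ^ 2 +
              C * Shakhov.energy N D t ^ 2 := by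
  obtain ⟨K, hK, h⟩ := Shakhov.exists_sq_le (τ₀ := τ₀) (η := η) (w := w) hN
  have hK0 : 0 < K := by linarith
  -- With `b² ≤ K (micro² + quad²)` the rate is `δ = K⁻¹`, and `quad ≤ 2𝓔` makes the error constant
  -- `4`.
  refine ⟨Shakhov.smallNorm ^ 2 / 2, by have := Shakhov.smallNorm_pos; positivity, K⁻¹,
    inv_pos.2 hK0, 4, by norm_num, fun T hT f D sol small _ same third t ht => ?_⟩
  let ξ : Shakhov.Solution N τ₀ η w := ⟨T, f, D, sol, small, same, third⟩
  have h1 : ξ.b t ^ 2 ≤ K * (ξ.micro t ^ 2 + ξ.quad t ^ 2) := by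
    rcases ht.1.eq_or_lt with rfl | h0
    · exact ξ.sq_le_at_zero hT hK0.le (h ξ)
    · exact h ξ t ⟨h0, ht.2⟩
  have h2 : ξ.quad t ≤ 2 * Shakhov.energy N D t := by
    have h3 := sol.derivatives.bnd_sq_add_le_energy ht
    have h4 := ξ.integral_sq_nonneg ht.1
    change ξ.b t ^ 2 + ∫ s in (0 : ℝ)..t, ξ.b s ^ 2 ≤ _
    change 1 / 2 * ξ.b t ^ 2 + ∫ s in (0 : ℝ)..t, ξ.b s ^ 2 ≤ _ at h3
    linarith
  have h5 : ξ.quad t ^ 2 ≤ 4 * Shakhov.energy N D t ^ 2 := by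
    have := pow_le_pow_left₀ (ξ.quad_nonneg ht.1) h2 2
    linarith
  have h6 : K⁻¹ * ξ.b t ^ 2 ≤ ξ.micro t ^ 2 + ξ.quad t ^ 2 := by
    rwa [inv_mul_le_iff₀ hK0]
  simp only [Shakhov.integral_linearOp, Finset.sum_neg_distrib, ← Shakhov.bnd_sq]
  change -∑ α ∈ Shakhov.multiIndices 4 N, Shakhov.microSq (ξ.D α 0 t) ≤ -K⁻¹ * ξ.b t ^ 2 + _
  rw [← ξ.micro_sq]
  linarith
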